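/- **Setting.** Functions on $S^1$ are identified with $2\pi$-periodic functions on $\mathbb R$. An orientation-preserving circle diffeomorphism is represented by a lift: a smooth $f:\mathbb R\to\mathbb R$ with $f'>0$ and $f(x+2\pi)=f(x)+2\pi$. A Riemannian surface has an *ALH CSC end with mass-aspect function* $\mu$ if, in coordinates $(r,\varphi)\in(R,\infty)\times S^1$ on the end, its metric $g$ has scalar curvature $-2$ and its components in the frame $f_1=r^{-1}\partial_\varphi$, $f_2=r\partial_r$ satisfy, uniformly in $\varphi$, $g_{ij}-\delta_{ij}=r^{-2}\mu_{ij}(\varphi)+o(r^{-2})$ and $\partial_r g_{ij}=-2r^{-3}\mu_{ij}(\varphi)+o(r^{-3})$ with smooth $\mu_{ij}$; then $\mu=\mu_{22}+2\mu_{11}$. A circle diffeomorphism $f$ (an asymptotic symmetry) transforms $\mu$ to $$\mu_f=(f')^2\,\mu\circ f-2S(f),\qquad S(f)=\frac{f'''}{f'}-\frac32\Big(\frac{f''}{f'}\Big)^2 .$$ The Hill equation of $\mu$ is $\psi''=\frac{\mu}{4}\psi$. A normalised basis is a pair $\psi=(\psi_1,\psi_2)^T$ of solutions with $\psi_1'\psi_2-\psi_2'\psi_1=1$;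 its monodromy matrix $A$ is defined by $\psi(x+2\pi)=A\psi(x)$. Put $f^*\psi=(f')^{-1/2}\,\psi\circ f$ and $\sigma(x)=\sqrt2\,(\sin\frac x2,\cos\frac x2)^T$. **Maskit gluing.** Let $\mathbb D$ be the Poincaré disc with coordinates $(y_1,y_2)$, in whose polar coordinates the hyperbolic metric is $\frac{dr^2}{r^2+1}+r^2d\varphi^2$. Let $(\check M,\check g)$, $(\widehat M,\hat g)$ be Riemannian surfaces with ALH CSC ends, with mass-aspect functions $\check\mu_0$, $\hat\mu_0$ in given end coordinates. Suppose that, for some $0<\delta<1$, $\check M$ (resp. $\widehat M$) contains an isometrically embedded half-plane $\{y_1\ge0\}$ (resp. $\{y_1\le0\}$) of $\mathbb D$, together with its neighbourhood $\{y_1>-\delta\}$ (resp. $\{y_1<\delta\}$), such that near infinity the embedding is given by the polar coordinates of $\mathbb D$ being equal to the end coordinates, the collar of the end meets the embedded region only there, and closed parts $\{y_1\ge a\}$, $a>-\delta$ (resp. $\{y_1\le -a\}$) have closed images. Remove $\{y_1>0\}$ from $\check M$ and $\{y_1<0\}$ from $\widehat M$ and glue the remainders isometrically along the geodesic $\{y_1=0\}$;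 call the result $(M,g)$. **Theorem.** 1. $(M,g)$ has an ALH CSC end whose coordinates, and mass-aspect function $\mu$, are those of $\widehat M$ over $[-\frac\pi2,\frac\pi2]$ and those of $\check M$ over $[\frac\pi2,\frac{3\pi}2]$. 2. Suppose $\check\mu_0=\check\mu_{\check f}$ and $\hat\mu_0=\hat\mu_{\hat f}$ for smooth functions $\check\mu,\hat\mu$ on $S^1$ and circle diffeomorphisms $\check f,\hat f$. Let $\check\psi,\hat\psi$ be normalised bases for $\check\mu,\hat\mu$ with monodromy matrices $\check M_0,\hat M_0$. Then there are $\check R,\hat R\in SL(2,\mathbb R)$ with $\check f^*\check\psi=\check R\sigma$ on $[-\frac\pi2,\frac\pi2]$ and $\hat f^*\hat\psi=\hat R\sigma$ on $[\frac\pi2,\frac{3\pi}2]$, and a normalised basis $\psi$ for $\mu$ with $\psi=\check R^{-1}\check f^*\check\psi$ on $[\frac\pi2,\frac{3\pi}2]$ and $\psi=\hat R^{-1}\hat f^*\hat\psi$ on $[-\frac\pi2,\frac\pi2]$, whose monodromy matrix is $$\mathbf M=-\check{\mathbf M}\,\widehat{\mathbf M},\qquad \check{\mathbf M}=\check R^{-1}\check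 M_0\check R,\quad \widehat{\mathbf M}=\hat R^{-1}\hat M_0\hat R .$$ The monodromy matrix of any other normalised basis for $\mu$ is conjugate to $\mathbf M$ by a matrix of determinant one. 3. Suppose that the pieces have positive constant masses $\check m,\hat m>0$, i.e. $\check\mu_0=(\check m)_{\check f}$ and $\hat\mu_0=(\hat m)_{\hat f}$, where, with gluing parameters $\check\omega,\hat\omega>1$, the circle diffeomorphisms $\check f,\hat f$ satisfy $$\check f(x)=-\tfrac1{\sqrt{\check m}}\log\!\big(-\tan\tfrac x2+\check\omega\coth(\sqrt{\check m}\pi)\big)\ \text{ on }[-\tfrac\pi2,\tfrac\pi2],$$ $$\hat f(x)=-\tfrac1{\sqrt{\hat m}}\log\!\big(\cot\tfrac x2+\hat\omega\coth(\sqrt{\hat m}\pi)\big)\ \text{ on }[\tfrac\pi2,\tfrac{3\pi}2].$$ Take the bases $m^{-1/4}(e^{\sqrt m x/2},e^{-\sqrt m x/2})$, $m=\check m,\hat m$, which are normalised with monodromy matrices $\mathrm{diag}(e^{\sqrt m\pi},e^{-\sqrt m\pi})$. Then the basis $\psi$ and the formula $\mathbf M=-\check{\mathbf M}\widehat{\mathbf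 M}$ of item 2 hold with $\check R=\begin{pmatrix}0&1\\-1&\check c\end{pmatrix}$, $\check c=\check\omega\coth(\sqrt{\check m}\pi)$, and $\hat R=\begin{pmatrix}1&0\\\hat c&1\end{pmatrix}$, $\hat c=\hat\omega\coth(\sqrt{\hat m}\pi)$. The monodromy matrix of every normalised basis for $\mu$ has half-trace $$2\check\omega\hat\omega\cosh(\sqrt{\check m}\pi)\cosh(\sqrt{\hat m}\pi)-\cosh(\sqrt{\check m}\pi-\sqrt{\hat m}\pi)>1 .$$ There is a circle diffeomorphism transforming $\mu$ to a positive constant $m_c$; $m_c$ is the only constant to which $\mu$ can be so transformed, and $$\cosh(\sqrt{m_c}\,\pi)=2\check\omega\hat\omega\cosh(\sqrt{\check m}\pi)\cosh(\sqrt{\hat m}\pi)-\cosh(\sqrt{\check m}\pi-\sqrt{\hat m}\pi).$$ Equivalently, with entropies $S,\check S,\hat S$ equal to a quarter of the horizon lengths of the static solutions $du^2+m\cosh^2(u)\,d\varphi^2$ of masses $m=m_c,\check m,\hat m$, the horizon being $\{u=0\}$, so that $S=\frac{\pi\sqrt{m_c}}2$, and similarly for $\check S,\hat S$, $$\cosh(2S)=2\check\omega\hat\omega\cosh(2\check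 S)\cosh(2\hat S)-\cosh\big(2(\check S-\hat S)\big).$$ 4. All values occur: for all $\check m,\hat m>0$ and $\check\omega,\hat\omega>1$ there are pieces, a Maskit gluing of them, and diffeomorphisms $\check f,\hat f$ as in item 3. -/

import Mathlib

open scoped Manifold ContDiff Matrix

universe u v w

noncomputable section

/-! ### Hill's equation and the action of circle diffeomorphisms on mass-aspect functions

Functions on the circle are identified with `2π`-periodic functions on the real line. -/

/-- A smooth function on the circle. -/
structure IsCircleFunction (μ : ℝ → ℝ) : Prop where
  smooth : ContDiff ℝ ∞ μ
  periodic : ∀ x, μ (x + 2 * Real.pi) = μ x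

/-- The lift to the line of an orientation-preserving diffeomorphism of the circle. -/
structure IsCircleDiffeo (f : ℝ → ℝ) : Prop where
  smooth : ContDiff ℝ ∞ f
  deriv_pos : ∀ x, 0 < deriv f x
  equivariant : ∀ x, f (x + 2 * Real.pi) = f x + 2 * Real.pi

/-- The Schwarzian derivative. -/
def schwarzian (f : ℝ → ℝ) (x : ℝ) : ℝ :=
  iteratedDeriv 3 f x / deriv f x - 3 / 2 * (iteratedDeriv 2 f x / deriv f x) ^ 2

/-- The mass-aspect function `μ` transformed by the asymptotic symmetry `f`. -/
def massTransform (μ f : ℝ → ℝ) (x : ℝ) : ℝ :=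
  μ (f x) * deriv f x ^ 2 - 2 * schwarzian f x

/-- A pair of solutions of Hill's equation `ψ'' = (μ / 4) ψ` with Wronskian
`ψ₁' ψ₂ - ψ₂' ψ₁ = 1`. -/
structure IsHillBasis (μ : ℝ → ℝ) (ψ : ℝ → Fin 2 → ℝ) : Prop where
  smooth : ∀ i, ContDiff ℝ 2 (fun x => ψ x i)
  hill : ∀ i x, iteratedDeriv 2 (fun t => ψ t i) x = μ x / 4 * ψ x i
  wronskian : ∀ x,
    deriv (fun t => ψ t 0) x * ψ x 1 - deriv (fun t => ψ t 1) x * ψ x 0 = 1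

/-- `A` is the monodromy matrix of the pair `ψ`. -/
def IsMonodromy (ψ : ℝ → Fin 2 → ℝ) (A : Matrix (Fin 2) (Fin 2) ℝ) : Prop :=
  ∀ x, ψ (2 * Real.pi + x) = A *ᵥ ψ x

/-- The transformed pair `(f')^(-1/2) (ψ₁ ∘ f, ψ₂ ∘ f)`. -/
def hillPull (f : ℝ → ℝ) (ψ : ℝ → Fin 2 → ℝ) (x : ℝ) : Fin 2 → ℝ :=
  fun i => ψ (f x) i / Real.sqrt (deriv f x)

/-- The Wronskian-normalised pair `√2 (sin (x/2), cos (x/2))` of solutions for `μ = -1`. -/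
def halfAngleBasis (x : ℝ) : Fin 2 → ℝ :=
  ![Real.sqrt 2 * Real.sin (x / 2), Real.sqrt 2 * Real.cos (x / 2)]

/-- The Wronskian-normalised pair of exponential solutions for a constant `μ = m > 0`. -/
def expBasis (m : ℝ) (x : ℝ) : Fin 2 → ℝ :=
  ![Real.exp (Real.sqrt m * x / 2) / Real.sqrt (Real.sqrt m),
    Real.exp (-(Real.sqrt m * x / 2)) / Real.sqrt (Real.sqrt m)]

/-- The diagonal monodromy matrix of `expBasis m`. -/
def expMonodromy (m : ℝ) : Matrix (Fin 2) (Fin 2) ℝ :=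
  !![Real.exp (Real.sqrt m * Real.pi), 0; 0, Real.exp (-(Real.sqrt m * Real.pi))]

/-! ### Surfaces -/

/-- A smooth two-dimensional Riemannian manifold. -/
structure RiemannianSurface where
  carrier : Type u
  [top : TopologicalSpace carrier]
  [t2 : T2Space carrier]
  [secondCountable : SecondCountableTopology carrier]
  [charted : ChartedSpace (EuclideanSpace ℝ (Fin 2)) carrier]
  [manifold : IsManifold (𝓡 2) ∞ carrier]
  metric : Bundle.ContMDiffRiemannianMetric (𝓡 2) ∞ (EuclideanSpace ℝ (Fin 2))
    (fun x : carrier => TangentSpace (𝓡 2) x)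

attribute [instance] RiemannianSurface.top RiemannianSurface.t2
  RiemannianSurface.secondCountable RiemannianSurface.charted RiemannianSurface.manifold

/-- The pull-back to the plane of the metric of `S` by a map `e`. -/
def pullbackMetric (S : RiemannianSurface.{u}) (e : ℝ × ℝ → S.carrier) (p v w : ℝ × ℝ) : ℝ :=
  S.metric.inner (e p) (mfderiv 𝓘(ℝ, ℝ × ℝ) (𝓡 2) e p v) (mfderiv 𝓘(ℝ, ℝ × ℝ) (𝓡 2) e p w)

/-- The coordinate vector fields of the plane. -/
def coordVec (i : Fin 2) : ℝ × ℝ := ![(1, 0), (0, 1)] i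

/-- The partial derivative in the `i`-th coordinate. -/
def partialDeriv (i : Fin 2) (F : ℝ × ℝ → ℝ) (p : ℝ × ℝ) : ℝ := fderiv ℝ F p (coordVec i)

/-- The matrix of components of the pulled-back metric. -/
def metricMatrix (S : RiemannianSurface.{u}) (e : ℝ × ℝ → S.carrier) (p : ℝ × ℝ) :
    Matrix (Fin 2) (Fin 2) ℝ :=
  Matrix.of fun i j => pullbackMetric S e p (coordVec i) (coordVec j)

/-- The Christoffel symbol `Γᵏᵢⱼ` of a metric in coordinates. -/
def christoffel (g : ℝ × ℝ → Matrix (Fin 2) (Fin 2) ℝ) (k i j : Fin 2) (p : ℝ × ℝ) : ℝ :=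
  1 / 2 * ∑ l, (g p)⁻¹ k l * (partialDeriv i (fun q => g q l j) p +
    partialDeriv j (fun q => g q l i) p - partialDeriv l (fun q => g q i j) p)

/-- The Ricci tensor of a metric in coordinates. -/
def ricci (g : ℝ × ℝ → Matrix (Fin 2) (Fin 2) ℝ) (i j : Fin 2) (p : ℝ × ℝ) : ℝ :=
  ∑ k, (partialDeriv k (christoffel g k i j) p - partialDeriv j (christoffel g k i k) p) +
    ∑ k, ∑ l, (christoffel g k k l p * christoffel g l i j p -
      christoffel g k j l p * christoffel g l i k p)

/-- The scalar curvature of a metric in coordinates. -/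
def scalarCurvature (g : ℝ × ℝ → Matrix (Fin 2) (Fin 2) ℝ) (p : ℝ × ℝ) : ℝ :=
  ∑ i, ∑ j, (g p)⁻¹ i j * ricci g i j p

/-! ### Asymptotically locally hyperbolic ends

Coordinates are `p = (r, φ)`. Index `0` refers to `r` and index `1` to `φ`. -/

/-- The frame `(r ∂_r, r⁻¹ ∂_φ)`, orthonormal for the background `dr²/r² + r² dφ²`. -/
def frameVec (i : Fin 2) (p : ℝ × ℝ) : ℝ × ℝ := ![(p.1, 0), (0, p.1⁻¹)] i

/-- The frame components of the difference of the metric and the background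
`dr²/r² + r² dφ²`. -/
def metricError (S : RiemannianSurface.{u}) (e : ℝ × ℝ → S.carrier) (i j : Fin 2)
    (p : ℝ × ℝ) : ℝ :=
  pullbackMetric S e p (frameVec i p) (frameVec j p) - if i = j then 1 else 0

/-- The coordinates `e : (R, ∞) × S¹ → S` parametrise an asymptotically locally hyperbolic end
of scalar curvature `-2`, with mass-aspect function `μ`. -/
structure IsALHEnd (S : RiemannianSurface.{u}) (R : ℝ) (e : ℝ × ℝ → S.carrier) (μ : ℝ → ℝ) :
    Prop where
  R_pos : 0 < R
  smooth : ContMDiffOn 𝓘(ℝ, ℝ × ℝ) (𝓡 2) ∞ e {p | R < p.1}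
  periodic : ∀ r φ, e (r, φ + 2 * Real.pi) = e (r, φ)
  injective : ∀ p q : ℝ × ℝ, R < p.1 → R < q.1 → e p = e q →
    p.1 = q.1 ∧ ∃ k : ℤ, p.2 = q.2 + k * (2 * Real.pi)
  immersion : ∀ p : ℝ × ℝ, R < p.1 →
    Function.Injective (mfderiv 𝓘(ℝ, ℝ × ℝ) (𝓡 2) e p)
  closed : ∀ R', R < R' → IsClosed (e '' {p | R' ≤ p.1})
  curvature : ∀ p : ℝ × ℝ, R < p.1 → scalarCurvature (metricMatrix S e) p = -2
  massAspect : ∃ τ : Fin 2 → Fin 2 → ℝ → ℝ,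
    (∀ i j, IsCircleFunction (τ i j)) ∧
    (∀ i j, TendstoUniformly (fun r φ => r ^ 2 * metricError S e i j (r, φ)) (τ i j)
      Filter.atTop) ∧
    (∀ i j, TendstoUniformly
      (fun r φ => r ^ 3 * deriv (fun t => metricError S e i j (t, φ)) r)
      (fun φ => -2 * τ i j φ) Filter.atTop) ∧
    ∀ φ, μ φ = τ 0 0 φ + 2 * τ 1 1 φ

/-! ### Maskit gluing -/

/-- The open unit disc. -/
def unitDisc : Set (ℝ × ℝ) := {y | y.1 ^ 2 + y.2 ^ 2 < 1}

/-- The hyperbolic metric of the Poincaré disc. -/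
def poincareMetric (y v w : ℝ × ℝ) : ℝ :=
  4 / (1 - y.1 ^ 2 - y.2 ^ 2) ^ 2 * (v.1 * w.1 + v.2 * w.2)

/-- The point of the Poincaré disc with polar coordinates `(r, φ)`, in which the hyperbolic
metric is `dr²/(r² + 1) + r² dφ²`. -/
def discPolar (p : ℝ × ℝ) : ℝ × ℝ :=
  (p.1 / (1 + Real.sqrt (1 + p.1 ^ 2)) * Real.cos p.2,
    p.1 / (1 + Real.sqrt (1 + p.1 ^ 2)) * Real.sin p.2)

/-- The part `σ y₁ > a` of the disc. For `σ = 1, a = 0` and `σ = -1, a = 0` these are the two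
half-planes bounded by the geodesic `y₁ = 0`. -/
def discPart (σ a : ℝ) : Set (ℝ × ℝ) := {y | y ∈ unitDisc ∧ a < σ * y.1}

/-- The part `σ y₁ ≥ a` of the disc. -/
def discPartClosed (σ a : ℝ) : Set (ℝ × ℝ) := {y | y ∈ unitDisc ∧ a ≤ σ * y.1}

/-- The strip `|y₁| < δ` around the geodesic `y₁ = 0` of the disc. -/
def discStrip (δ : ℝ) : Set (ℝ × ℝ) := {y | y ∈ unitDisc ∧ |y.1| < δ}

/-- A Riemannian surface with an asymptotically locally hyperbolic end of scalar curvature `-2`,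
together with a half-plane `σ y₁ ≥ 0` of hyperbolic space, embedded isometrically with a
neighbourhood of its boundary; near infinity the embedding is given by the coordinates of the end.
The mass-aspect function `μ` refers to these coordinates. -/
structure MaskitPiece (σ δ : ℝ) extends RiemannianSurface.{u} where
  R : ℝ
  e : ℝ × ℝ → carrier
  μ : ℝ → ℝ
  isEnd : IsALHEnd toRiemannianSurface R e μ
  s : ℝ × ℝ → carrier
  δ_pos : 0 < δ
  δ_lt_one : δ < 1
  s_smooth : ContMDiffOn 𝓘(ℝ, ℝ × ℝ) (𝓡 2) ∞ s (discPart σ (-δ))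
  s_injOn : Set.InjOn s (discPart σ (-δ))
  s_isometry : ∀ y ∈ discPart σ (-δ), ∀ v w,
    pullbackMetric toRiemannianSurface s y v w = poincareMetric y v w
  s_closed : ∀ a, -δ < a → IsClosed (s '' discPartClosed σ a)
  s_eq_e : ∀ p : ℝ × ℝ, R < p.1 → discPolar p ∈ discPart σ (-δ) → s (discPolar p) = e p
  e_mem_s : ∀ p : ℝ × ℝ, R < p.1 → e p ∈ s '' discPart σ (-δ) → discPolar p ∈ discPart σ (-δ)

/-- The complement in a piece of the part `σ y₁ ≥ δ` of the embedded half-plane. -/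
def MaskitPiece.keep {σ δ : ℝ} (P : MaskitPiece.{u} σ δ) : Set P.carrier :=
  (P.s '' discPartClosed σ δ)ᶜ

/-- `j` is an isometric open embedding of the open set `U` of the surface `S` into `T`. -/
structure IsIsometricOpenEmbeddingOn (S : RiemannianSurface.{u}) (T : RiemannianSurface.{v})
    (U : Set S.carrier) (j : S.carrier → T.carrier) : Prop where
  smooth : ContMDiffOn (𝓡 2) (𝓡 2) ∞ j U
  openEmbedding : Topology.IsOpenEmbedding (U.domRestrict j)
  isometry : ∀ x ∈ U, ∀ v w : TangentSpace (𝓡 2) x,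
    T.metric.inner (j x) (mfderiv (𝓡 2) (𝓡 2) j x v) (mfderiv (𝓡 2) (𝓡 2) j x w) =
      S.metric.inner x v w

/-- The Maskit gluing of two pieces. From the first piece one removes the half-plane `y₁ > 0`, over
the arc `[-π/2, π/2]` of the conformal boundary, from the second one the half-plane `y₁ < 0`, over
the arc `[π/2, 3π/2]`, and the remainders are glued along the geodesic `y₁ = 0`. In terms of open
sets: slightly larger remainders are identified along the isometric strips `|y₁| < δ`. -/
structure MaskitGluing {δ : ℝ} (P : MaskitPiece.{u} 1 δ) (Q : MaskitPiece.{v} (-1) δ)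
    extends RiemannianSurface.{w} where
  jP : P.carrier → carrier
  jQ : Q.carrier → carrier
  jP_embedding :
    IsIsometricOpenEmbeddingOn P.toRiemannianSurface toRiemannianSurface P.keep jP
  jQ_embedding :
    IsIsometricOpenEmbeddingOn Q.toRiemannianSurface toRiemannianSurface Q.keep jQ
  cover : jP '' P.keep ∪ jQ '' Q.keep = Set.univ
  overlap : ∀ x ∈ P.keep, ∀ y ∈ Q.keep,
    (jP x = jQ y ↔ ∃ z ∈ discStrip δ, P.s z = x ∧ Q.s z = y)

namespace MaskitGluing

variable {δ : ℝ} {P : MaskitPiece.{u} 1 δ} {Q : MaskitPiece.{v} (-1) δ}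

/-- Coordinates near the conformal boundary of the glued surface: those of the second piece over
`[-π/2, π/2]` (where `cos φ ≥ 0`) and those of the first piece over `[π/2, 3π/2]`. -/
def e (G : MaskitGluing.{u, v, w} P Q) (p : ℝ × ℝ) : G.carrier :=
  if 0 ≤ Real.cos p.2 then G.jQ (Q.e p) else G.jP (P.e p)

/-- The function on the circle equal to the mass-aspect function of the second piece over
`[-π/2, π/2]` and to that of the first piece over `[π/2, 3π/2]`. -/
def μ (_G : MaskitGluing.{u, v, w} P Q) (φ : ℝ) : ℝ :=
  if 0 ≤ Real.cos φ then Q.μ φ else P.μ φ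

end MaskitGluing

/-! ### Gluing parameters, masses and entropy -/

/-- `κ coth (√m π)`. -/
def gluingConst (m κ : ℝ) : ℝ :=
  κ * (Real.cosh (Real.sqrt m * Real.pi) / Real.sinh (Real.sqrt m * Real.pi))

/-- `f` transforms the constant mass-aspect function `m` into `μ`, and has on `[-π/2, π/2]` the
normal form with gluing parameter `κ`. -/
structure IsFirstGauge (m κ : ℝ) (f μ : ℝ → ℝ) : Prop where
  diffeo : IsCircleDiffeo f
  transform : ∀ x, massTransform (fun _ => m) f x = μ x
  normalForm : ∀ x ∈ Set.Icc (-(Real.pi / 2)) (Real.pi / 2),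
    f x = -(1 / Real.sqrt m) * Real.log (-Real.tan (x / 2) + gluingConst m κ)

/-- `f` transforms the constant mass-aspect function `m` into `μ`, and has on `[π/2, 3π/2]` the
normal form with gluing parameter `κ`. -/
structure IsSecondGauge (m κ : ℝ) (f μ : ℝ → ℝ) : Prop where
  diffeo : IsCircleDiffeo f
  transform : ∀ x, massTransform (fun _ => m) f x = μ x
  normalForm : ∀ x ∈ Set.Icc (Real.pi / 2) (3 * Real.pi / 2),
    f x = -(1 / Real.sqrt m) * Real.log (Real.cot (x / 2) + gluingConst m κ)

/-- The matrix expressing the transformed exponential solutions of the first piece on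
`[-π/2, π/2]` through `halfAngleBasis`. -/
def firstMatrix (c : ℝ) : Matrix (Fin 2) (Fin 2) ℝ := !![0, 1; -1, c]

/-- The matrix expressing the transformed exponential solutions of the second piece on
`[π/2, 3π/2]` through `halfAngleBasis`. -/
def secondMatrix (c : ℝ) : Matrix (Fin 2) (Fin 2) ℝ := !![1, 0; c, 1]

/-- The metric `du² + m cosh² u dφ²` of the static solution of mass `m > 0`, in terms of the
distance `u` from the horizon. -/
def staticMetric (m : ℝ) (p v w : ℝ × ℝ) : ℝ :=
  v.1 * w.1 + m * Real.cosh p.1 ^ 2 * (v.2 * w.2)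

/-- The length of the horizon `u = 0` of the static solution of mass `m > 0`. -/
def horizonLength (m : ℝ) : ℝ :=
  ∫ φ in (0 : ℝ)..(2 * Real.pi), Real.sqrt (staticMetric m (0, φ) (0, 1) (0, 1))

/-- The entropy of the static black hole of mass `m > 0`: a quarter of the horizon length. -/
def entropy (m : ℝ) : ℝ := horizonLength m / 4

end

/-!
The theorem combines a local statement about metrics, a statement about Hill's equation on the circle,
and a construction of examples.

**The end.** Over the arc of its half-plane a piece is isometric to the hyperbolic plane, with the
same polar coordinates, so all coefficients of its asymptotic expansion agree there with those of
the hyperbolic plane, and its mass-aspect function is `-1` (`MaskitPiece.μ_eq_neg_one`). The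
coordinates of both pieces therefore fit together over the two arcs around `±π/2` where both are
hyperbolic. The glued coordinates are locally the composition of an isometric embedding with the
coordinates of one of the pieces, so every condition in the definition of an end is inherited
(`MaskitGluing.isALHEnd`). What remains of the geometry for items 2 and 3 is `IsGluedPotential`: the
potential coincides on complementary half-circles with those of the pieces, and the potential of each
piece is `-1` on a neighbourhood of the half-circle over which the other piece is used.

**Monodromy.** Two pairs of solutions of the same equation on an interval differ by the matrix of
their Wronskians, which is constant (`IsHillBasis.exists_eq_mulVec_on`); no existence theorem for
differential equations is needed. Where the potential is `-1`, a basis is thus a constant multiple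
`R σ` of the half-angle basis `σ`. After multiplication by the inverses of these matrices the bases
of the two pieces coincide with `σ` over complementary half-circles, hence with each other near the
points of gluing. Following the glued basis through a period gives the product of both monodromy
matrices; the sign comes from `σ (x + 2π) = -σ x` (`exists_glued_hillBasis`,
`IsGluedPotential.exists_glued`). For pieces of positive mass the matrices `R` are computed from the
normal forms (`IsFirstGauge.hillPull_eq`, `IsSecondGauge.hillPull_eq`), and the trace is an explicit
product (`IsGluedPotential.halfTrace`).

**The constant mass.** The glued monodromy is hyperbolic with positive eigenvalues `L`, `L⁻¹`. A Hill
basis `φ` that diagonalises it and has positive components is the transform of an exponential basis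
by the circle diffeomorphism `(π / log L) log (φ₀ / φ₁)`, whose inverse transforms the potential to a
constant (`exists_diffeo_to_const`). Positivity, which excludes the other orbits with the same
conjugacy class of monodromy, holds because the quotient of the two components of the glued basis
stays strictly between the slopes of the eigenvectors (`eigen_slope_bounds`,
`IsGluedPotential.exists_diffeo_to_const`). The constant is unique because a Hill basis determines its
potential, and among constant potentials the half-trace of the monodromy is above one only for
positive ones, where it is injective (`eq_of_const_halfTrace`).

**Examples.** A gluing parameter above one makes the increment of the normal form over the half-circle
smaller than `2π`, so it extends to a circle diffeomorphism which keeps the normal form on a larger arc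
(`exists_isFirstGauge`). A mass-aspect function `μ` equal to `-1` near the half-circle is realised on
the plane by changing only the angular part of the hyperbolic metric, with
`dr² / (1 + r²) + (r + ν (√(1 + r²) - r))² dφ²`, `ν = (μ + 1) / 2`, near infinity; the coefficient solves
the Jacobi equation, so the curvature is that of the hyperbolic plane (`scalarCurvature_of_jacobi`,
`AngularProfile.isALHEnd`). The changes for the two pieces have disjoint supports, and the sum of both
gives the glued surface (`AngularProfile.gluing`).
-/

noncomputable section

open Filter Topology

/-! ### Hill bases -/

namespace IsHillBasis

variable {μ ν : ℝ → ℝ} {ψ χ : ℝ → Fin 2 → ℝ}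

theorem hasDerivAt (h : IsHillBasis μ ψ) (i : Fin 2) (x : ℝ) :
    HasDerivAt (fun t => ψ t i) (deriv (fun t => ψ t i) x) x :=
  (((h.smooth i).differentiable (by norm_num)) x).hasDerivAt

theorem hasDerivAt_deriv (h : IsHillBasis μ ψ) (i : Fin 2) (x : ℝ) :
    HasDerivAt (deriv fun t => ψ t i) (μ x / 4 * ψ x i) x := by
  have h1 : ContDiff ℝ 1 (deriv fun t => ψ t i) :=
    ((contDiff_succ_iff_deriv (n := 1)).1 (h.smooth i)).2.2
  rw [← h.hill i x, iteratedDeriv_succ, iteratedDeriv_one]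
  exact (h1.differentiable (by norm_num) x).hasDerivAt

theorem of_hasDerivAt (hμ : Continuous μ) (ψ' : ℝ → Fin 2 → ℝ)
    (h1 : ∀ i x, HasDerivAt (fun t => ψ t i) (ψ' x i) x)
    (h2 : ∀ i x, HasDerivAt (fun t => ψ' t i) (μ x / 4 * ψ x i) x)
    (hw : ∀ x, ψ' x 0 * ψ x 1 - ψ' x 1 * ψ x 0 = 1) : IsHillBasis μ ψ := by
  have d1 : ∀ i, deriv (fun t => ψ t i) = fun t => ψ' t i := fun i => funext fun x => (h1 i x).deriv
  have d2 : ∀ i, deriv (fun t => ψ' t i) = fun t => μ t / 4 * ψ t i :=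
    fun i => funext fun x => (h2 i x).deriv
  have c0 : ∀ i, Continuous (fun t => ψ t i) := fun i =>
    continuous_iff_continuousAt.2 fun x => (h1 i x).continuousAt
  refine ⟨fun i => ?_, fun i x => ?_, fun x => ?_⟩
  · refine (contDiff_succ_iff_deriv (n := 1)).2 ⟨fun x => (h1 i x).differentiableAt, by simp, ?_⟩
    rw [d1]
    refine contDiff_one_iff_deriv.2 ⟨fun x => (h2 i x).differentiableAt, ?_⟩
    rw [d2]
    exact (hμ.div_const 4).mul (c0 i)
  · rw [iteratedDeriv_succ, iteratedDeriv_one, d1, d2]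
  · rw [d1, d1, hw]

/-- Hill bases which agree near a point have the same potential there, since a normalised pair has
no common zero. -/
theorem eq_potential_at (h : IsHillBasis μ ψ) (h' : IsHillBasis ν χ) {x : ℝ}
    (e : ψ =ᶠ[nhds x] χ) : μ x = ν x := by
  have hw := h.wronskian x
  have e : ∀ i, μ x / 4 * ψ x i = ν x / 4 * ψ x i := fun i => by
    have ei : (fun t => ψ t i) =ᶠ[nhds x] fun t => χ t i := e.mono fun t ht => by simp only [ht]
    rw [← h.hill i x, ei.iteratedDeriv_eq, h'.hill i x, e.eq_of_nhds]
  linear_combination 4 * (deriv (fun t => ψ t 0) x * e 1 - deriv (fun t => ψ t 1) x * e 0)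
    - (μ x - ν x) * hw

theorem eq_potential (h : IsHillBasis μ ψ) (h' : IsHillBasis ν ψ) : μ = ν :=
  funext fun _ => h.eq_potential_at h' Filter.EventuallyEq.rfl

theorem congr_potential (h : IsHillBasis μ ψ) (e : ∀ x, μ x = ν x) : IsHillBasis ν ψ :=
  (funext e : μ = ν) ▸ h

/-- A Hill basis is smooth if the potential is. -/
theorem contDiff (h : IsHillBasis μ ψ) (hμ : ContDiff ℝ ∞ μ) (i : Fin 2) :
    ContDiff ℝ ∞ (fun t => ψ t i) := by
  have key : ∀ n : ℕ, ContDiff ℝ n (fun t => ψ t i) ∧ ContDiff ℝ n (deriv fun t => ψ t i) := by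
    intro n
    induction n with
    | zero =>
      refine ⟨(h.smooth i).of_le (by simp), contDiff_zero.2 ?_⟩
      exact (h.smooth i).continuous_deriv (by norm_num)
    | succ n ih =>
      refine ⟨?_, ?_⟩
      · exact (contDiff_succ_iff_deriv (n := (n : WithTop ℕ∞))).2
          ⟨fun x => (h.hasDerivAt i x).differentiableAt, by simp, ih.2⟩
      · refine (contDiff_succ_iff_deriv (n := (n : WithTop ℕ∞))).2
          ⟨fun x => (h.hasDerivAt_deriv i x).differentiableAt, by simp, ?_⟩
        have : deriv (deriv fun t => ψ t i) = fun x => μ x / 4 * ψ x i :=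
          funext fun x => (h.hasDerivAt_deriv i x).deriv
        rw [this]
        exact ((hμ.of_le (by exact_mod_cast le_top)).div_const 4).mul ih.1
  exact contDiff_infty.2 fun n => (key n).1

theorem continuous_potential (h : IsHillBasis μ ψ) : Continuous μ := by
  have e : μ = fun x => 4 * (deriv (fun t => ψ t 0) x * iteratedDeriv 2 (fun t => ψ t 1) x
      - deriv (fun t => ψ t 1) x * iteratedDeriv 2 (fun t => ψ t 0) x) := by
    funext x
    rw [h.hill, h.hill]
    linear_combination (-μ x) * h.wronskian x
  rw [e]
  have c1 : ∀ i, Continuous (deriv fun t => ψ t i) := fun i =>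
    (h.smooth i).continuous_deriv (by norm_num)
  have c2 : ∀ i, Continuous (iteratedDeriv 2 fun t => ψ t i) := fun i =>
    (h.smooth i).continuous_iteratedDeriv 2 (by norm_num)
  have := c1 0; have := c1 1; have := c2 0; have := c2 1
  fun_prop

theorem mulVec (h : IsHillBasis μ ψ) {B : Matrix (Fin 2) (Fin 2) ℝ} (hB : B.det = 1) :
    IsHillBasis μ (fun x => B *ᵥ ψ x) := by
  refine of_hasDerivAt h.continuous_potential
    (fun x => B *ᵥ fun i => deriv (fun t => ψ t i) x) (fun i x => ?_) (fun i x => ?_) (fun x => ?_)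
  · simp only [Matrix.mulVec, dotProduct, Fin.sum_univ_two]
    exact ((h.hasDerivAt 0 x).const_mul _).add ((h.hasDerivAt 1 x).const_mul _)
  · simp only [Matrix.mulVec, dotProduct, Fin.sum_univ_two]
    refine (((h.hasDerivAt_deriv 0 x).const_mul _).add
      ((h.hasDerivAt_deriv 1 x).const_mul _)).congr_deriv ?_
    ring
  · rw [Matrix.det_fin_two] at hB
    simp only [Matrix.mulVec, dotProduct, Fin.sum_univ_two]
    linear_combination (deriv (fun t => ψ t 0) x * ψ x 1 - deriv (fun t => ψ t 1) x * ψ x 0) * hB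
      + h.wronskian x

theorem comp_add_const (h : IsHillBasis μ ψ) (a : ℝ) :
    IsHillBasis (fun x => μ (x + a)) (fun x => ψ (x + a)) :=
  of_hasDerivAt (h.continuous_potential.comp (continuous_add_const a))
    (fun x i => deriv (fun t => ψ t i) (x + a))
    (fun i x => (h.hasDerivAt i (x + a)).comp_add_const x a)
    (fun i x => (h.hasDerivAt_deriv i (x + a)).comp_add_const x a)
    (fun x => h.wronskian (x + a))

/-- Being a Hill basis is a local property. -/
theorem of_locally (hμ : Continuous μ)
    (h : ∀ x, ∃ (ν : ℝ → ℝ) (χ : ℝ → Fin 2 → ℝ), IsHillBasis ν χ ∧ ψ =ᶠ[nhds x] χ ∧ μ x = ν x) :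
    IsHillBasis μ ψ := by
  have hc : ∀ {χ : ℝ → Fin 2 → ℝ} {x : ℝ} (i : Fin 2), ψ =ᶠ[nhds x] χ →
      (fun t => ψ t i) =ᶠ[nhds x] fun t => χ t i := fun i e => e.mono fun t ht => by simp only [ht]
  refine of_hasDerivAt hμ (fun x i => deriv (fun t => ψ t i) x) (fun i x => ?_) (fun i x => ?_)
    (fun x => ?_)
  · obtain ⟨ν, χ, hχ, e, -⟩ := h x
    rw [(hc i e).deriv_eq]
    exact (hχ.hasDerivAt i x).congr_of_eventuallyEq (hc i e)
  · obtain ⟨ν, χ, hχ, e, e'⟩ := h x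
    rw [e', e.eq_of_nhds]
    exact (hχ.hasDerivAt_deriv i x).congr_of_eventuallyEq (hc i e).deriv
  · obtain ⟨ν, χ, hχ, e, -⟩ := h x
    rw [(hc 0 e).deriv_eq, (hc 1 e).deriv_eq, e.eq_of_nhds]
    exact hχ.wronskian x

/-- Bases of solutions of the same equation on an interval differ by a constant matrix there.
The entries of the matrix are Wronskians of the two bases. -/
theorem exists_eq_mulVec_on (h : IsHillBasis μ χ) (h' : IsHillBasis ν ψ) {s : Set ℝ}
    (hs : Convex ℝ s) (hne : s.Nonempty) (e : ∀ x ∈ s, μ x = ν x) :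
    ∃ R : Matrix (Fin 2) (Fin 2) ℝ, R.det = 1 ∧ ∀ x ∈ s, χ x = R *ᵥ ψ x := by
  obtain ⟨x₀, hx₀⟩ := hne
  set d : Fin 2 → ℝ → ℝ := fun i => deriv fun t => χ t i with hd
  set d' : Fin 2 → ℝ → ℝ := fun i => deriv fun t => ψ t i with hd'
  have hw : ∀ x, d 0 x * χ x 1 - d 1 x * χ x 0 = 1 := h.wronskian
  have hw' : ∀ x, d' 0 x * ψ x 1 - d' 1 x * ψ x 0 = 1 := h'.wronskian
  -- the Wronskian of two solutions is constant on `s`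
  have key : ∀ i j, ∀ x ∈ s, d i x * ψ x j - χ x i * d' j x =
      d i x₀ * ψ x₀ j - χ x₀ i * d' j x₀ := by
    intro i j x hx
    have hder : ∀ y ∈ s, HasDerivWithinAt (fun y => d i y * ψ y j - χ y i * d' j y) 0 s y := by
      intro y hy
      refine (((h.hasDerivAt_deriv i y).mul (h'.hasDerivAt j y)).sub
        ((h.hasDerivAt i y).mul (h'.hasDerivAt_deriv j y))).hasDerivWithinAt.congr_deriv ?_
      rw [e y hy]
      ring
    have := hs.norm_image_sub_le_of_norm_hasDerivWithin_le (C := 0) hder (by simp) hx₀ hx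
    rw [zero_mul, norm_le_zero_iff, sub_eq_zero] at this
    exact this
  refine ⟨!![d 0 x₀ * ψ x₀ 1 - χ x₀ 0 * d' 1 x₀, -(d 0 x₀ * ψ x₀ 0 - χ x₀ 0 * d' 0 x₀);
    d 1 x₀ * ψ x₀ 1 - χ x₀ 1 * d' 1 x₀, -(d 1 x₀ * ψ x₀ 0 - χ x₀ 1 * d' 0 x₀)], ?_, ?_⟩
  · rw [Matrix.det_fin_two_of]
    linear_combination (d' 0 x₀ * ψ x₀ 1 - d' 1 x₀ * ψ x₀ 0) * hw x₀ + hw' x₀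
  · intro x hx
    rw [← key 0 0 x hx, ← key 0 1 x hx, ← key 1 0 x hx, ← key 1 1 x hx]
    ext i
    fin_cases i
    · simp [Matrix.mulVec, dotProduct, Fin.sum_univ_two]
      linear_combination (-χ x 0) * hw' x
    · simp [Matrix.mulVec, dotProduct, Fin.sum_univ_two]
      linear_combination (-χ x 1) * hw' x

theorem exists_eq_mulVec (h : IsHillBasis μ χ) (h' : IsHillBasis μ ψ) :
    ∃ R : Matrix (Fin 2) (Fin 2) ℝ, R.det = 1 ∧ ∀ x, χ x = R *ᵥ ψ x := by
  obtain ⟨R, h1, h2⟩ := h.exists_eq_mulVec_on h' convex_univ Set.univ_nonempty fun _ _ => rfl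
  exact ⟨R, h1, fun x => h2 x trivial⟩

/-- A matrix is determined by its action on a Hill basis on an open set. -/
theorem matrix_eq (h : IsHillBasis μ ψ) {A B : Matrix (Fin 2) (Fin 2) ℝ} {s : Set ℝ}
    (hs : IsOpen s) (hne : s.Nonempty) (e : ∀ x ∈ s, A *ᵥ ψ x = B *ᵥ ψ x) : A = B := by
  obtain ⟨x, hx⟩ := hne
  have hw := h.wronskian x
  have ee : ∀ i, (A i 0 - B i 0) * ψ x 0 + (A i 1 - B i 1) * ψ x 1 = 0 := fun i => by
    have := congrFun (e x hx) i
    simp only [Matrix.mulVec, dotProduct, Fin.sum_univ_two] at this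
    linear_combination this
  have ed : ∀ i, (A i 0 - B i 0) * deriv (fun t => ψ t 0) x
      + (A i 1 - B i 1) * deriv (fun t => ψ t 1) x = 0 := fun i => by
    have h1 := ((h.hasDerivAt 0 x).const_mul (A i 0 - B i 0)).add
      ((h.hasDerivAt 1 x).const_mul (A i 1 - B i 1))
    refine h1.unique ((hasDerivAt_const x (0 : ℝ)).congr_of_eventuallyEq ?_)
    filter_upwards [hs.mem_nhds hx] with y hy
    have := congrFun (e y hy) i
    simp only [Matrix.mulVec, dotProduct, Fin.sum_univ_two] at this
    simp only [Pi.add_apply]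
    linear_combination this
  ext i j
  have h0 : A i 0 - B i 0 = 0 := by
    linear_combination (-(A i 0 - B i 0)) * hw + ψ x 1 * ed i - deriv (fun t => ψ t 1) x * ee i
  have h1 : A i 1 - B i 1 = 0 := by
    linear_combination (-(A i 1 - B i 1)) * hw - ψ x 0 * ed i + deriv (fun t => ψ t 0) x * ee i
  fin_cases j
  · exact sub_eq_zero.1 h0
  · exact sub_eq_zero.1 h1

theorem monodromy_det (h : IsHillBasis μ ψ) {A : Matrix (Fin 2) (Fin 2) ℝ}
    (hA : IsMonodromy ψ A) : A.det = 1 := by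
  have hA0 : ∀ i x, ψ (2 * Real.pi + x) i = A i 0 * ψ x 0 + A i 1 * ψ x 1 := fun i x => by
    rw [hA x]; simp [Matrix.mulVec, dotProduct, Fin.sum_univ_two]
  have hA1 : ∀ i, deriv (fun t => ψ t i) (2 * Real.pi + 0) =
      A i 0 * deriv (fun t => ψ t 0) 0 + A i 1 * deriv (fun t => ψ t 1) 0 := fun i => by
    have h1 : HasDerivAt (fun x => ψ (2 * Real.pi + x) i) _ 0 :=
      (h.hasDerivAt i (2 * Real.pi + 0)).comp_const_add (2 * Real.pi) 0
    refine h1.unique ?_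
    simp only [hA0]
    exact ((h.hasDerivAt 0 0).const_mul _).add ((h.hasDerivAt 1 0).const_mul _)
  have w := h.wronskian (2 * Real.pi + 0)
  have w0 := h.wronskian 0
  rw [hA1, hA1, hA0, hA0] at w
  rw [Matrix.det_fin_two]
  linear_combination w - (A 0 0 * A 1 1 - A 0 1 * A 1 0) * w0

end IsHillBasis

theorem IsMonodromy.mulVec {ψ : ℝ → Fin 2 → ℝ} {A B : Matrix (Fin 2) (Fin 2) ℝ}
    (h : IsMonodromy ψ A) (hB : B.det = 1) : IsMonodromy (fun x => B *ᵥ ψ x) (B * A * B⁻¹) := by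
  intro x
  have hu : IsUnit B.det := by rw [hB]; exact isUnit_one
  simp only [Matrix.mulVec_mulVec, h x]
  rw [mul_assoc, Matrix.nonsing_inv_mul _ hu, mul_one]

/-- The monodromy matrices of two bases for the same potential are conjugate. -/
theorem IsHillBasis.monodromy_conj {μ : ℝ → ℝ} {ψ χ : ℝ → Fin 2 → ℝ}
    {A M : Matrix (Fin 2) (Fin 2) ℝ} (h : IsHillBasis μ χ) (h' : IsHillBasis μ ψ)
    (hA : IsMonodromy χ A) (hM : IsMonodromy ψ M) :
    ∃ B : Matrix (Fin 2) (Fin 2) ℝ, B.det = 1 ∧ A = B⁻¹ * M * B := by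
  obtain ⟨R, hR, e⟩ := h.exists_eq_mulVec h'
  have hu : IsUnit R.det := by rw [hR]; exact isUnit_one
  refine ⟨R⁻¹, by rw [Matrix.det_nonsing_inv, hR, Ring.inverse_one], ?_⟩
  rw [Matrix.nonsing_inv_nonsing_inv _ hu]
  refine h.matrix_eq isOpen_univ Set.univ_nonempty fun x _ => ?_
  have e' : χ = fun x => R *ᵥ ψ x := funext e
  rw [← hA x]
  have := hM.mulVec hR x
  rw [← e'] at this
  exact this

theorem IsHillBasis.monodromy_trace_eq {μ : ℝ → ℝ} {ψ χ : ℝ → Fin 2 → ℝ}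
    {A M : Matrix (Fin 2) (Fin 2) ℝ} (h : IsHillBasis μ χ) (h' : IsHillBasis μ ψ)
    (hA : IsMonodromy χ A) (hM : IsMonodromy ψ M) : A.trace = M.trace := by
  obtain ⟨B, hB, rfl⟩ := h.monodromy_conj h' hA hM
  have hu : IsUnit B.det := by rw [hB]; exact isUnit_one
  rw [Matrix.trace_mul_comm, ← mul_assoc, Matrix.mul_nonsing_inv _ hu, one_mul]

/-! ### The action of circle diffeomorphisms -/

namespace IsCircleDiffeo

variable {f : ℝ → ℝ}

theorem differentiableAt (hf : IsCircleDiffeo f) (x : ℝ) : DifferentiableAt ℝ f x :=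
  hf.smooth.differentiable (by simp) x

theorem strictMono (hf : IsCircleDiffeo f) : StrictMono f :=
  strictMono_of_deriv_pos hf.deriv_pos

theorem contDiff_deriv (hf : IsCircleDiffeo f) : ContDiff ℝ ∞ (deriv f) :=
  (contDiff_infty_iff_deriv.1 hf.smooth).2

theorem deriv_periodic (hf : IsCircleDiffeo f) (x : ℝ) :
    deriv f (x + 2 * Real.pi) = deriv f x := by
  rw [← deriv_comp_add_const]
  have : (fun x => f (x + 2 * Real.pi)) = fun x => f x + 2 * Real.pi := funext hf.equivariant
  rw [this, deriv_add_const]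

end IsCircleDiffeo

theorem schwarzian_contDiff {f : ℝ → ℝ} (hf : IsCircleDiffeo f) : ContDiff ℝ ∞ (schwarzian f) := by
  have h : ∀ n, ContDiff ℝ ∞ (iteratedDeriv n f) := fun n => by
    rw [iteratedDeriv_eq_iterate]
    exact hf.smooth.iterate_deriv n
  have h0 : ∀ x, deriv f x ≠ 0 := fun x => (hf.deriv_pos x).ne'
  have e : schwarzian f = fun x => iteratedDeriv 3 f x / deriv f x
    - 3 / 2 * (iteratedDeriv 2 f x / deriv f x) ^ 2 := rfl
  rw [e]
  exact ((h 3).div hf.contDiff_deriv h0).sub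
    (contDiff_const.mul (((h 2).div hf.contDiff_deriv h0).pow 2))

theorem massTransform_contDiff {μ f : ℝ → ℝ} (hμ : ContDiff ℝ ∞ μ) (hf : IsCircleDiffeo f) :
    ContDiff ℝ ∞ (massTransform μ f) :=
  ((hμ.comp hf.smooth).mul (hf.contDiff_deriv.pow 2)).sub
    (contDiff_const.mul (schwarzian_contDiff hf))

/-- The pull-back of a Hill basis by a diffeomorphism is a Hill basis for the transformed
potential. -/
theorem IsHillBasis.hillPull {μ f : ℝ → ℝ} {ψ : ℝ → Fin 2 → ℝ} (h : IsHillBasis μ ψ)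
    (hf : IsCircleDiffeo f) : IsHillBasis (massTransform μ f) (hillPull f ψ) := by
  -- the square root `s` of `f'` and its derivatives
  set s : ℝ → ℝ := fun x => √(deriv f x) with hs
  have hpos : ∀ x, 0 < s x := fun x => Real.sqrt_pos.2 (hf.deriv_pos x)
  have hsq : ∀ x, s x ^ 2 = deriv f x := fun x => Real.sq_sqrt (hf.deriv_pos x).le
  have hsm : ContDiff ℝ ∞ s := hf.contDiff_deriv.sqrt fun x => (hf.deriv_pos x).ne'
  have hsm' : ContDiff ℝ ∞ (deriv s) := (contDiff_infty_iff_deriv.1 hsm).2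
  have d0 : ∀ x, HasDerivAt f (s x ^ 2) x := fun x => by
    rw [hsq]; exact (hf.differentiableAt x).hasDerivAt
  have d1 : ∀ x, HasDerivAt s (deriv s x) x := fun x =>
    (hsm.differentiable (by simp) x).hasDerivAt
  have d2 : ∀ x, HasDerivAt (deriv s) (deriv (deriv s) x) x := fun x =>
    (hsm'.differentiable (by simp) x).hasDerivAt
  have e1 : deriv f = fun x => s x ^ 2 := funext fun x => (hsq x).symm
  have e2 : iteratedDeriv 2 f = fun x => 2 * s x * deriv s x := by
    rw [iteratedDeriv_succ, iteratedDeriv_one, e1]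
    funext x
    refine (((d1 x).pow 2).congr_deriv ?_).deriv
    norm_num
  have e3 : iteratedDeriv 3 f = fun x => 2 * (deriv s x ^ 2 + s x * deriv (deriv s) x) := by
    rw [iteratedDeriv_succ, e2]
    funext x
    refine ((((d1 x).const_mul 2).mul (d2 x)).congr_deriv ?_).deriv
    ring
  have hS : ∀ x, schwarzian f x = 2 * (deriv (deriv s) x / s x) - 4 * (deriv s x / s x) ^ 2 := by
    intro x
    have := (hpos x).ne'
    rw [schwarzian, e3, e2, e1]
    field_simp
    ring
  refine IsHillBasis.of_hasDerivAt ?_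
    (fun x i => deriv (fun t => ψ t i) (f x) * s x - ψ (f x) i * deriv s x / s x ^ 2)
    (fun i x => ?_) (fun i x => ?_) (fun x => ?_)
  · have hc : Continuous μ := h.continuous_potential
    exact ((hc.comp hf.smooth.continuous).mul (hf.contDiff_deriv.continuous.pow 2)).sub
      (continuous_const.mul (schwarzian_contDiff hf).continuous)
  · have := (hpos x).ne'
    refine (((h.hasDerivAt i (f x)).comp x (d0 x)).div (d1 x) this).congr_deriv ?_
    simp only [Function.comp]
    field_simp
  · have hn := (hpos x).ne'
    refine (((((h.hasDerivAt_deriv i (f x)).comp x (d0 x)).mul (d1 x)).sub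
      ((((h.hasDerivAt i (f x)).comp x (d0 x)).mul (d2 x)).div ((d1 x).pow 2)
        (pow_ne_zero 2 hn)))).congr_deriv ?_
    simp only [Function.comp, Pi.pow_apply, Pi.mul_apply, massTransform, hS, _root_.hillPull, e1, Real.sqrt_sq (hpos x).le]
    field_simp
    ring
  · have hn := (hpos x).ne'
    simp only [_root_.hillPull, e1, Real.sqrt_sq (hpos x).le]
    have := h.wronskian (f x)
    field_simp
    linear_combination s x ^ 3 * this

theorem IsMonodromy.hillPull {f : ℝ → ℝ} {ψ : ℝ → Fin 2 → ℝ} {A : Matrix (Fin 2) (Fin 2) ℝ}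
    (h : IsMonodromy ψ A) (hf : IsCircleDiffeo f) : IsMonodromy (hillPull f ψ) A := by
  intro x
  have e : ∀ x, _root_.hillPull f ψ x = (√(deriv f x))⁻¹ • ψ (f x) := fun x => by
    ext i
    simp [_root_.hillPull, div_eq_inv_mul]
  rw [e, e, add_comm, hf.deriv_periodic, hf.equivariant, add_comm, h, Matrix.mulVec_smul]

/-- The action on pairs of functions is compatible with composition. -/
theorem hillPull_hillPull {f g : ℝ → ℝ} (hf : IsCircleDiffeo f) (hg : IsCircleDiffeo g)
    (ψ : ℝ → Fin 2 → ℝ) : hillPull g (hillPull f ψ) = hillPull (f ∘ g) ψ := by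
  funext x i
  have : deriv (f ∘ g) x = deriv f (g x) * deriv g x :=
    ((hf.differentiableAt (g x)).hasDerivAt.comp x (hg.differentiableAt x).hasDerivAt).deriv
  simp only [hillPull, this, Function.comp, Real.sqrt_mul (hf.deriv_pos (g x)).le, div_div]

/-! ### Constant potentials -/

theorem sqrt_sqrt_mul_self {m : ℝ} : √(√m) * √(√m) = √m := Real.mul_self_sqrt (Real.sqrt_nonneg m)

theorem expBasis_isHillBasis {m : ℝ} (hm : 0 < m) : IsHillBasis (fun _ => m) (expBasis m) := by
  have h1 : 0 < √m := Real.sqrt_pos.2 hm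
  have h2 : 0 < √(√m) := Real.sqrt_pos.2 h1
  have e1 : √m * √m = m := Real.mul_self_sqrt hm.le
  have e2 := sqrt_sqrt_mul_self (m := m)
  have dl : ∀ x, HasDerivAt (fun x => √m * x / 2) (√m / 2) x := fun x => by
    simpa using ((hasDerivAt_id x).const_mul √m).div_const 2
  refine IsHillBasis.of_hasDerivAt continuous_const
    (fun x => ![√m / 2 * (Real.exp (√m * x / 2) / √(√m)),
      -(√m / 2) * (Real.exp (-(√m * x / 2)) / √(√m))]) (fun i x => ?_) (fun i x => ?_) (fun x => ?_)
  · fin_cases i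
    · simp only [expBasis, Fin.zero_eta, Matrix.cons_val_zero]
      exact (((dl x).exp).div_const _).congr_deriv (by ring)
    · simp only [expBasis, Fin.mk_one, Matrix.cons_val_one, Matrix.cons_val_fin_one]
      exact ((((dl x).neg).exp).div_const _).congr_deriv (by simp only [Pi.neg_apply]; ring)
  · fin_cases i
    · simp only [expBasis, Fin.zero_eta, Matrix.cons_val_zero]
      refine ((((dl x).exp).div_const _).const_mul _).congr_deriv ?_
      linear_combination (Real.exp (√m * x / 2) / √(√m) / 4) * e1
    · simp only [expBasis, Fin.mk_one, Matrix.cons_val_one, Matrix.cons_val_fin_one]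
      refine (((((dl x).neg).exp).div_const _).const_mul _).congr_deriv ?_
      linear_combination (Real.exp (-(√m * x / 2)) / √(√m) / 4) * e1
  · simp only [expBasis, Matrix.cons_val_zero, Matrix.cons_val_one, Matrix.cons_val_fin_one]
    have e3 : Real.exp (√m * x / 2) * Real.exp (-(√m * x / 2)) = 1 := by
      rw [← Real.exp_add, add_neg_cancel, Real.exp_zero]
    field_simp
    linear_combination (2 * √m) * e3 - 2 * e2

theorem expBasis_isMonodromy (m : ℝ) : IsMonodromy (expBasis m) (expMonodromy m) := by
  intro x
  have e1 : √m * (2 * Real.pi + x) / 2 = √m * Real.pi + √m * x / 2 := by ring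
  ext i
  fin_cases i
  · simp [expBasis, expMonodromy, Matrix.mulVec, dotProduct, Fin.sum_univ_two, e1, Real.exp_add]
    ring
  · simp [expBasis, expMonodromy, Matrix.mulVec, dotProduct, Fin.sum_univ_two, e1, Real.exp_add]
    ring

/-- The pair `k^(-1/2) (sin (k x), cos (k x))`. -/
def trigBasis (k : ℝ) (x : ℝ) : Fin 2 → ℝ := ![Real.sin (k * x) / √k, Real.cos (k * x) / √k]

theorem trigBasis_isHillBasis {k : ℝ} (hk : 0 < k) :
    IsHillBasis (fun _ => -(4 * k ^ 2)) (trigBasis k) := by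
  have h1 : 0 < √k := Real.sqrt_pos.2 hk
  have e1 : √k * √k = k := Real.mul_self_sqrt hk.le
  have dl : ∀ x, HasDerivAt (fun x => k * x) k x := fun x => by
    simpa using (hasDerivAt_id x).const_mul k
  refine IsHillBasis.of_hasDerivAt continuous_const
    (fun x => ![k * (Real.cos (k * x) / √k), -k * (Real.sin (k * x) / √k)])
    (fun i x => ?_) (fun i x => ?_) (fun x => ?_)
  · fin_cases i
    · simp only [trigBasis, Fin.zero_eta, Matrix.cons_val_zero]
      exact (((dl x).sin).div_const _).congr_deriv (by ring)
    · simp only [trigBasis, Fin.mk_one, Matrix.cons_val_one, Matrix.cons_val_fin_one]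
      exact (((dl x).cos).div_const _).congr_deriv (by ring)
  · fin_cases i
    · simp only [trigBasis, Fin.zero_eta, Matrix.cons_val_zero]
      exact ((((dl x).cos).div_const _).const_mul _).congr_deriv (by ring)
    · simp only [trigBasis, Fin.mk_one, Matrix.cons_val_one, Matrix.cons_val_fin_one]
      exact ((((dl x).sin).div_const _).const_mul _).congr_deriv (by ring)
  · simp only [trigBasis, Matrix.cons_val_zero, Matrix.cons_val_one, Matrix.cons_val_fin_one]
    field_simp
    linear_combination k * Real.sin_sq_add_cos_sq (k * x) - e1

theorem trigBasis_isMonodromy (k : ℝ) : IsMonodromy (trigBasis k)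
    !![Real.cos (2 * Real.pi * k), Real.sin (2 * Real.pi * k);
      -Real.sin (2 * Real.pi * k), Real.cos (2 * Real.pi * k)] := by
  intro x
  have e1 : k * (2 * Real.pi + x) = 2 * Real.pi * k + k * x := by ring
  ext i
  fin_cases i
  · simp [trigBasis, Matrix.mulVec, dotProduct, Fin.sum_univ_two, e1, Real.sin_add]
    ring
  · simp [trigBasis, Matrix.mulVec, dotProduct, Fin.sum_univ_two, e1, Real.cos_add]
    ring

theorem halfAngleBasis_eq_trigBasis : halfAngleBasis = trigBasis (1 / 2) := by
  have h : √(1 / 2 : ℝ) = (√2)⁻¹ := by rw [one_div, Real.sqrt_inv]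
  funext x i
  fin_cases i <;> simp [halfAngleBasis, trigBasis] <;>
    rw [show x / 2 = 2⁻¹ * x by ring] <;> ring

theorem halfAngleBasis_isHillBasis : IsHillBasis (fun _ => -1) halfAngleBasis := by
  rw [halfAngleBasis_eq_trigBasis]
  exact (trigBasis_isHillBasis (k := 1 / 2) (by norm_num)).congr_potential fun _ => by norm_num

theorem halfAngleBasis_add_two_pi (x : ℝ) :
    halfAngleBasis (x + 2 * Real.pi) = -halfAngleBasis x := by
  have e : (x + 2 * Real.pi) / 2 = x / 2 + Real.pi := by ring
  ext i
  fin_cases i <;> simp [halfAngleBasis, e]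

/-- The pair `(x, 1)` of affine functions. -/
def affineBasis (x : ℝ) : Fin 2 → ℝ := ![x, 1]

theorem affineBasis_isHillBasis : IsHillBasis (fun _ => 0) affineBasis := by
  refine IsHillBasis.of_hasDerivAt continuous_const (fun _ => ![1, 0])
    (fun i x => ?_) (fun i x => ?_) (fun x => ?_)
  · fin_cases i
    · simpa [affineBasis] using hasDerivAt_id' x
    · simpa [affineBasis] using hasDerivAt_const x (1 : ℝ)
  · fin_cases i
    · simpa [affineBasis] using hasDerivAt_const x (1 : ℝ)
    · simpa [affineBasis] using hasDerivAt_const x (0 : ℝ)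
  · simp [affineBasis]

theorem affineBasis_isMonodromy : IsMonodromy affineBasis !![1, 2 * Real.pi; 0, 1] := by
  intro x
  ext i
  fin_cases i
  · simp [affineBasis, Matrix.mulVec, dotProduct, Fin.sum_univ_two, add_comm]
  · simp [affineBasis, Matrix.mulVec, dotProduct, Fin.sum_univ_two]

/-- Among the constant potentials only positive ones have monodromy of half-trace above one, and
the half-trace then determines the constant. -/
theorem eq_of_const_halfTrace {m mc : ℝ} (hmc : 0 < mc) {χ : ℝ → Fin 2 → ℝ}
    {A : Matrix (Fin 2) (Fin 2) ℝ} (h : IsHillBasis (fun _ => m) χ) (hA : IsMonodromy χ A)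
    (ht : A.trace / 2 = Real.cosh (√mc * Real.pi)) : m = mc := by
  have hp : 0 < √mc * Real.pi := mul_pos (Real.sqrt_pos.2 hmc) Real.pi_pos
  have h1 : 1 < Real.cosh (√mc * Real.pi) := Real.one_lt_cosh.2 hp.ne'
  rcases lt_trichotomy m 0 with hm | rfl | hm
  · exfalso
    have hk : 0 < √(-m) / 2 := by have := Real.sqrt_pos.2 (neg_pos.2 hm); positivity
    have hb : IsHillBasis (fun _ => m) (trigBasis (√(-m) / 2)) :=
      (trigBasis_isHillBasis hk).congr_potential fun _ => by
        rw [div_pow, Real.sq_sqrt (by linarith)]; ring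
    rw [h.monodromy_trace_eq hb hA (trigBasis_isMonodromy _), Matrix.trace_fin_two_of] at ht
    have := Real.cos_le_one (2 * Real.pi * (√(-m) / 2))
    linarith
  · exfalso
    rw [h.monodromy_trace_eq affineBasis_isHillBasis hA affineBasis_isMonodromy,
      Matrix.trace_fin_two_of] at ht
    linarith
  · rw [h.monodromy_trace_eq (expBasis_isHillBasis hm) hA (expBasis_isMonodromy m), expMonodromy,
      Matrix.trace_fin_two_of, ← Real.cosh_eq] at ht
    have e := Real.cosh_strictMonoOn.injOn
      (Set.mem_Ici.2 (mul_nonneg (Real.sqrt_nonneg m) Real.pi_pos.le)) (Set.mem_Ici.2 hp.le) ht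
    exact (Real.sqrt_inj hm.le hmc.le).1 (mul_right_cancel₀ Real.pi_pos.ne' e)

/-! ### Gluing Hill bases -/

/-- The extension of `ψ₀`, given on `[a, a + T)`, to a function `ψ` on the line with
`ψ (T + x) = M ψ x`. -/
def quasiPeriodicExt (a T : ℝ) (M : Matrix.SpecialLinearGroup (Fin 2) ℝ) (ψ₀ : ℝ → Fin 2 → ℝ)
    (x : ℝ) : Fin 2 → ℝ :=
  ((M ^ ⌊(x - a) / T⌋ : Matrix.SpecialLinearGroup (Fin 2) ℝ) : Matrix (Fin 2) (Fin 2) ℝ) *ᵥ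
    ψ₀ (x - ⌊(x - a) / T⌋ * T)

theorem quasiPeriodicExt_add {a T : ℝ} (hT : 0 < T) (M : Matrix.SpecialLinearGroup (Fin 2) ℝ)
    (ψ₀ : ℝ → Fin 2 → ℝ) (x : ℝ) :
    quasiPeriodicExt a T M ψ₀ (T + x) =
      (M : Matrix (Fin 2) (Fin 2) ℝ) *ᵥ quasiPeriodicExt a T M ψ₀ x := by
  have e : ⌊(T + x - a) / T⌋ = ⌊(x - a) / T⌋ + 1 := by
    rw [show (T + x - a) / T = (x - a) / T + 1 by field_simp; ring, Int.floor_add_one]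
  have e2 : T + x - ((⌊(x - a) / T⌋ + 1 : ℤ) : ℝ) * T = x - ⌊(x - a) / T⌋ * T := by
    push_cast; ring
  rw [quasiPeriodicExt, quasiPeriodicExt, e, e2, Matrix.mulVec_mulVec, zpow_add_one,
    (Commute.zpow_self M _).eq, Matrix.SpecialLinearGroup.coe_mul]

theorem quasiPeriodicExt_of_mem {a T : ℝ} (hT : 0 < T) (M : Matrix.SpecialLinearGroup (Fin 2) ℝ)
    (ψ₀ : ℝ → Fin 2 → ℝ) {x : ℝ} (hx : x ∈ Set.Ico a (a + T)) :
    quasiPeriodicExt a T M ψ₀ x = ψ₀ x := by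
  have e : ⌊(x - a) / T⌋ = 0 := by
    rw [Int.floor_eq_zero_iff]
    exact ⟨div_nonneg (by linarith [hx.1]) hT.le, (div_lt_one hT).2 (by linarith [hx.2])⟩
  simp [quasiPeriodicExt, e]

theorem IsMonodromy.zpow {ψ : ℝ → Fin 2 → ℝ} {M : Matrix.SpecialLinearGroup (Fin 2) ℝ}
    (h : IsMonodromy ψ M) (k : ℤ) (x : ℝ) :
    ψ x = ((M ^ k : Matrix.SpecialLinearGroup (Fin 2) ℝ) : Matrix (Fin 2) (Fin 2) ℝ) *ᵥ
      ψ (x - k * (2 * Real.pi)) := by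
  have key : ∀ (k : ℤ) (y : ℝ), ψ (y + k * (2 * Real.pi)) =
      ((M ^ k : Matrix.SpecialLinearGroup (Fin 2) ℝ) : Matrix (Fin 2) (Fin 2) ℝ) *ᵥ ψ y := by
    intro k
    induction k using Int.induction_on with
    | zero => intro y; simp
    | succ n ih =>
      intro y
      rw [show y + ((n + 1 : ℤ) : ℝ) * (2 * Real.pi) =
        2 * Real.pi + (y + (n : ℤ) * (2 * Real.pi)) by push_cast; ring, h, ih,
        Matrix.mulVec_mulVec, zpow_add_one, (Commute.zpow_self M _).eq,
        Matrix.SpecialLinearGroup.coe_mul]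
    | pred n ih =>
      intro y
      have e : (M : Matrix (Fin 2) (Fin 2) ℝ) *ᵥ ψ (y + ((-n - 1 : ℤ) : ℝ) * (2 * Real.pi)) =
          ψ (y + ((-n : ℤ) : ℝ) * (2 * Real.pi)) := by
        rw [← h]; congr 1; push_cast; ring
      rw [ih] at e
      have e2 := congrArg (fun v => ((M⁻¹ : Matrix.SpecialLinearGroup (Fin 2) ℝ) :
        Matrix (Fin 2) (Fin 2) ℝ) *ᵥ v) e
      simp only [Matrix.mulVec_mulVec, ← Matrix.SpecialLinearGroup.coe_mul, inv_mul_cancel] at e2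
      rw [Matrix.SpecialLinearGroup.coe_one, Matrix.one_mulVec] at e2
      rw [e2, zpow_sub_one, (Commute.zpow_left (Commute.inv_right (Commute.refl M)) _).eq]
  rw [← key k, sub_add_cancel]

/-- A quasi-periodic pair which agrees near each point of a period with a Hill basis is a Hill
basis. -/
theorem IsHillBasis.of_isMonodromy {μ : ℝ → ℝ} (hμ : Continuous μ)
    (hper : Function.Periodic μ (2 * Real.pi)) {ψ : ℝ → Fin 2 → ℝ}
    {M : Matrix.SpecialLinearGroup (Fin 2) ℝ} (hM : IsMonodromy ψ M) (a : ℝ)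
    (h : ∀ x ∈ Set.Ico a (a + 2 * Real.pi), ∃ (ν : ℝ → ℝ) (χ : ℝ → Fin 2 → ℝ),
      IsHillBasis ν χ ∧ ψ =ᶠ[nhds x] χ ∧ μ x = ν x) : IsHillBasis μ ψ := by
  refine IsHillBasis.of_locally hμ fun x => ?_
  set k : ℤ := toIcoDiv Real.two_pi_pos a x with hk
  have hx : x - k * (2 * Real.pi) ∈ Set.Ico a (a + 2 * Real.pi) := by
    have := sub_toIcoDiv_zsmul_mem_Ico Real.two_pi_pos a x
    rwa [zsmul_eq_mul] at this
  obtain ⟨ν, χ, h1, h2, h3⟩ := h _ hx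
  refine ⟨_, _, (h1.comp_add_const (-(k * (2 * Real.pi)))).mulVec
    (B := ((M ^ k : Matrix.SpecialLinearGroup (Fin 2) ℝ) : Matrix (Fin 2) (Fin 2) ℝ))
    (Matrix.SpecialLinearGroup.det_coe _), ?_, ?_⟩
  · have hc : Filter.Tendsto (fun y => y - k * (2 * Real.pi)) (nhds x)
        (nhds (x - k * (2 * Real.pi))) := (continuous_sub_right _).tendsto x
    filter_upwards [hc.eventually h2] with y hy
    rw [hM.zpow k y, hy, sub_eq_add_neg]
  · simp only [← sub_eq_add_neg]
    rw [← h3, hper.sub_int_mul_eq k]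

/-- Let `ψ₁`, `ψ₂` be Hill bases with monodromy which coincide with `halfAngleBasis` over
complementary half-circles. The basis equal to `ψ₂` over the first half-circle and to `ψ₁` over
the second is a Hill basis with monodromy matrix `-M₁ M₂`; the sign is due to the
anti-periodicity of `halfAngleBasis`. -/
theorem exists_glued_hillBasis {μ₁ μ₂ μ : ℝ → ℝ} {ψ₁ ψ₂ : ℝ → Fin 2 → ℝ}
    {M₁ M₂ : Matrix (Fin 2) (Fin 2) ℝ} {ε : ℝ} (hε : 0 < ε) (hμ : IsCircleFunction μ)
    (h₁ : IsHillBasis μ₁ ψ₁) (h₂ : IsHillBasis μ₂ ψ₂)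
    (hM₁ : IsMonodromy ψ₁ M₁) (hM₂ : IsMonodromy ψ₂ M₂)
    (e₁ : ∀ x ∈ Set.Ioo (-(Real.pi / 2) - ε) (Real.pi / 2 + ε), ψ₁ x = halfAngleBasis x)
    (e₂ : ∀ x ∈ Set.Ioo (Real.pi / 2 - ε) (3 * Real.pi / 2 + ε), ψ₂ x = halfAngleBasis x)
    (g₁ : ∀ x ∈ Set.Icc (Real.pi / 2) (3 * Real.pi / 2), μ x = μ₁ x)
    (g₂ : ∀ x ∈ Set.Icc (-(Real.pi / 2)) (Real.pi / 2), μ x = μ₂ x) :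
    ∃ ψ : ℝ → Fin 2 → ℝ, IsHillBasis μ ψ ∧
      (∀ x ∈ Set.Icc (Real.pi / 2) (3 * Real.pi / 2), ψ x = ψ₁ x) ∧
      (∀ x ∈ Set.Icc (-(Real.pi / 2)) (Real.pi / 2), ψ x = ψ₂ x) ∧
      IsMonodromy ψ (-(M₁ * M₂)) := by
  wlog hεπ : ε < Real.pi / 2 generalizing ε
  · refine this (ε := Real.pi / 4) (by linarith [Real.pi_pos]) (fun x hx => e₁ x ⟨?_, ?_⟩)
      (fun x hx => e₂ x ⟨?_, ?_⟩) (by linarith [Real.pi_pos]) <;>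
      linarith [hx.1, hx.2, Real.pi_pos]
  have hpi := Real.pi_pos
  have hdet : (-(M₁ * M₂)).det = 1 := by
    rw [Matrix.det_neg, Matrix.det_mul, h₁.monodromy_det hM₁, h₂.monodromy_det hM₂]
    simp
  set M : Matrix.SpecialLinearGroup (Fin 2) ℝ := ⟨-(M₁ * M₂), hdet⟩ with hMdef
  set ψ₀ : ℝ → Fin 2 → ℝ := fun x => if x < Real.pi / 2 then ψ₂ x else ψ₁ x with hψ₀
  set ψ := quasiPeriodicExt (-(Real.pi / 2)) (2 * Real.pi) M ψ₀ with hψ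
  have hM : IsMonodromy ψ M := fun x => quasiPeriodicExt_add Real.two_pi_pos M ψ₀ x
  have base : ∀ x ∈ Set.Ico (-(Real.pi / 2)) (3 * Real.pi / 2), ψ x = ψ₀ x := fun x hx =>
    quasiPeriodicExt_of_mem Real.two_pi_pos M ψ₀ ⟨hx.1, by linarith [hx.2]⟩
  have c₁ : ∀ x ∈ Set.Ioo (Real.pi / 2 - ε) (3 * Real.pi / 2), ψ x = ψ₁ x := by
    intro x hx
    rw [base x ⟨by linarith [hx.1], hx.2⟩]
    simp only [hψ₀]
    split_ifs with hlt
    · rw [e₁ x ⟨by linarith [hx.1], by linarith⟩, e₂ x ⟨hx.1, by linarith⟩]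
    · rfl
  have c₂ : ∀ x ∈ Set.Ioo (-(Real.pi / 2) - ε) (Real.pi / 2 + ε), ψ x = ψ₂ x := by
    intro x hx
    rcases lt_or_ge x (-(Real.pi / 2)) with hlt | hge
    · -- compare the continuations of both pairs through a period
      have hinj : Function.Injective fun v => (M : Matrix (Fin 2) (Fin 2) ℝ) *ᵥ v :=
        Matrix.mulVec_injective_of_isUnit
          ((Matrix.isUnit_iff_isUnit_det _).2 (by rw [M.det_coe]; exact isUnit_one))
      apply hinj
      change (M : Matrix (Fin 2) (Fin 2) ℝ) *ᵥ ψ x = -(M₁ * M₂) *ᵥ ψ₂ x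
      rw [← hM x, Matrix.neg_mulVec, ← Matrix.mulVec_mulVec, ← hM₂ x,
        c₁ _ ⟨by linarith [hx.1], by linarith⟩, hM₁ x, e₁ x hx,
        e₂ _ ⟨by linarith [hx.1], by linarith⟩, add_comm, halfAngleBasis_add_two_pi,
        Matrix.mulVec_neg, neg_neg]
    · rw [base x ⟨hge, by linarith [hx.2]⟩]
      simp only [hψ₀]
      split_ifs with hlt
      · rfl
      · rw [e₁ x ⟨by linarith [hx.1], hx.2⟩, e₂ x ⟨by linarith, by linarith [hx.2]⟩]
  have hB : IsHillBasis μ ψ := by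
    refine IsHillBasis.of_isMonodromy hμ.smooth.continuous hμ.periodic hM (-(Real.pi / 2))
      fun x hx => ?_
    rcases le_or_gt x (Real.pi / 2) with hle | hgt
    · refine ⟨μ₂, ψ₂, h₂, ?_, g₂ x ⟨hx.1, hle⟩⟩
      exact Filter.mem_of_superset (Ioo_mem_nhds (by linarith [hx.1]) (by linarith)) c₂
    · refine ⟨μ₁, ψ₁, h₁, ?_, g₁ x ⟨hgt.le, by linarith [hx.2]⟩⟩
      exact Filter.mem_of_superset (Ioo_mem_nhds (by linarith) (by linarith [hx.2])) c₁
  refine ⟨ψ, hB, fun x hx => ?_, fun x hx => c₂ x ⟨by linarith [hx.1], by linarith [hx.2]⟩, hM⟩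
  rcases hx.2.lt_or_eq with hlt | rfl
  · exact c₁ x ⟨by linarith [hx.1], hlt⟩
  · have e : 3 * Real.pi / 2 = 2 * Real.pi + -(Real.pi / 2) := by ring
    have hm : -(Real.pi / 2) ∈ Set.Ioo (-(Real.pi / 2) - ε) (Real.pi / 2 + ε) :=
      ⟨by linarith, by linarith⟩
    rw [e, hM, hM₁, c₂ _ hm, e₁ _ hm, show (M : Matrix (Fin 2) (Fin 2) ℝ) = -(M₁ * M₂) from rfl,
      Matrix.neg_mulVec, ← Matrix.mulVec_mulVec, ← hM₂, e₂ _ ⟨by linarith, by linarith⟩,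
      add_comm, halfAngleBasis_add_two_pi, Matrix.mulVec_neg, neg_neg]

/-! ### Circle diffeomorphisms with a prescribed constant potential -/

/-- The inverse of a circle diffeomorphism is a circle diffeomorphism. -/
theorem IsCircleDiffeo.exists_inverse {g : ℝ → ℝ} (hg : IsCircleDiffeo g) :
    ∃ f : ℝ → ℝ, IsCircleDiffeo f ∧ (∀ x, g (f x) = x) ∧ ∀ x, f (g x) = x := by
  have hpi := Real.two_pi_pos
  have hint : ∀ (n : ℤ) (x : ℝ), g (x + n * (2 * Real.pi)) = g x + n * (2 * Real.pi) := by
    intro n x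
    have hp : Function.Periodic (fun y => g y - y) (2 * Real.pi) := fun y => by
      simp only [hg.equivariant]; ring
    have : g (x + n * (2 * Real.pi)) - (x + n * (2 * Real.pi)) = g x - x := hp.int_mul n x
    linarith
  have hsurj : Function.Surjective g := by
    refine hg.smooth.continuous.surjective ?_ ?_
    · refine hg.strictMono.monotone.tendsto_atTop_atTop fun b => ?_
      obtain ⟨n, hn⟩ := exists_nat_gt ((b - g 0) / (2 * Real.pi))
      refine ⟨0 + (n : ℤ) * (2 * Real.pi), ?_⟩
      rw [hint]
      rw [div_lt_iff₀ hpi] at hn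
      push_cast
      linarith
    · refine hg.strictMono.monotone.tendsto_atBot_atBot fun b => ?_
      obtain ⟨n, hn⟩ := exists_nat_gt ((g 0 - b) / (2 * Real.pi))
      refine ⟨0 + (-n : ℤ) * (2 * Real.pi), ?_⟩
      rw [hint]
      rw [div_lt_iff₀ hpi] at hn
      push_cast
      linarith
  set o := hg.strictMono.orderIsoOfSurjective g hsurj with ho
  have hl : ∀ x, o.symm (g x) = x := fun x => o.symm_apply_apply x
  have hr : ∀ x, g (o.symm x) = x := fun x => o.apply_symm_apply x
  have hd : ∀ x, HasDerivAt o.symm (deriv g (o.symm x))⁻¹ x := fun x =>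
    HasDerivAt.of_local_left_inverse o.symm.continuous.continuousAt
      (hg.differentiableAt _).hasDerivAt (hg.deriv_pos _).ne' (Filter.Eventually.of_forall hr)
  refine ⟨o.symm, ⟨?_, fun x => ?_, fun x => ?_⟩, hr, hl⟩
  · have key : ∀ n : ℕ, ContDiff ℝ n o.symm := by
      intro n
      induction n with
      | zero => exact contDiff_zero.2 o.symm.continuous
      | succ n ih =>
        refine (contDiff_succ_iff_deriv (n := (n : WithTop ℕ∞))).2
          ⟨fun x => (hd x).differentiableAt, by simp, ?_⟩
        rw [show deriv o.symm = fun x => (deriv g (o.symm x))⁻¹ from funext fun x => (hd x).deriv]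
        exact ((hg.contDiff_deriv.of_le (by exact_mod_cast le_top)).comp ih).inv
          fun x => (hg.deriv_pos _).ne'
    exact contDiff_infty.2 key
  · rw [(hd x).deriv]
    exact inv_pos.2 (hg.deriv_pos _)
  · apply hg.strictMono.injective
    rw [hg.equivariant, hr, hr]

/-- A Hill basis with positive components and monodromy `diag (L, L⁻¹)`, `L > 1`, is the pull-back
of an exponential basis by `(log L / π)⁻¹ log (φ₁ / φ₂)`; the inverse of this diffeomorphism
transforms the potential to a constant. -/
theorem exists_diffeo_to_const {μ : ℝ → ℝ} (hμ : IsCircleFunction μ) {φ : ℝ → Fin 2 → ℝ} {L : ℝ}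
    (hL : 1 < L) (h : IsHillBasis μ φ) (hM : IsMonodromy φ !![L, 0; 0, L⁻¹])
    (hpos : ∀ i x, 0 < φ x i) :
    ∃ f, IsCircleDiffeo f ∧ ∀ x, massTransform μ f x = (Real.log L / Real.pi) ^ 2 := by
  have hpi := Real.pi_pos
  have hlog : 0 < Real.log L := Real.log_pos hL
  set k := Real.log L / Real.pi with hk
  have hk0 : 0 < k := div_pos hlog hpi
  have hsk : √(k ^ 2) = k := Real.sqrt_sq hk0.le
  set g : ℝ → ℝ := fun x => k⁻¹ * (Real.log (φ x 0) - Real.log (φ x 1)) with hg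
  -- the numerator of the derivative of `log (φ₀ / φ₁)` is the Wronskian
  have hgd : ∀ x, HasDerivAt g (k⁻¹ * (φ x 0 * φ x 1)⁻¹) x := by
    intro x
    refine ((((h.hasDerivAt 0 x).log (hpos 0 x).ne').sub
      ((h.hasDerivAt 1 x).log (hpos 1 x).ne')).const_mul k⁻¹).congr_deriv ?_
    have h0 := (hpos 0 x).ne'
    have h1 := (hpos 1 x).ne'
    field_simp
    linear_combination h.wronskian x
  have hM0 : ∀ x, φ (x + 2 * Real.pi) 0 = L * φ x 0 := fun x => by
    rw [add_comm, hM]; simp [Matrix.mulVec, dotProduct, Fin.sum_univ_two]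
  have hM1 : ∀ x, φ (x + 2 * Real.pi) 1 = L⁻¹ * φ x 1 := fun x => by
    rw [add_comm, hM]; simp [Matrix.mulVec, dotProduct, Fin.sum_univ_two]
  have hgc : IsCircleDiffeo g := by
    refine ⟨?_, fun x => ?_, fun x => ?_⟩
    · exact contDiff_const.mul (((h.contDiff hμ.smooth 0).log fun x => (hpos 0 x).ne').sub
        ((h.contDiff hμ.smooth 1).log fun x => (hpos 1 x).ne'))
    · rw [(hgd x).deriv]
      have h0 := hpos 0 x
      have h1 := hpos 1 x
      positivity
    · have hL0 : L ≠ 0 := by positivity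
      simp only [hg]
      rw [hM0, hM1, Real.log_mul hL0 (hpos 0 x).ne', Real.log_mul (inv_ne_zero hL0) (hpos 1 x).ne',
        Real.log_inv]
      have : k⁻¹ * Real.log L = Real.pi := by rw [hk]; field_simp
      linear_combination 2 * this
  have hpull : hillPull g (expBasis (k ^ 2)) = φ := by
    funext x i
    have h0 := hpos 0 x
    have h1 := hpos 1 x
    have e0 : k * g x = Real.log (φ x 0) - Real.log (φ x 1) := by
      simp only [hg]; field_simp
    have s0 : √(deriv g x) = (√k * √(φ x 0) * √(φ x 1))⁻¹ := by
      rw [(hgd x).deriv, ← mul_inv, Real.sqrt_inv, Real.sqrt_mul hk0.le, Real.sqrt_mul h0.le,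
        mul_assoc]
    have hexp : ∀ {y : ℝ}, 0 < y → Real.exp (Real.log y / 2) = √y := fun {y} hy => by
      rw [Real.exp_half, Real.exp_log hy]
    have q0 := Real.sqrt_pos.2 h0
    have q1 := Real.sqrt_pos.2 h1
    have qk := Real.sqrt_pos.2 hk0
    have r0 : √(φ x 0) ^ 2 = φ x 0 := Real.sq_sqrt h0.le
    have r1 : √(φ x 1) ^ 2 = φ x 1 := Real.sq_sqrt h1.le
    fin_cases i
    · simp only [hillPull, expBasis, hsk, e0, s0, Fin.zero_eta, Matrix.cons_val_zero]
      rw [sub_div, Real.exp_sub, hexp h0, hexp h1]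
      field_simp
      exact r0
    · simp only [hillPull, expBasis, hsk, e0, s0, Fin.mk_one, Matrix.cons_val_one,
        Matrix.cons_val_fin_one]
      rw [sub_div, neg_sub, Real.exp_sub, hexp h0, hexp h1]
      field_simp
      exact r1
  obtain ⟨f, hf, hgf, hfg⟩ := hgc.exists_inverse
  refine ⟨f, hf, fun x => ?_⟩
  have hb : IsHillBasis (massTransform μ f) (expBasis (k ^ 2)) := by
    have := h.hillPull hf
    rw [← hpull, hillPull_hillPull hgc hf, show g ∘ f = id from funext hgf] at this
    convert this using 1
    funext y i
    simp [hillPull]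
  exact congrFun (hb.eq_potential (expBasis_isHillBasis (by positivity))) x

/-! ### The two exponential pieces -/

/-- The pulled-back exponential basis of a piece in normal form, over the arc of the normal form. -/
theorem hillPull_expBasis_of_hasDerivAt {m X s x : ℝ} {f : ℝ → ℝ} (hm : 0 < m) (hX : 0 < X)
    (hs : 0 < s) (hf : f x = -(1 / √m) * Real.log X)
    (hd : deriv f x = 1 / √m * (1 / (2 * s ^ 2)) / X) :
    hillPull f (expBasis m) x = ![√2 * s, √2 * s * X] := by
  have h1 : 0 < √m := Real.sqrt_pos.2 hm
  have h2 : 0 < √(√m) := Real.sqrt_pos.2 h1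
  have hx := Real.sqrt_pos.2 hX
  have e0 : √m * f x = -Real.log X := by rw [hf]; field_simp
  have s0 : √(deriv f x) = (√(√m) * (√2 * s) * √X)⁻¹ := by
    rw [hd, ← Real.sqrt_sq hs.le, ← Real.sqrt_mul (by norm_num), ← Real.sqrt_mul h1.le,
      ← Real.sqrt_mul (by positivity), ← Real.sqrt_inv, Real.sqrt_sq hs.le]
    congr 1
    field_simp
  have q : √X ^ 2 = X := Real.sq_sqrt hX.le
  have hexp : Real.exp (Real.log X / 2) = √X := by rw [Real.exp_half, Real.exp_log hX]
  have e1 : Real.exp (√m * f x / 2) = (√X)⁻¹ := by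
    rw [e0, neg_div, Real.exp_neg, hexp]
  have e2 : Real.exp (-(√m * f x / 2)) = √X := by
    rw [e0, neg_div, neg_neg, hexp]
  funext i
  fin_cases i
  · simp only [hillPull, expBasis, e1, s0, Fin.zero_eta, Matrix.cons_val_zero]
    field_simp
  · simp only [hillPull, expBasis, e2, s0, Fin.mk_one, Matrix.cons_val_one,
      Matrix.cons_val_fin_one]
    field_simp
    exact q

theorem one_lt_gluingConst {m κ : ℝ} (hm : 0 < m) (hκ : 1 < κ) : 1 < gluingConst m κ := by
  have h : 0 < √m * Real.pi := mul_pos (Real.sqrt_pos.2 hm) Real.pi_pos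
  have h1 : 0 < Real.sinh (√m * Real.pi) := Real.sinh_pos_iff.2 h
  have h2 : 1 < Real.cosh (√m * Real.pi) / Real.sinh (√m * Real.pi) :=
    (one_lt_div h1).2 (Real.sinh_lt_cosh _)
  exact one_lt_mul_of_lt_of_le hκ h2.le

/-- A logarithmic normal form transforms the exponential basis into multiples of
`halfAngleBasis`. -/
theorem hillPull_expBasis_of_eventuallyEq {m c x : ℝ} {f : ℝ → ℝ} (hm : 0 < m)
    (hcos : 0 < Real.cos (x / 2)) (hX : 0 < -Real.tan (x / 2) + c)
    (hf : f =ᶠ[nhds x] fun y => -(1 / √m) * Real.log (-Real.tan (y / 2) + c)) :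
    hillPull f (expBasis m) x = firstMatrix c *ᵥ halfAngleBasis x := by
  have hd : HasDerivAt f (1 / √m * (1 / (2 * Real.cos (x / 2) ^ 2)) /
      (-Real.tan (x / 2) + c)) x := by
    have h1 : HasDerivAt (fun x : ℝ => x / 2) (1 / 2) x := (hasDerivAt_id' x).div_const 2
    have ht : HasDerivAt (fun x : ℝ => Real.tan (x / 2)) (1 / Real.cos (x / 2) ^ 2 * (1 / 2)) x :=
      HasDerivAt.comp (h₂ := Real.tan) x (Real.hasDerivAt_tan hcos.ne') h1
    have h2 := (((ht.neg.add_const c).log hX.ne').const_mul (-(1 / √m)))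
    refine (h2.congr_of_eventuallyEq hf).congr_deriv ?_
    simp only [Pi.neg_apply]
    field_simp
  rw [hillPull_expBasis_of_hasDerivAt hm hX hcos hf.eq_of_nhds hd.deriv]
  funext i
  fin_cases i
  · simp [firstMatrix, halfAngleBasis, Matrix.mulVec, dotProduct, Fin.sum_univ_two]
  · simp [firstMatrix, halfAngleBasis, Matrix.mulVec, dotProduct, Fin.sum_univ_two]
    rw [Real.tan_eq_sin_div_cos]
    field_simp

theorem IsFirstGauge.hillPull_eq {m κ : ℝ} {f μ : ℝ → ℝ} (hm : 0 < m) (hκ : 1 < κ)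
    (h : IsFirstGauge m κ f μ) {x : ℝ} (hx : x ∈ Set.Ioo (-(Real.pi / 2)) (Real.pi / 2)) :
    hillPull f (expBasis m) x = firstMatrix (gluingConst m κ) *ᵥ halfAngleBasis x := by
  have hc := one_lt_gluingConst hm hκ
  have hcos : 0 < Real.cos (x / 2) :=
    Real.cos_pos_of_mem_Ioo ⟨by linarith [hx.1, Real.pi_pos], by linarith [hx.2, Real.pi_pos]⟩
  have htan : Real.tan (x / 2) < 1 := by
    rw [← Real.tan_pi_div_four]
    exact Real.tan_lt_tan_of_lt_of_lt_pi_div_two (by linarith [hx.1, Real.pi_pos])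
      (by linarith [hx.2, Real.pi_pos]) (by linarith [hx.2])
  refine hillPull_expBasis_of_eventuallyEq hm hcos (by linarith) ?_
  filter_upwards [Ioo_mem_nhds hx.1 hx.2] with y hy
  exact h.normalForm y ⟨hy.1.le, hy.2.le⟩

theorem IsSecondGauge.hillPull_eq {m κ : ℝ} {f μ : ℝ → ℝ} (hm : 0 < m) (hκ : 1 < κ)
    (h : IsSecondGauge m κ f μ) {x : ℝ} (hx : x ∈ Set.Ioo (Real.pi / 2) (3 * Real.pi / 2)) :
    hillPull f (expBasis m) x = secondMatrix (gluingConst m κ) *ᵥ halfAngleBasis x := by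
  have hc := one_lt_gluingConst hm hκ
  have hsin : 0 < Real.sin (x / 2) :=
    Real.sin_pos_of_mem_Ioo ⟨by linarith [hx.1, Real.pi_pos], by linarith [hx.2, Real.pi_pos]⟩
  have hcs : 0 < Real.cos (x / 2) + Real.sin (x / 2) := by
    have h1 : 0 < Real.sin (x / 2 + Real.pi / 4) :=
      Real.sin_pos_of_mem_Ioo ⟨by linarith [hx.1, Real.pi_pos], by linarith [hx.2, Real.pi_pos]⟩
    rw [Real.sin_add, Real.cos_pi_div_four, Real.sin_pi_div_four, ← add_mul] at h1
    linarith [pos_of_mul_pos_left h1 (by positivity)]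
  have hX : 0 < Real.cot (x / 2) + gluingConst m κ := by
    rw [Real.cot_eq_cos_div_sin]
    have : -1 < Real.cos (x / 2) / Real.sin (x / 2) := by
      rw [lt_div_iff₀ hsin]; linarith
    linarith
  have hd : HasDerivAt f (1 / √m * (1 / (2 * Real.sin (x / 2) ^ 2)) /
      (Real.cot (x / 2) + gluingConst m κ)) x := by
    have h1 : HasDerivAt (fun x : ℝ => x / 2) (1 / 2) x := (hasDerivAt_id' x).div_const 2
    have h2 := ((((h1.cos.div h1.sin hsin.ne').add_const
      (gluingConst m κ)).log (by rw [Real.cot_eq_cos_div_sin] at hX; exact hX.ne')).const_mul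
        (-(1 / √m)))
    refine (h2.congr_of_eventuallyEq ?_).congr_deriv ?_
    · filter_upwards [Ioo_mem_nhds hx.1 hx.2] with y hy
      rw [h.normalForm y ⟨hy.1.le, hy.2.le⟩, Real.cot_eq_cos_div_sin]
      rfl
    · rw [Real.cot_eq_cos_div_sin] at hX ⊢
      simp only [Pi.div_apply]
      have hX' := hX.ne'
      have hsq := Real.sin_sq_add_cos_sq (x / 2)
      have h1 : 0 < √m := Real.sqrt_pos.2 hm
      rw [show (-Real.sin (x / 2) * (1 / 2) * Real.sin (x / 2) -
        Real.cos (x / 2) * (Real.cos (x / 2) * (1 / 2))) = -(1 / 2) by linear_combination -hsq / 2]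
      field_simp
  rw [hillPull_expBasis_of_hasDerivAt hm hX hsin (h.normalForm x ⟨hx.1.le, hx.2.le⟩) hd.deriv]
  funext i
  fin_cases i
  · simp [secondMatrix, halfAngleBasis, Matrix.mulVec, dotProduct, Fin.sum_univ_two]
  · simp [secondMatrix, halfAngleBasis, Matrix.mulVec, dotProduct, Fin.sum_univ_two]
    rw [Real.cot_eq_cos_div_sin]
    field_simp
    ring

/-! ### Monodromy of the glued potential -/

/-- The potential `μ` is `μ₂` over `[-π/2, π/2]` and `μ₁` over the complementary half-circle, and
`μ₁`, `μ₂` take the value `-1` of the hyperbolic plane near the respective omitted half-circles. -/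
structure IsGluedPotential (δ : ℝ) (μ₁ μ₂ μ : ℝ → ℝ) : Prop where
  pos : 0 < δ
  circle : IsCircleFunction μ
  first : ∀ x, -δ < Real.cos x → μ₁ x = -1
  second : ∀ x, Real.cos x < δ → μ₂ x = -1
  eq_ite : ∀ x, μ x = if 0 ≤ Real.cos x then μ₂ x else μ₁ x

namespace IsGluedPotential

variable {δ : ℝ} {μ₁ μ₂ μ : ℝ → ℝ}

theorem neg_lt_cos {δ x : ℝ} (hδ : 0 < δ)
    (hx : x ∈ Set.Ioo (-(Real.pi / 2) - min δ (Real.pi / 2)) (Real.pi / 2 + min δ (Real.pi / 2))) :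
    -δ < Real.cos x := by
  have hpi := Real.pi_pos
  set ε := min δ (Real.pi / 2) with hε
  have h1 : ε ≤ δ := min_le_left _ _
  have h2 : ε ≤ Real.pi / 2 := min_le_right _ _
  have h0 : 0 < ε := lt_min hδ (by positivity)
  rw [← Real.cos_abs]
  have hab : |x| < Real.pi / 2 + ε := abs_lt.2 ⟨by linarith [hx.1], hx.2⟩
  have := Real.cos_lt_cos_of_nonneg_of_le_pi (abs_nonneg x) (by linarith) hab
  rw [add_comm, Real.cos_add_pi_div_two] at this
  linarith [Real.sin_le h0.le]

theorem cos_lt {δ x : ℝ} (hδ : 0 < δ)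
    (hx : x ∈ Set.Ioo (Real.pi / 2 - min δ (Real.pi / 2))
      (3 * Real.pi / 2 + min δ (Real.pi / 2))) : Real.cos x < δ := by
  have := neg_lt_cos (x := x - Real.pi) hδ ⟨by linarith [hx.1], by linarith [hx.2]⟩
  rw [Real.cos_sub_pi] at this
  linarith

theorem eq_first (h : IsGluedPotential δ μ₁ μ₂ μ) {x : ℝ}
    (hx : x ∈ Set.Icc (Real.pi / 2) (3 * Real.pi / 2)) : μ x = μ₁ x := by
  rw [h.eq_ite]
  have hc := Real.cos_nonpos_of_pi_div_two_le_of_le hx.1 (by linarith [hx.2])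
  split_ifs with h0
  · have h1 : Real.cos x = 0 := le_antisymm hc h0
    rw [h.first x (by linarith [h.pos]), h.second x (by linarith [h.pos])]
  · rfl

theorem eq_second (h : IsGluedPotential δ μ₁ μ₂ μ) {x : ℝ}
    (hx : x ∈ Set.Icc (-(Real.pi / 2)) (Real.pi / 2)) : μ x = μ₂ x := by
  rw [h.eq_ite, if_pos (Real.cos_nonneg_of_mem_Icc hx)]

/-- Hill bases of the two potentials are constant multiples of `halfAngleBasis` over the omitted
half-circles; after normalisation by these constants they glue. -/
theorem exists_glued (h : IsGluedPotential δ μ₁ μ₂ μ) {χ₁ χ₂ : ℝ → Fin 2 → ℝ}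
    {A₁ A₂ : Matrix (Fin 2) (Fin 2) ℝ} (h₁ : IsHillBasis μ₁ χ₁) (h₂ : IsHillBasis μ₂ χ₂)
    (hA₁ : IsMonodromy χ₁ A₁) (hA₂ : IsMonodromy χ₂ A₂) :
    ∃ R₁ R₂ : Matrix (Fin 2) (Fin 2) ℝ, R₁.det = 1 ∧ R₂.det = 1 ∧
      (∀ x ∈ Set.Icc (-(Real.pi / 2)) (Real.pi / 2), χ₁ x = R₁ *ᵥ halfAngleBasis x) ∧
      (∀ x ∈ Set.Icc (Real.pi / 2) (3 * Real.pi / 2), χ₂ x = R₂ *ᵥ halfAngleBasis x) ∧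
      ∃ ψ : ℝ → Fin 2 → ℝ, IsHillBasis μ ψ ∧
        (∀ x ∈ Set.Icc (Real.pi / 2) (3 * Real.pi / 2), ψ x = R₁⁻¹ *ᵥ χ₁ x) ∧
        (∀ x ∈ Set.Icc (-(Real.pi / 2)) (Real.pi / 2), ψ x = R₂⁻¹ *ᵥ χ₂ x) ∧
        IsMonodromy ψ (-((R₁⁻¹ * A₁ * R₁) * (R₂⁻¹ * A₂ * R₂))) := by
  have hpi := Real.pi_pos
  set ε := min δ (Real.pi / 2) with hε
  have h0 : 0 < ε := lt_min h.pos (by positivity)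
  obtain ⟨R₁, d₁, r₁⟩ := h₁.exists_eq_mulVec_on halfAngleBasis_isHillBasis
    (convex_Ioo (-(Real.pi / 2) - ε) (Real.pi / 2 + ε)) ⟨0, by constructor <;> linarith⟩
    fun x hx => h.first x (neg_lt_cos h.pos hx)
  obtain ⟨R₂, d₂, r₂⟩ := h₂.exists_eq_mulVec_on halfAngleBasis_isHillBasis
    (convex_Ioo (Real.pi / 2 - ε) (3 * Real.pi / 2 + ε)) ⟨Real.pi, by constructor <;> linarith⟩
    fun x hx => h.second x (cos_lt h.pos hx)
  have u₁ : IsUnit R₁.det := by rw [d₁]; exact isUnit_one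
  have u₂ : IsUnit R₂.det := by rw [d₂]; exact isUnit_one
  have i₁ : (R₁⁻¹).det = 1 := by rw [Matrix.det_nonsing_inv, d₁, Ring.inverse_one]
  have i₂ : (R₂⁻¹).det = 1 := by rw [Matrix.det_nonsing_inv, d₂, Ring.inverse_one]
  refine ⟨R₁, R₂, d₁, d₂, fun x hx => r₁ x ⟨by linarith [hx.1], by linarith [hx.2]⟩,
    fun x hx => r₂ x ⟨by linarith [hx.1], by linarith [hx.2]⟩, ?_⟩
  have m₁ := hA₁.mulVec i₁
  have m₂ := hA₂.mulVec i₂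
  rw [Matrix.nonsing_inv_nonsing_inv _ u₁] at m₁
  rw [Matrix.nonsing_inv_nonsing_inv _ u₂] at m₂
  refine exists_glued_hillBasis h0 h.circle (h₁.mulVec i₁) (h₂.mulVec i₂) m₁ m₂
    (fun x hx => ?_) (fun x hx => ?_) (fun x hx => h.eq_first hx) fun x hx => h.eq_second hx
  · rw [r₁ x hx, Matrix.mulVec_mulVec, Matrix.nonsing_inv_mul _ u₁, Matrix.one_mulVec]
  · rw [r₂ x hx, Matrix.mulVec_mulVec, Matrix.nonsing_inv_mul _ u₂, Matrix.one_mulVec]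

/-- The glued basis for two exponential pieces in normal form. -/
theorem exists_glued_exp (h : IsGluedPotential δ μ₁ μ₂ μ) {m₁ m₂ κ₁ κ₂ : ℝ} {f₁ f₂ : ℝ → ℝ}
    (hm₁ : 0 < m₁) (hm₂ : 0 < m₂) (hκ₁ : 1 < κ₁) (hκ₂ : 1 < κ₂)
    (g₁ : IsFirstGauge m₁ κ₁ f₁ μ₁) (g₂ : IsSecondGauge m₂ κ₂ f₂ μ₂) :
    ∃ ψ : ℝ → Fin 2 → ℝ, IsHillBasis μ ψ ∧
      (∀ x ∈ Set.Icc (Real.pi / 2) (3 * Real.pi / 2),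
        ψ x = (firstMatrix (gluingConst m₁ κ₁))⁻¹ *ᵥ hillPull f₁ (expBasis m₁) x) ∧
      (∀ x ∈ Set.Icc (-(Real.pi / 2)) (Real.pi / 2),
        ψ x = (secondMatrix (gluingConst m₂ κ₂))⁻¹ *ᵥ hillPull f₂ (expBasis m₂) x) ∧
      IsMonodromy ψ
        (-(((firstMatrix (gluingConst m₁ κ₁))⁻¹ * expMonodromy m₁ *
              firstMatrix (gluingConst m₁ κ₁)) *
            ((secondMatrix (gluingConst m₂ κ₂))⁻¹ * expMonodromy m₂ *
              secondMatrix (gluingConst m₂ κ₂)))) := by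
  have hpi := Real.pi_pos
  obtain ⟨R₁, R₂, -, -, r₁, r₂, hψ⟩ := h.exists_glued
    (((expBasis_isHillBasis hm₁).hillPull g₁.diffeo).congr_potential g₁.transform)
    (((expBasis_isHillBasis hm₂).hillPull g₂.diffeo).congr_potential g₂.transform)
    ((expBasis_isMonodromy m₁).hillPull g₁.diffeo) ((expBasis_isMonodromy m₂).hillPull g₂.diffeo)
  have e₁ : R₁ = firstMatrix (gluingConst m₁ κ₁) :=
    halfAngleBasis_isHillBasis.matrix_eq (isOpen_Ioo (a := -(Real.pi / 2)) (b := Real.pi / 2))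
      ⟨0, by constructor <;> linarith⟩ fun x hx => by
        rw [← r₁ x ⟨hx.1.le, hx.2.le⟩, g₁.hillPull_eq hm₁ hκ₁ hx]
  have e₂ : R₂ = secondMatrix (gluingConst m₂ κ₂) :=
    halfAngleBasis_isHillBasis.matrix_eq (isOpen_Ioo (a := Real.pi / 2) (b := 3 * Real.pi / 2))
      ⟨Real.pi, by constructor <;> linarith⟩ fun x hx => by
        rw [← r₂ x ⟨hx.1.le, hx.2.le⟩, g₂.hillPull_eq hm₂ hκ₂ hx]
  rw [e₁, e₂] at hψ
  exact hψ

end IsGluedPotential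

theorem firstMatrix_inv (c : ℝ) : (firstMatrix c)⁻¹ = !![c, -1; 1, 0] := by
  refine Matrix.inv_eq_right_inv ?_
  ext i j
  fin_cases i <;> fin_cases j <;> simp [firstMatrix, Matrix.mul_apply, Fin.sum_univ_two]

theorem secondMatrix_inv (c : ℝ) : (secondMatrix c)⁻¹ = !![1, 0; -c, 1] := by
  refine Matrix.inv_eq_right_inv ?_
  ext i j
  fin_cases i <;> fin_cases j <;> simp [secondMatrix, Matrix.mul_apply, Fin.sum_univ_two]

theorem gluingConst_mul {m κ : ℝ} (hm : 0 < m) :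
    gluingConst m κ * (Real.exp (√m * Real.pi) - Real.exp (-(√m * Real.pi))) =
      2 * κ * Real.cosh (√m * Real.pi) := by
  have h : 0 < √m * Real.pi := mul_pos (Real.sqrt_pos.2 hm) Real.pi_pos
  have h1 : 0 < Real.sinh (√m * Real.pi) := Real.sinh_pos_iff.2 h
  have h2 : Real.exp (√m * Real.pi) - Real.exp (-(√m * Real.pi)) = 2 * Real.sinh (√m * Real.pi) := by
    rw [Real.sinh_eq]; ring
  rw [gluingConst, h2]
  field_simp

/-- The monodromy matrix of the glued surface for two pieces of positive mass. -/
theorem glued_monodromy_eq {m₁ m₂ κ₁ κ₂ : ℝ} (hm₁ : 0 < m₁) (hm₂ : 0 < m₂) :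
    -(((firstMatrix (gluingConst m₁ κ₁))⁻¹ * expMonodromy m₁ * firstMatrix (gluingConst m₁ κ₁)) *
        ((secondMatrix (gluingConst m₂ κ₂))⁻¹ * expMonodromy m₂ *
          secondMatrix (gluingConst m₂ κ₂))) =
      !![2 * κ₁ * Real.cosh (√m₁ * Real.pi) * (2 * κ₂ * Real.cosh (√m₂ * Real.pi)) -
          Real.exp (√m₂ * Real.pi) / Real.exp (√m₁ * Real.pi),
        -(2 * κ₁ * Real.cosh (√m₁ * Real.pi)) / Real.exp (√m₂ * Real.pi);
        Real.exp (√m₁ * Real.pi) * (2 * κ₂ * Real.cosh (√m₂ * Real.pi)),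
        -(Real.exp (√m₁ * Real.pi) / Real.exp (√m₂ * Real.pi))] := by
  rw [← gluingConst_mul hm₁, ← gluingConst_mul hm₂, firstMatrix_inv, secondMatrix_inv]
  ext i j
  fin_cases i <;> fin_cases j <;>
    simp [firstMatrix, secondMatrix, expMonodromy,
      Real.exp_neg] <;>
    field_simp <;> ring

theorem halfTrace_eq (x y κ₁ κ₂ : ℝ) :
    (2 * κ₁ * Real.cosh x * (2 * κ₂ * Real.cosh y) - Real.exp y / Real.exp x +
      -(Real.exp x / Real.exp y)) / 2 =
      2 * κ₁ * κ₂ * Real.cosh x * Real.cosh y - Real.cosh (x - y) := by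
  rw [Real.cosh_eq (x - y), neg_sub, Real.exp_sub, Real.exp_sub]
  ring

theorem one_lt_halfTrace {x y κ₁ κ₂ : ℝ} (hx : 0 < x) (hy : 0 < y) (h₁ : 1 < κ₁) (h₂ : 1 < κ₂) :
    1 < 2 * κ₁ * κ₂ * Real.cosh x * Real.cosh y - Real.cosh (x - y) := by
  have hκ : 1 < κ₁ * κ₂ := one_lt_mul_of_lt_of_le h₁ h₂.le
  have hc : 0 < Real.cosh x * Real.cosh y := mul_pos (Real.cosh_pos x) (Real.cosh_pos y)
  have h1 : 1 < Real.cosh (x + y) := Real.one_lt_cosh.2 (by positivity)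
  rw [Real.cosh_add] at h1
  rw [Real.cosh_sub]
  nlinarith [mul_lt_mul_of_pos_right hκ hc]

/-- The slopes `q = C / (b L + a)` and `q' = C / (b / L + a)` of the eigenvectors of the transposed
glued monodromy matrix, of eigenvalues `L` and `L⁻¹`, enclose the values which the quotient of the
components of the glued basis takes on a period. Here `a = e^(√m₁ π)`, `b = e^(√m₂ π)`,
`C = 2 κ₁ cosh (√m₁ π)`, `D = 2 κ₂ cosh (√m₂ π)`; gluing parameters above one make `C` and `D` larger
than `a + a⁻¹` and `b + b⁻¹`. -/
theorem eigen_slope_bounds {a b C D L : ℝ} (ha : 1 < a) (hb : 1 < b) (hC : a + a⁻¹ < C)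
    (hD : b + b⁻¹ < D) (hL : 1 < L) (ht : L + L⁻¹ = C * D - b / a - a / b) :
    C / (b * L + a) < 1 ∧ 1 < C / (b / L + a) ∧ C / (b * L + a) * (b * D - b ^ 2) < 1 ∧
      (C - a⁻¹) / a < C / (b / L + a) := by
  have a0 : 0 < a := by linarith
  have b0 : 0 < b := by linarith
  have L0 : 0 < L := by linarith
  have ia : 0 < a⁻¹ := inv_pos.2 a0
  have ib : 0 < b⁻¹ := inv_pos.2 b0
  have iL : 0 < L⁻¹ := inv_pos.2 L0
  have iL1 : L⁻¹ < 1 := inv_lt_one_of_one_lt₀ hL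
  have aia : a * a⁻¹ = 1 := mul_inv_cancel₀ a0.ne'
  have bib : b * b⁻¹ = 1 := mul_inv_cancel₀ b0.ne'
  have LiL : L * L⁻¹ = 1 := mul_inv_cancel₀ L0.ne'
  have C0 : 0 < C := by linarith
  rw [div_eq_mul_inv b a, div_eq_mul_inv a b] at ht
  -- `s` lies strictly between the eigenvalues if the characteristic polynomial is negative at `s`
  have between : ∀ s, s * s - (L + L⁻¹) * s + 1 < 0 → L⁻¹ < s ∧ s < L := by
    intro s hs
    have hp : (s - L) * (s - L⁻¹) < 0 := by nlinarith
    rcases mul_neg_iff.1 hp with ⟨h1, h2⟩ | ⟨h1, h2⟩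
    · exfalso; linarith
    · exact ⟨by linarith, by linarith⟩
  -- the four bounds amount to `C - a` divided by `b` and `b (C - a⁻¹)` lying between the eigenvalues
  set X := C - a⁻¹ with hX
  set Y := C - a with hY
  have hXa : a < X := by linarith
  have hYa : a⁻¹ < Y := by linarith
  have hXY : 1 < X * Y := by nlinarith
  have Y0 : 0 < Y := by linarith
  have X0 : 0 < X := by linarith
  have hCDb : C * b⁻¹ < C * (D - b) := mul_lt_mul_of_pos_left (by linarith) C0
  have k1 := between (Y * b⁻¹) (by
    have : L + L⁻¹ - Y * b⁻¹ > b * X := by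
      rw [ht, hX, hY]; nlinarith
    have h3 : b * X * (Y * b⁻¹) = X * Y := by linear_combination X * Y * bib
    have h4 := mul_lt_mul_of_pos_right this (mul_pos Y0 ib)
    nlinarith)
  have k2 := between (b * X) (by
    have : L + L⁻¹ - b * X > Y * b⁻¹ := by
      rw [ht, hX, hY]; nlinarith
    have h3 : Y * b⁻¹ * (b * X) = X * Y := by linear_combination X * Y * bib
    have h4 := mul_lt_mul_of_pos_right this (mul_pos b0 X0)
    nlinarith)
  have d1 : 0 < b * L + a := by positivity
  have d2 : 0 < b / L + a := by positivity
  refine ⟨?_, ?_, ?_, ?_⟩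
  · rw [div_lt_one d1]
    have := mul_lt_mul_of_pos_left k1.2 b0
    have h5 : b * (Y * b⁻¹) = Y := by linear_combination Y * bib
    linarith
  · rw [one_lt_div d2, div_eq_mul_inv]
    have := mul_lt_mul_of_pos_left k1.1 b0
    have h5 : b * (Y * b⁻¹) = Y := by linear_combination Y * bib
    linarith
  · rw [div_mul_eq_mul_div, div_lt_one d1]
    have := mul_lt_mul_of_pos_left k2.1 b0
    have h6 : b * L = b * (C * D - b * a⁻¹ - a * b⁻¹ - L⁻¹) := by rw [← ht]; ring
    have h7 : b * (b * X) = b ^ 2 * C - b ^ 2 * a⁻¹ := by rw [hX]; ring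
    have h8 : b * (C * D - b * a⁻¹ - a * b⁻¹ - L⁻¹) =
      C * (b * D) - b ^ 2 * a⁻¹ - a - b * L⁻¹ := by linear_combination (-a) * bib
    nlinarith
  · rw [div_lt_div_iff₀ a0 d2, div_eq_mul_inv]
    have := mul_lt_mul_of_pos_right k2.2 iL
    have h9 : X * a = C * a - 1 := by rw [hX]; linear_combination -aia
    nlinarith

/-- A quasi-periodic function with positive multiplier is positive if it is so on a period. -/
theorem pos_of_quasiPeriodic {u : ℝ → ℝ} {a T L : ℝ} (hT : 0 < T) (hL : 0 < L)
    (hu : ∀ x, u (x + T) = L * u x) (h : ∀ x ∈ Set.Ico a (a + T), 0 < u x) (x : ℝ) : 0 < u x := by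
  have hp : Function.Periodic (fun x => u x * L ^ (-(x / T))) T := fun x => by
    have e : -((x + T) / T) = -(x / T) - 1 := by field_simp; ring
    simp only [hu, e, Real.rpow_sub hL, Real.rpow_one]
    field_simp
  obtain ⟨y, hy, e⟩ := hp.exists_mem_Ico hT x a
  have h1 : 0 < u y * L ^ (-(y / T)) := mul_pos (h y hy) (Real.rpow_pos_of_pos hL _)
  rw [← e] at h1
  exact pos_of_mul_pos_left h1 (Real.rpow_pos_of_pos hL _).le

theorem hillPull_expBasis_zero_pos {m : ℝ} (hm : 0 < m) {f : ℝ → ℝ} (hf : IsCircleDiffeo f)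
    (x : ℝ) : 0 < hillPull f (expBasis m) x 0 :=
  div_pos (div_pos (Real.exp_pos _) (Real.sqrt_pos.2 (Real.sqrt_pos.2 hm)))
    (Real.sqrt_pos.2 (hf.deriv_pos x))

theorem hillPull_expBasis_one {m : ℝ} (f : ℝ → ℝ) (x : ℝ) :
    hillPull f (expBasis m) x 1 = Real.exp (-(√m * f x)) * hillPull f (expBasis m) x 0 := by
  have e : Real.exp (-(√m * f x / 2)) = Real.exp (-(√m * f x)) * Real.exp (√m * f x / 2) := by
    rw [← Real.exp_add]; congr 1; ring
  simp only [hillPull, expBasis, Matrix.cons_val_zero, Matrix.cons_val_one,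
    Matrix.cons_val_fin_one, e]
  ring

theorem exp_neg_sqrt_mul_normalForm {m X : ℝ} (hm : 0 < m) (hX : 0 < X) :
    Real.exp (-(√m * (-(1 / √m) * Real.log X))) = X := by
  have h1 : 0 < √m := Real.sqrt_pos.2 hm
  rw [show -(√m * (-(1 / √m) * Real.log X)) = Real.log X by field_simp, Real.exp_log hX]

/-- Over the half-circle on which `f` is not given explicitly, it is bounded by its values at the
end points, because it is increasing. -/
theorem IsFirstGauge.exp_bounds {m κ : ℝ} {f μ : ℝ → ℝ} (hm : 0 < m) (hκ : 1 < κ)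
    (h : IsFirstGauge m κ f μ) {x : ℝ} (hx : x ∈ Set.Icc (Real.pi / 2) (3 * Real.pi / 2)) :
    (1 + gluingConst m κ) / Real.exp (√m * Real.pi) ^ 2 ≤ Real.exp (-(√m * f x)) ∧
      Real.exp (-(√m * f x)) ≤ gluingConst m κ - 1 := by
  have hpi := Real.pi_pos
  have hc := one_lt_gluingConst hm hκ
  have h1 : 0 < √m := Real.sqrt_pos.2 hm
  have hmono := h.diffeo.strictMono.monotone
  have e1 : Real.exp (-(√m * f (Real.pi / 2))) = gluingConst m κ - 1 := by
    rw [h.normalForm _ ⟨by linarith, le_rfl⟩, exp_neg_sqrt_mul_normalForm hm] <;>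
      rw [div_div, show (2 : ℝ) * 2 = 4 by norm_num, Real.tan_pi_div_four] <;> linarith
  have e2 : Real.exp (-(√m * f (-(Real.pi / 2)))) = 1 + gluingConst m κ := by
    rw [h.normalForm _ ⟨le_rfl, by linarith⟩, exp_neg_sqrt_mul_normalForm hm] <;>
      rw [neg_div, div_div, show (2 : ℝ) * 2 = 4 by norm_num, Real.tan_neg,
        Real.tan_pi_div_four] <;> linarith
  have e3 : Real.exp (-(√m * f (3 * Real.pi / 2))) =
      (1 + gluingConst m κ) / Real.exp (√m * Real.pi) ^ 2 := by
    rw [show 3 * Real.pi / 2 = -(Real.pi / 2) + 2 * Real.pi by ring, h.diffeo.equivariant, ← e2,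
      ← Real.exp_nat_mul, ← Real.exp_sub]
    congr 1
    push_cast
    ring
  rw [← e1, ← e3]
  refine ⟨Real.exp_le_exp.2 (neg_le_neg (mul_le_mul_of_nonneg_left (hmono hx.2) h1.le)),
    Real.exp_le_exp.2 (neg_le_neg (mul_le_mul_of_nonneg_left (hmono hx.1) h1.le))⟩

theorem IsSecondGauge.exp_bounds {m κ : ℝ} {f μ : ℝ → ℝ} (hm : 0 < m) (hκ : 1 < κ)
    (h : IsSecondGauge m κ f μ) {x : ℝ} (hx : x ∈ Set.Icc (-(Real.pi / 2)) (Real.pi / 2)) :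
    1 + gluingConst m κ ≤ Real.exp (-(√m * f x)) ∧
      Real.exp (-(√m * f x)) ≤ (gluingConst m κ - 1) * Real.exp (√m * Real.pi) ^ 2 := by
  have hpi := Real.pi_pos
  have hc := one_lt_gluingConst hm hκ
  have h1 : 0 < √m := Real.sqrt_pos.2 hm
  have hmono := h.diffeo.strictMono.monotone
  have c1 : Real.cot (Real.pi / 2 / 2) = 1 := by
    rw [div_div, show (2 : ℝ) * 2 = 4 by norm_num, Real.cot_eq_cos_div_sin,
      Real.cos_pi_div_four, Real.sin_pi_div_four, div_self (by positivity)]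
  have c2 : Real.cot (3 * Real.pi / 2 / 2) = -1 := by
    rw [show 3 * Real.pi / 2 / 2 = Real.pi - Real.pi / 4 by ring, Real.cot_eq_cos_div_sin,
      Real.cos_pi_sub, Real.sin_pi_sub, Real.cos_pi_div_four, Real.sin_pi_div_four, neg_div,
      div_self (by positivity)]
  have e1 : Real.exp (-(√m * f (Real.pi / 2))) = 1 + gluingConst m κ := by
    rw [h.normalForm _ ⟨le_rfl, by linarith⟩, exp_neg_sqrt_mul_normalForm hm] <;>
      rw [c1]; linarith
  have e2 : Real.exp (-(√m * f (3 * Real.pi / 2))) = gluingConst m κ - 1 := by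
    rw [h.normalForm _ ⟨by linarith, le_rfl⟩, exp_neg_sqrt_mul_normalForm hm] <;>
      rw [c2] <;> linarith
  have e3 : Real.exp (-(√m * f (-(Real.pi / 2)))) =
      (gluingConst m κ - 1) * Real.exp (√m * Real.pi) ^ 2 := by
    have := h.diffeo.equivariant (-(Real.pi / 2))
    rw [← e2, show 3 * Real.pi / 2 = -(Real.pi / 2) + 2 * Real.pi by ring, this,
      ← Real.exp_nat_mul, ← Real.exp_add]
    congr 1
    push_cast
    ring
  rw [← e1, ← e3]
  refine ⟨Real.exp_le_exp.2 (neg_le_neg (mul_le_mul_of_nonneg_left (hmono hx.2) h1.le)),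
    Real.exp_le_exp.2 (neg_le_neg (mul_le_mul_of_nonneg_left (hmono hx.1) h1.le))⟩

theorem two_mul_entropy (m : ℝ) : 2 * entropy m = √m * Real.pi := by
  have : horizonLength m = 2 * Real.pi * √m := by
    simp [horizonLength, staticMetric]
  rw [entropy, this]
  ring

/-! ### The constant mass of the glued potential -/

/-- Left eigenvectors `(1, -q)`, `(1, -q')` of the glued monodromy matrix, with the bounds needed
for positivity. -/
theorem exists_eigen_slopes {a b C D L : ℝ} (ha : 1 < a) (hb : 1 < b) (hC : a + a⁻¹ < C)
    (hD : b + b⁻¹ < D) (hL : 1 < L) (ht : L + L⁻¹ = C * D - b / a - a / b) :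
    ∃ q q' : ℝ, 0 < q ∧ q < 1 ∧ 1 < q' ∧ q * (b * D - b ^ 2) < 1 ∧ (C - a⁻¹) / a < q' ∧
      C * D - b / a - q * (a * D) = L ∧ -C / b + q * (a / b) = -L * q ∧
      C * D - b / a - q' * (a * D) = L⁻¹ ∧ -C / b + q' * (a / b) = -L⁻¹ * q' := by
  obtain ⟨s₁, s₂, s₃, s₄⟩ := eigen_slope_bounds ha hb hC hD hL ht
  have a0 : 0 < a := by linarith
  have b0 : 0 < b := by linarith
  have L0 : 0 < L := by linarith
  have C0 : 0 < C := by linarith [inv_pos.2 a0]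
  have d1 : 0 < b * L + a := by positivity
  have d2 : 0 < b / L + a := by positivity
  have h2 : C * D = L + L⁻¹ + b / a + a / b := by linarith
  refine ⟨C / (b * L + a), C / (b / L + a), div_pos C0 d1, s₁, s₂, s₃, s₄, ?_, ?_, ?_, ?_⟩
  · have e : C * D - b / a - C / (b * L + a) * (a * D) =
      C * D * (b * L) / (b * L + a) - b / a := by field_simp; ring
    rw [e, h2]; field_simp; ring
  · field_simp; ring
  · have e : C * D - b / a - C / (b / L + a) * (a * D) =
      C * D * (b / L) / (b / L + a) - b / a := by field_simp; ring
    rw [e, h2]; field_simp; ring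
  · field_simp; ring

/-- The glued basis of two pieces of positive mass, expressed in eigenvectors of the monodromy
matrix, has positive components; hence the glued potential is in the orbit of a positive
constant. -/
theorem IsGluedPotential.exists_diffeo_to_const {δ : ℝ} {μ₁ μ₂ μ : ℝ → ℝ}
    (h : IsGluedPotential δ μ₁ μ₂ μ) {m₁ m₂ κ₁ κ₂ : ℝ} {f₁ f₂ : ℝ → ℝ}
    (hm₁ : 0 < m₁) (hm₂ : 0 < m₂) (hκ₁ : 1 < κ₁) (hκ₂ : 1 < κ₂)
    (g₁ : IsFirstGauge m₁ κ₁ f₁ μ₁) (g₂ : IsSecondGauge m₂ κ₂ f₂ μ₂) :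
    ∃ mc : ℝ, 0 < mc ∧ (∃ f : ℝ → ℝ, IsCircleDiffeo f ∧ ∀ x, massTransform μ f x = mc) ∧
      Real.cosh (√mc * Real.pi) =
        2 * κ₁ * κ₂ * Real.cosh (√m₁ * Real.pi) * Real.cosh (√m₂ * Real.pi)
          - Real.cosh (√m₁ * Real.pi - √m₂ * Real.pi) := by
  have hpi := Real.pi_pos
  obtain ⟨ψ, hψ, p₁, p₂, hM⟩ := h.exists_glued_exp hm₁ hm₂ hκ₁ hκ₂ g₁ g₂
  rw [glued_monodromy_eq hm₁ hm₂] at hM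
  have x0 : 0 < √m₁ * Real.pi := mul_pos (Real.sqrt_pos.2 hm₁) hpi
  have y0 : 0 < √m₂ * Real.pi := mul_pos (Real.sqrt_pos.2 hm₂) hpi
  have bound₁ := fun x hx => g₁.exp_bounds hm₁ hκ₁ (x := x) hx
  have bound₂ := fun x hx => g₂.exp_bounds hm₂ hκ₂ (x := x) hx
  have hH := one_lt_halfTrace x0 y0 hκ₁ hκ₂
  have htr := halfTrace_eq (√m₁ * Real.pi) (√m₂ * Real.pi) κ₁ κ₂
  have hCc := gluingConst_mul (κ := κ₁) hm₁
  have hDd := gluingConst_mul (κ := κ₂) hm₂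
  have ha : 1 < Real.exp (√m₁ * Real.pi) := Real.one_lt_exp_iff.2 x0
  have hb : 1 < Real.exp (√m₂ * Real.pi) := Real.one_lt_exp_iff.2 y0
  have hC : Real.exp (√m₁ * Real.pi) + (Real.exp (√m₁ * Real.pi))⁻¹ <
      2 * κ₁ * Real.cosh (√m₁ * Real.pi) := by
    rw [← Real.exp_neg, show Real.exp (√m₁ * Real.pi) + Real.exp (-(√m₁ * Real.pi)) =
      2 * Real.cosh (√m₁ * Real.pi) by rw [Real.cosh_eq]; ring]
    nlinarith [Real.cosh_pos (√m₁ * Real.pi)]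
  have hD : Real.exp (√m₂ * Real.pi) + (Real.exp (√m₂ * Real.pi))⁻¹ <
      2 * κ₂ * Real.cosh (√m₂ * Real.pi) := by
    rw [← Real.exp_neg, show Real.exp (√m₂ * Real.pi) + Real.exp (-(√m₂ * Real.pi)) =
      2 * Real.cosh (√m₂ * Real.pi) by rw [Real.cosh_eq]; ring]
    nlinarith [Real.cosh_pos (√m₂ * Real.pi)]
  rw [firstMatrix_inv] at p₁
  rw [secondMatrix_inv] at p₂
  rw [Real.exp_neg] at hCc hDd
  set H := 2 * κ₁ * κ₂ * Real.cosh (√m₁ * Real.pi) * Real.cosh (√m₂ * Real.pi)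
    - Real.cosh (√m₁ * Real.pi - √m₂ * Real.pi) with hHdef
  set a := Real.exp (√m₁ * Real.pi) with hadef
  set b := Real.exp (√m₂ * Real.pi) with hbdef
  set C := 2 * κ₁ * Real.cosh (√m₁ * Real.pi) with hCdef
  set D := 2 * κ₂ * Real.cosh (√m₂ * Real.pi) with hDdef
  set c := gluingConst m₁ κ₁ with hcdef
  set d := gluingConst m₂ κ₂ with hddef
  have a0 : 0 < a := by linarith
  have b0 : 0 < b := by linarith
  -- the larger eigenvalue
  set L := H + √(H ^ 2 - 1) with hLdef
  have hsq : √(H ^ 2 - 1) ^ 2 = H ^ 2 - 1 := Real.sq_sqrt (by nlinarith)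
  have hL : 1 < L := by have := Real.sqrt_nonneg (H ^ 2 - 1); linarith
  have L0 : 0 < L := by linarith
  have hLinv : L⁻¹ = H - √(H ^ 2 - 1) :=
    inv_eq_of_mul_eq_one_right (by rw [hLdef]; linear_combination -hsq)
  have hLsum : L + L⁻¹ = C * D - b / a - a / b := by
    rw [hLinv]; linear_combination -2 * htr
  obtain ⟨q, q', q0, s₁, s₂, s₃, s₄, t1, t2, t1', t2'⟩ := exists_eigen_slopes ha hb hC hD hL hLsum
  have hqq : 0 < q' - q := by linarith only [s₁, s₂]
  set β := (q' - q)⁻¹ with hβ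
  have β0 : 0 < β := inv_pos.2 hqq
  have hβ1 : β * (q' - q) = 1 := inv_mul_cancel₀ hqq.ne'
  -- the Hill basis `φ`, given by eigenvectors of the transposed monodromy matrix
  have hB : (!![1, -q; -β, β * q'] : Matrix (Fin 2) (Fin 2) ℝ).det = 1 := by
    rw [Matrix.det_fin_two_of]; linear_combination hβ1
  set φ : ℝ → Fin 2 → ℝ := fun x => !![1, -q; -β, β * q'] *ᵥ ψ x with hφ
  have φ0 : ∀ x, φ x 0 = ψ x 0 - q * ψ x 1 := fun x => by
    simp [hφ, dotProduct, Fin.sum_univ_two]; ring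
  have φ1 : ∀ x, φ x 1 = β * (q' * ψ x 1 - ψ x 0) := fun x => by
    simp [hφ, dotProduct, Fin.sum_univ_two]; ring
  have M0 : ∀ x, ψ (x + 2 * Real.pi) 0 = (C * D - b / a) * ψ x 0 + -C / b * ψ x 1 := fun x => by
    rw [add_comm, hM]; simp [Matrix.mulVec, dotProduct, Fin.sum_univ_two]
  have M1 : ∀ x, ψ (x + 2 * Real.pi) 1 = a * D * ψ x 0 + -(a / b) * ψ x 1 := fun x => by
    rw [add_comm, hM]; simp [Matrix.mulVec, dotProduct, Fin.sum_univ_two]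
  have per0 : ∀ x, φ (x + 2 * Real.pi) 0 = L * φ x 0 := fun x => by
    rw [φ0, φ0, M0, M1]; linear_combination ψ x 0 * t1 + ψ x 1 * t2
  have per1 : ∀ x, φ (x + 2 * Real.pi) 1 = L⁻¹ * φ x 1 := fun x => by
    rw [φ1, φ1, M0, M1]; linear_combination (-β) * (ψ x 0 * t1' + ψ x 1 * t2')
  have hφM : IsMonodromy φ !![L, 0; 0, L⁻¹] := by
    intro x
    rw [add_comm]
    ext i
    fin_cases i
    · simp [per0, Matrix.mulVec, dotProduct, Fin.sum_univ_two]
    · simp [per1, Matrix.mulVec, dotProduct, Fin.sum_univ_two]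
  -- positivity over one period: the quotient `ψ₀ / ψ₁` stays between `q` and `q'`, because on each
  -- half-circle it is a fractional linear function of the exponential of a monotone function
  have base : ∀ x ∈ Set.Ico (-(Real.pi / 2)) (-(Real.pi / 2) + 2 * Real.pi),
      0 < ψ x 0 - q * ψ x 1 ∧ 0 < q' * ψ x 1 - ψ x 0 := by
    intro x hx
    rcases le_total x (Real.pi / 2) with hle | hge
    · have hm : x ∈ Set.Icc (-(Real.pi / 2)) (Real.pi / 2) := ⟨hx.1, hle⟩
      obtain ⟨w1, w2⟩ := bound₂ x hm
      have v0 := hillPull_expBasis_zero_pos hm₂ g₂.diffeo x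
      have e0 : ψ x 0 = hillPull f₂ (expBasis m₂) x 0 := by
        rw [p₂ x hm]; simp [Matrix.mulVec, dotProduct, Fin.sum_univ_two]
      have e1 : ψ x 1 = (Real.exp (-(√m₂ * f₂ x)) - d) * hillPull f₂ (expBasis m₂) x 0 := by
        rw [p₂ x hm]
        simp [Matrix.mulVec, dotProduct, Fin.sum_univ_two, hillPull_expBasis_one]
        ring
      rw [e0, e1]
      set w := Real.exp (-(√m₂ * f₂ x))
      set v := hillPull f₂ (expBasis m₂) x 0
      have hbD : b * D - b ^ 2 = (d - 1) * b ^ 2 - d := by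
        have : b * b⁻¹ = 1 := mul_inv_cancel₀ b0.ne'
        linear_combination (-b) * hDd - d * this
      rw [hbD] at s₃
      have r1 : 0 < 1 - q * (w - d) := by
        have := mul_le_mul_of_nonneg_left (sub_le_sub_right w2 d) q0.le
        linarith only [this, s₃]
      have r2 : 0 < q' * (w - d) - 1 := by
        have := mul_le_mul_of_nonneg_left (show 1 ≤ w - d by linarith only [w1])
          (show 0 ≤ q' by linarith only [s₂])
        linarith only [this, s₂]
      constructor
      · have := mul_pos v0 r1; linarith only [this]
      · have := mul_pos v0 r2; linarith only [this]
    · have hm : x ∈ Set.Icc (Real.pi / 2) (3 * Real.pi / 2) := ⟨hge, by linarith [hx.2]⟩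
      obtain ⟨w1, w2⟩ := bound₁ x hm
      have v0 := hillPull_expBasis_zero_pos hm₁ g₁.diffeo x
      have e0 : ψ x 0 = (c - Real.exp (-(√m₁ * f₁ x))) * hillPull f₁ (expBasis m₁) x 0 := by
        rw [p₁ x hm]
        simp [Matrix.mulVec, dotProduct, Fin.sum_univ_two, hillPull_expBasis_one]
        ring
      have e1 : ψ x 1 = hillPull f₁ (expBasis m₁) x 0 := by
        rw [p₁ x hm]; simp [Matrix.mulVec, dotProduct, Fin.sum_univ_two]
      rw [e0, e1]
      set y := Real.exp (-(√m₁ * f₁ x))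
      set v := hillPull f₁ (expBasis m₁) x 0
      have hCa : (C - a⁻¹) / a = c - (1 + c) / a ^ 2 := by
        rw [← hCc]; field_simp; ring
      rw [hCa] at s₄
      have r1 : 0 < c - y - q := by linarith only [w2, s₁]
      have r2 : 0 < q' - (c - y) := by linarith only [w1, s₄]
      constructor
      · have := mul_pos v0 r1; linarith only [this]
      · have := mul_pos v0 r2; linarith only [this]
  have hpos : ∀ i x, 0 < φ x i := by
    intro i x
    fin_cases i
    · exact pos_of_quasiPeriodic (u := fun x => φ x 0) Real.two_pi_pos L0 per0
        (fun x hx => by simp only [φ0]; exact (base x hx).1) x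
    · exact pos_of_quasiPeriodic (u := fun x => φ x 1) Real.two_pi_pos (inv_pos.2 L0) per1
        (fun x hx => by simp only [φ1]; exact mul_pos β0 (base x hx).2) x
  have hlog : 0 < Real.log L := Real.log_pos hL
  refine ⟨(Real.log L / Real.pi) ^ 2, by positivity,
    _root_.exists_diffeo_to_const h.circle hL (hψ.mulVec hB) hφM hpos, ?_⟩
  rw [Real.sqrt_sq (by positivity), div_mul_cancel₀ _ hpi.ne', Real.cosh_eq, Real.exp_neg,
    Real.exp_log L0, hLinv, hLdef]
  ring

/-! ### Pulled-back metrics -/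

/-- The metric of a surface as a function on the model plane; the tangent spaces are all identified
with this plane, which allows rewriting of base points. -/
def RiemannianSurface.innerAt (S : RiemannianSurface.{u}) (x : S.carrier)
    (v w : EuclideanSpace ℝ (Fin 2)) : ℝ :=
  S.metric.inner x v w

theorem pullbackMetric_congr {S : RiemannianSurface.{u}} {e e' : ℝ × ℝ → S.carrier} {p : ℝ × ℝ}
    (h : e =ᶠ[𝓝 p] e') (v w : ℝ × ℝ) : pullbackMetric S e p v w = pullbackMetric S e' p v w := by
  have h1 : (mfderiv 𝓘(ℝ, ℝ × ℝ) (𝓡 2) e p : ℝ × ℝ →L[ℝ] EuclideanSpace ℝ (Fin 2)) =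
    mfderiv 𝓘(ℝ, ℝ × ℝ) (𝓡 2) e' p := h.mfderiv_eq
  change S.innerAt (e p) ((mfderiv 𝓘(ℝ, ℝ × ℝ) (𝓡 2) e p : ℝ × ℝ →L[ℝ] _) v)
    ((mfderiv 𝓘(ℝ, ℝ × ℝ) (𝓡 2) e p : ℝ × ℝ →L[ℝ] _) w) = _
  rw [h1, h.eq_of_nhds]
  rfl

theorem pullbackMetric_pos {S : RiemannianSurface.{u}} {e : ℝ × ℝ → S.carrier} {p v : ℝ × ℝ}
    (h : Function.Injective (mfderiv 𝓘(ℝ, ℝ × ℝ) (𝓡 2) e p)) (hv : v ≠ 0) :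
    0 < pullbackMetric S e p v v :=
  S.metric.pos _ _ fun h0 => hv (h (h0.trans (map_zero _).symm))

theorem injective_of_pullbackMetric_pos {S : RiemannianSurface.{u}} {e : ℝ × ℝ → S.carrier}
    {p : ℝ × ℝ} (h : ∀ v, v ≠ 0 → 0 < pullbackMetric S e p v v) :
    Function.Injective (mfderiv 𝓘(ℝ, ℝ × ℝ) (𝓡 2) e p) := by
  refine (injective_iff_map_eq_zero _).2 fun v hv => ?_
  by_contra h0
  refine (h v h0).ne' ((congrArg (fun z => S.innerAt (e p) z z) hv).trans ?_)
  exact (S.metric.inner (e p) 0).map_zero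

namespace IsIsometricOpenEmbeddingOn

variable {S : RiemannianSurface.{u}} {T : RiemannianSurface.{v}} {U : Set S.carrier}
  {j : S.carrier → T.carrier}

theorem injOn (hj : IsIsometricOpenEmbeddingOn S T U j) : Set.InjOn j U :=
  Set.injOn_iff_injective.2 hj.openEmbedding.injective

theorem isOpen_image (hj : IsIsometricOpenEmbeddingOn S T U j) {V : Set S.carrier}
    (hV : IsOpen V) : IsOpen (j '' (V ∩ U)) := by
  rw [← Set.image_domRestrict]
  exact hj.openEmbedding.isOpenMap _ (hV.preimage continuous_subtype_val)

theorem pullbackMetric_eq (hj : IsIsometricOpenEmbeddingOn S T U j) (hU : IsOpen U)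
    {e : ℝ × ℝ → S.carrier} {e' : ℝ × ℝ → T.carrier} {p : ℝ × ℝ} (h : e' =ᶠ[𝓝 p] j ∘ e)
    (hp : e p ∈ U) (he : MDifferentiableAt 𝓘(ℝ, ℝ × ℝ) (𝓡 2) e p) (v w : ℝ × ℝ) :
    pullbackMetric T e' p v w = pullbackMetric S e p v w := by
  rw [pullbackMetric_congr h]
  have hjd : MDifferentiableAt (𝓡 2) (𝓡 2) j (e p) :=
    ((hj.smooth (e p) hp).contMDiffAt (hU.mem_nhds hp)).mdifferentiableAt (by simp)
  have hc := mfderiv_comp p hjd he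
  rw [pullbackMetric, hc]
  exact hj.isometry (e p) hp _ _

end IsIsometricOpenEmbeddingOn

theorem metricError_congr {S : RiemannianSurface.{u}} {T : RiemannianSurface.{v}}
    {e : ℝ × ℝ → S.carrier} {e' : ℝ × ℝ → T.carrier} {p : ℝ × ℝ}
    (h : ∀ v w, pullbackMetric T e' p v w = pullbackMetric S e p v w) (i j : Fin 2) :
    metricError T e' i j p = metricError S e i j p := by
  rw [metricError, metricError, h]

theorem partialDeriv_congr {F F' : ℝ × ℝ → ℝ} {p : ℝ × ℝ} (h : F =ᶠ[𝓝 p] F') (i : Fin 2) :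
    partialDeriv i F p = partialDeriv i F' p := by
  rw [partialDeriv, partialDeriv, h.fderiv_eq]

theorem christoffel_congr {g g' : ℝ × ℝ → Matrix (Fin 2) (Fin 2) ℝ} {p : ℝ × ℝ}
    (h : g =ᶠ[𝓝 p] g') (k i j : Fin 2) : christoffel g k i j p = christoffel g' k i j p := by
  have hc : ∀ a b, (fun q => g q a b) =ᶠ[𝓝 p] fun q => g' q a b := fun a b =>
    h.mono fun q hq => by simp only [hq]
  simp only [christoffel, h.eq_of_nhds, partialDeriv_congr (hc _ _)]

/-- The scalar curvature depends only on the germ of the metric. -/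
theorem scalarCurvature_congr {g g' : ℝ × ℝ → Matrix (Fin 2) (Fin 2) ℝ} {p : ℝ × ℝ}
    (h : g =ᶠ[𝓝 p] g') : scalarCurvature g p = scalarCurvature g' p := by
  have hc : ∀ k i j, christoffel g k i j =ᶠ[𝓝 p] christoffel g' k i j := fun k i j =>
    h.eventuallyEq_nhds.mono fun q hq => christoffel_congr hq k i j
  simp only [scalarCurvature, ricci, h.eq_of_nhds, partialDeriv_congr (hc _ _ _),
    (hc _ _ _).eq_of_nhds]

/-! ### Polar coordinates of the disc -/

/-- The Euclidean radius in the Poincaré disc of the points at polar radius `r`. -/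
def discRadius (r : ℝ) : ℝ := r / (1 + √(1 + r ^ 2))

theorem discPolar_fst (p : ℝ × ℝ) : (discPolar p).1 = discRadius p.1 * Real.cos p.2 := rfl

theorem discPolar_snd (p : ℝ × ℝ) : (discPolar p).2 = discRadius p.1 * Real.sin p.2 := rfl

theorem discRadius_pos {r : ℝ} (hr : 0 < r) : 0 < discRadius r := by
  unfold discRadius; positivity

theorem discRadius_lt_one {r : ℝ} : discRadius r < 1 := by
  have h : |r| ≤ √(1 + r ^ 2) := Real.abs_le_sqrt (by linarith)
  rw [discRadius, div_lt_one (by positivity)]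
  linarith [le_abs_self r]

theorem one_sub_discRadius_sq (r : ℝ) : 1 - discRadius r ^ 2 = 2 / (1 + √(1 + r ^ 2)) := by
  have h : √(1 + r ^ 2) ^ 2 = 1 + r ^ 2 := Real.sq_sqrt (by positivity)
  rw [discRadius]
  field_simp
  linear_combination h

theorem discPolar_mem_unitDisc {p : ℝ × ℝ} (hp : 0 < p.1) : discPolar p ∈ unitDisc := by
  have h1 := discRadius_pos hp
  have h2 : discRadius p.1 < 1 := discRadius_lt_one
  change (discPolar p).1 ^ 2 + (discPolar p).2 ^ 2 < 1
  rw [discPolar_fst, discPolar_snd]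
  have := Real.sin_sq_add_cos_sq p.2
  have e : (discRadius p.1 * Real.cos p.2) ^ 2 + (discRadius p.1 * Real.sin p.2) ^ 2 =
    discRadius p.1 ^ 2 := by linear_combination discRadius p.1 ^ 2 * this
  rw [e]
  nlinarith

theorem hasDerivAt_discRadius (r : ℝ) :
    HasDerivAt discRadius (1 / (√(1 + r ^ 2) * (1 + √(1 + r ^ 2)))) r := by
  have h0 : 0 < 1 + r ^ 2 := by positivity
  have h1 : √(1 + r ^ 2) ^ 2 = 1 + r ^ 2 := Real.sq_sqrt h0.le
  have h2 : 0 < √(1 + r ^ 2) := Real.sqrt_pos.2 h0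
  have hq : HasDerivAt (fun r : ℝ => 1 + r ^ 2) (2 * r) r := by
    simpa using ((hasDerivAt_id' r).pow 2).const_add 1
  refine ((hasDerivAt_id' r).div ((hq.sqrt h0.ne').const_add 1) (by positivity)).congr_deriv ?_
  field_simp
  linear_combination h1

theorem hasFDerivAt_discPolar (p : ℝ × ℝ) : ∃ D : ℝ × ℝ →L[ℝ] ℝ × ℝ, HasFDerivAt discPolar D p ∧
    ∀ v, D v =
      (1 / (√(1 + p.1 ^ 2) * (1 + √(1 + p.1 ^ 2))) * v.1 * Real.cos p.2 -
        discRadius p.1 * Real.sin p.2 * v.2,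
      1 / (√(1 + p.1 ^ 2) * (1 + √(1 + p.1 ^ 2))) * v.1 * Real.sin p.2 +
        discRadius p.1 * Real.cos p.2 * v.2) := by
  have h1 : HasFDerivAt (fun q : ℝ × ℝ => discRadius q.1) _ p :=
    (hasDerivAt_discRadius p.1).comp_hasFDerivAt (f := Prod.fst)
      (f' := ContinuousLinearMap.fst ℝ ℝ ℝ) p hasFDerivAt_fst
  have hc : HasFDerivAt (fun q : ℝ × ℝ => Real.cos q.2) _ p :=
    (Real.hasDerivAt_cos p.2).comp_hasFDerivAt (f := Prod.snd)
      (f' := ContinuousLinearMap.snd ℝ ℝ ℝ) p hasFDerivAt_snd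
  have hs : HasFDerivAt (fun q : ℝ × ℝ => Real.sin q.2) _ p :=
    (Real.hasDerivAt_sin p.2).comp_hasFDerivAt (f := Prod.snd)
      (f' := ContinuousLinearMap.snd ℝ ℝ ℝ) p hasFDerivAt_snd
  refine ⟨_, (h1.mul hc).prodMk (h1.mul hs), fun v => ?_⟩
  ext
  · simp; ring
  · simp; ring

theorem continuous_discPolar : Continuous discPolar :=
  continuous_iff_continuousAt.2 fun p => by
    obtain ⟨D, hD, -⟩ := hasFDerivAt_discPolar p
    exact hD.continuousAt

/-- The hyperbolic metric in polar coordinates. -/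
theorem poincareMetric_discPolar (p v w : ℝ × ℝ) {D : ℝ × ℝ →L[ℝ] ℝ × ℝ}
    (hD : HasFDerivAt discPolar D p) :
    poincareMetric (discPolar p) (D v) (D w) =
      v.1 * w.1 / (1 + p.1 ^ 2) + p.1 ^ 2 * (v.2 * w.2) := by
  obtain ⟨D', hD', e⟩ := hasFDerivAt_discPolar p
  rw [hD.unique hD', e, e, poincareMetric]
  have hsc := Real.sin_sq_add_cos_sq p.2
  have h0 : 0 < 1 + p.1 ^ 2 := by positivity
  have h1 : √(1 + p.1 ^ 2) ^ 2 = 1 + p.1 ^ 2 := Real.sq_sqrt h0.le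
  have h2 : 0 < √(1 + p.1 ^ 2) := Real.sqrt_pos.2 h0
  have e1 : 1 - (discPolar p).1 ^ 2 - (discPolar p).2 ^ 2 = 2 / (1 + √(1 + p.1 ^ 2)) := by
    rw [← one_sub_discRadius_sq, discPolar_fst, discPolar_snd]
    linear_combination (-discRadius p.1 ^ 2) * hsc
  rw [e1]
  have e2 : ∀ a b x y ρ : ℝ, (a * x * Real.cos p.2 - ρ * Real.sin p.2 * y) *
      (a * b * Real.cos p.2 - ρ * Real.sin p.2 * w.2) +
      (a * x * Real.sin p.2 + ρ * Real.cos p.2 * y) *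
      (a * b * Real.sin p.2 + ρ * Real.cos p.2 * w.2) = a ^ 2 * (x * b) + ρ ^ 2 * (y * w.2) := by
    intro a b x y ρ
    linear_combination (a ^ 2 * x * b + ρ ^ 2 * y * w.2) * hsc
  rw [e2, discRadius]
  set s := √(1 + p.1 ^ 2)
  rw [← h1]
  field_simp
  ring

theorem isOpen_discPart (σ a : ℝ) : IsOpen (discPart σ a) := by
  have h1 : IsOpen unitDisc := isOpen_lt (by fun_prop) continuous_const
  exact h1.inter (isOpen_lt continuous_const (continuous_const.mul continuous_fst))

/-! ### The end of a piece over its half-plane -/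

namespace MaskitPiece

variable {σ δ : ℝ} (P : MaskitPiece.{u} σ δ)

theorem isOpen_keep : IsOpen P.keep :=
  (P.s_closed δ (by linarith [P.δ_pos])).isOpen_compl

theorem mdifferentiableAt_e {p : ℝ × ℝ} (hp : P.R < p.1) :
    MDifferentiableAt 𝓘(ℝ, ℝ × ℝ) (𝓡 2) P.e p :=
  ((P.isEnd.smooth p hp).contMDiffAt
    ((isOpen_lt continuous_const continuous_fst).mem_nhds hp)).mdifferentiableAt (by simp)

theorem e_mem_keep {p : ℝ × ℝ} (hp : P.R < p.1) (h : σ * (discPolar p).1 < δ) : P.e p ∈ P.keep := by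
  rintro ⟨y, hy, e⟩
  have hδ := P.δ_pos
  have hy' : y ∈ discPart σ (-δ) := ⟨hy.1, by linarith [hy.2]⟩
  have hm := P.e_mem_s p hp ⟨y, hy', e⟩
  have : y = discPolar p := P.s_injOn hy' hm (e.trans (P.s_eq_e p hp hm).symm)
  rw [this] at hy
  linarith [hy.2]

theorem lt_of_e_mem_keep {p : ℝ × ℝ} (hp : P.R < p.1) (h : P.e p ∈ P.keep) :
    σ * (discPolar p).1 < δ := by
  by_contra hn
  have hd := discPolar_mem_unitDisc (P.isEnd.R_pos.trans hp)
  exact h ⟨discPolar p, ⟨hd, not_lt.1 hn⟩,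
    P.s_eq_e p hp ⟨hd, by linarith [P.δ_pos, not_lt.1 hn]⟩⟩

/-- Points of the half-plane in the range of the coordinates have these polar coordinates. -/
theorem eq_discPolar {p z : ℝ × ℝ} (hp : P.R < p.1) (hz : z ∈ discPart σ (-δ))
    (h : P.s z = P.e p) : z = discPolar p := by
  have hm := P.e_mem_s p hp ⟨z, hz, h⟩
  exact P.s_injOn hz hm (h.trans (P.s_eq_e p hp hm).symm)

theorem pullbackMetric_e {p : ℝ × ℝ} (hp : P.R < p.1) (h : discPolar p ∈ discPart σ (-δ))
    (v w : ℝ × ℝ) : pullbackMetric P.toRiemannianSurface P.e p v w =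
      v.1 * w.1 / (1 + p.1 ^ 2) + p.1 ^ 2 * (v.2 * w.2) := by
  have he : P.e =ᶠ[𝓝 p] P.s ∘ discPolar := by
    filter_upwards [(isOpen_lt continuous_const continuous_fst).mem_nhds hp,
      continuous_discPolar.continuousAt ((isOpen_discPart σ (-δ)).mem_nhds h)] with q hq hq'
    exact (P.s_eq_e q hq hq').symm
  obtain ⟨D, hD, -⟩ := hasFDerivAt_discPolar p
  rw [pullbackMetric_congr he, ← poincareMetric_discPolar p v w hD, ← P.s_isometry _ h]
  have hs : MDifferentiableAt 𝓘(ℝ, ℝ × ℝ) (𝓡 2) P.s (discPolar p) :=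
    ((P.s_smooth _ h).contMDiffAt ((isOpen_discPart σ (-δ)).mem_nhds h)).mdifferentiableAt
      (by simp)
  have hc := mfderiv_comp p hs hD.differentiableAt.mdifferentiableAt
  rw [pullbackMetric, hc, mfderiv_eq_fderiv, hD.fderiv]
  rfl

theorem discPolar_mem {p : ℝ × ℝ} (hp : P.R < p.1) (h : -δ < σ * Real.cos p.2) :
    discPolar p ∈ discPart σ (-δ) := by
  have h0 := P.isEnd.R_pos.trans hp
  refine ⟨discPolar_mem_unitDisc h0, ?_⟩
  rw [discPolar_fst]
  have h1 := discRadius_pos h0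
  have h2 : discRadius p.1 < 1 := discRadius_lt_one
  have hδ := P.δ_pos
  rcases le_total 0 (σ * Real.cos p.2) with hc | hc <;> nlinarith

theorem tendsto_sq_div : Tendsto (fun r : ℝ => r ^ 2 * (-1 / (1 + r ^ 2))) atTop (𝓝 (-1)) := by
  have h : Tendsto (fun r : ℝ => -1 + (1 + r ^ 2)⁻¹) atTop (𝓝 (-1 + 0)) :=
    (tendsto_inv_atTop_zero.comp
      (tendsto_const_nhds.add_atTop (tendsto_pow_atTop two_ne_zero))).const_add _
  rw [add_zero] at h
  refine h.congr fun r => ?_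
  field_simp
  ring

theorem metricError_e {p : ℝ × ℝ} (hp : P.R < p.1) (h : discPolar p ∈ discPart σ (-δ))
    (i j : Fin 2) : metricError P.toRiemannianSurface P.e i j p =
      if i = 0 ∧ j = 0 then -1 / (1 + p.1 ^ 2) else 0 := by
  have h0 := (P.isEnd.R_pos.trans hp).ne'
  rw [metricError, P.pullbackMetric_e hp h]
  fin_cases i <;> fin_cases j <;> simp [frameVec]
  · field_simp; ring
  · field_simp; ring

/-- Near the arc of its half-plane the coefficients of the asymptotic expansion are those of the
hyperbolic plane. -/
theorem massAspect_coeff {τ : Fin 2 → Fin 2 → ℝ → ℝ}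
    (h : ∀ i j, TendstoUniformly
      (fun r φ => r ^ 2 * metricError P.toRiemannianSurface P.e i j (r, φ)) (τ i j) atTop)
    {φ : ℝ} (hφ : -δ < σ * Real.cos φ) (i j : Fin 2) :
    τ i j φ = if i = 0 ∧ j = 0 then -1 else 0 := by
  have h1 := (h i j).tendsto_at φ
  refine tendsto_nhds_unique h1 ?_
  have h2 : Tendsto (fun r : ℝ => r ^ 2 * (if i = 0 ∧ j = 0 then -1 / (1 + r ^ 2) else 0)) atTop
      (𝓝 (if i = 0 ∧ j = 0 then -1 else 0)) := by
    split_ifs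
    · exact tendsto_sq_div
    · simp
  refine h2.congr' ?_
  filter_upwards [eventually_gt_atTop P.R] with r hr
  rw [P.metricError_e (p := (r, φ)) hr (P.discPolar_mem hr hφ)]

/-- Over the arc of its half-plane a piece has the mass-aspect function of the hyperbolic plane. -/
theorem μ_eq_neg_one {φ : ℝ} (hφ : -δ < σ * Real.cos φ) : P.μ φ = -1 := by
  obtain ⟨τ, -, h2, -, h4⟩ := P.isEnd.massAspect
  rw [h4, P.massAspect_coeff h2 hφ, P.massAspect_coeff h2 hφ]
  simp

end MaskitPiece

theorem IsALHEnd.isCircleFunction {S : RiemannianSurface.{u}} {R : ℝ} {e : ℝ × ℝ → S.carrier}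
    {μ : ℝ → ℝ} (h : IsALHEnd S R e μ) : IsCircleFunction μ := by
  obtain ⟨τ, h1, -, -, h4⟩ := h.massAspect
  refine ⟨?_, fun x => ?_⟩
  · rw [show μ = fun φ => τ 0 0 φ + 2 * τ 1 1 φ from funext h4]
    exact (h1 0 0).smooth.add (contDiff_const.mul (h1 1 1).smooth)
  · rw [h4, h4, (h1 0 0).periodic, (h1 1 1).periodic]

/-! ### The end of the glued surface -/

namespace MaskitGluing

variable {δ : ℝ} {P : MaskitPiece.{u} 1 δ} {Q : MaskitPiece.{v} (-1) δ}
  (G : MaskitGluing.{u, v, w} P Q)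

theorem discPolar_fst_nonneg {p : ℝ × ℝ} (hp : 0 < p.1) (h : 0 ≤ Real.cos p.2) :
    0 ≤ (discPolar p).1 := mul_nonneg (discRadius_pos hp).le h

theorem discPolar_fst_neg {p : ℝ × ℝ} (hp : 0 < p.1) (h : Real.cos p.2 < 0) :
    (discPolar p).1 < 0 := mul_neg_of_pos_of_neg (discRadius_pos hp) h

/-- Over the strip around the geodesic the coordinates of both pieces are identified. -/
theorem jP_eq_jQ {p : ℝ × ℝ} (hP : P.R < p.1) (hQ : Q.R < p.1) (h1 : -δ < (discPolar p).1)
    (h2 : (discPolar p).1 < δ) : G.jP (P.e p) = G.jQ (Q.e p) := by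
  have hd := discPolar_mem_unitDisc (P.isEnd.R_pos.trans hP)
  exact (G.overlap _ (P.e_mem_keep hP (by linarith)) _ (Q.e_mem_keep hQ (by linarith))).2
    ⟨discPolar p, ⟨hd, abs_lt.2 ⟨h1, h2⟩⟩, P.s_eq_e p hP ⟨hd, by linarith⟩,
      Q.s_eq_e p hQ ⟨hd, by linarith⟩⟩

theorem e_eq_jQ {p : ℝ × ℝ} (hP : P.R < p.1) (hQ : Q.R < p.1) (h : -δ < (discPolar p).1) :
    G.e p = G.jQ (Q.e p) := by
  unfold e
  split_ifs with hc
  · rfl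
  · have := discPolar_fst_neg (P.isEnd.R_pos.trans hP) (not_le.1 hc)
    exact G.jP_eq_jQ hP hQ h (by linarith [P.δ_pos])

theorem e_eq_jP {p : ℝ × ℝ} (hP : P.R < p.1) (hQ : Q.R < p.1) (h : (discPolar p).1 < δ) :
    G.e p = G.jP (P.e p) := by
  unfold e
  split_ifs with hc
  · have := discPolar_fst_nonneg (P.isEnd.R_pos.trans hP) hc
    exact (G.jP_eq_jQ hP hQ (by linarith [P.δ_pos]) h).symm
  · rfl

theorem e_eventuallyEq_jQ {p : ℝ × ℝ} (hP : P.R < p.1) (hQ : Q.R < p.1)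
    (h : -δ < (discPolar p).1) : G.e =ᶠ[𝓝 p] G.jQ ∘ Q.e := by
  filter_upwards [(isOpen_lt continuous_const continuous_fst).mem_nhds hP,
    (isOpen_lt continuous_const continuous_fst).mem_nhds hQ,
    (isOpen_lt continuous_const (continuous_fst.comp continuous_discPolar)).mem_nhds h]
    with q h1 h2 h3
  exact G.e_eq_jQ h1 h2 h3

theorem e_eventuallyEq_jP {p : ℝ × ℝ} (hP : P.R < p.1) (hQ : Q.R < p.1)
    (h : (discPolar p).1 < δ) : G.e =ᶠ[𝓝 p] G.jP ∘ P.e := by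
  filter_upwards [(isOpen_lt continuous_const continuous_fst).mem_nhds hP,
    (isOpen_lt continuous_const continuous_fst).mem_nhds hQ,
    (isOpen_lt (continuous_fst.comp continuous_discPolar) continuous_const).mem_nhds h]
    with q h1 h2 h3
  exact G.e_eq_jP h1 h2 h3

theorem pullbackMetric_eq_Q {p : ℝ × ℝ} (hP : P.R < p.1) (hQ : Q.R < p.1)
    (h : -δ < (discPolar p).1) (v w : ℝ × ℝ) :
    pullbackMetric G.toRiemannianSurface G.e p v w =
      pullbackMetric Q.toRiemannianSurface Q.e p v w :=
  G.jQ_embedding.pullbackMetric_eq Q.isOpen_keep (G.e_eventuallyEq_jQ hP hQ h)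
    (Q.e_mem_keep hQ (by linarith)) (Q.mdifferentiableAt_e hQ) v w

theorem pullbackMetric_eq_P {p : ℝ × ℝ} (hP : P.R < p.1) (hQ : Q.R < p.1)
    (h : (discPolar p).1 < δ) (v w : ℝ × ℝ) :
    pullbackMetric G.toRiemannianSurface G.e p v w =
      pullbackMetric P.toRiemannianSurface P.e p v w :=
  G.jP_embedding.pullbackMetric_eq P.isOpen_keep (G.e_eventuallyEq_jP hP hQ h)
    (P.e_mem_keep hP (by linarith)) (P.mdifferentiableAt_e hP) v w

theorem neg_lt_or_lt {δ : ℝ} (hδ : 0 < δ) (y : ℝ) : -δ < y ∨ y < δ :=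
  (lt_or_ge (-δ) y).imp_right fun h => by linarith

theorem contMDiffAt_e {p : ℝ × ℝ} (hP : P.R < p.1) (hQ : Q.R < p.1) :
    ContMDiffAt 𝓘(ℝ, ℝ × ℝ) (𝓡 2) ∞ G.e p := by
  rcases neg_lt_or_lt P.δ_pos (discPolar p).1 with h | h
  · refine ContMDiffAt.congr_of_eventuallyEq ?_ (G.e_eventuallyEq_jQ hP hQ h)
    have hk := Q.e_mem_keep hQ (by linarith)
    exact ((G.jQ_embedding.smooth _ hk).contMDiffAt (Q.isOpen_keep.mem_nhds hk)).comp p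
      ((Q.isEnd.smooth p hQ).contMDiffAt
        ((isOpen_lt continuous_const continuous_fst).mem_nhds hQ))
  · refine ContMDiffAt.congr_of_eventuallyEq ?_ (G.e_eventuallyEq_jP hP hQ h)
    have hk := P.e_mem_keep hP (by linarith)
    exact ((G.jP_embedding.smooth _ hk).contMDiffAt (P.isOpen_keep.mem_nhds hk)).comp p
      ((P.isEnd.smooth p hP).contMDiffAt
        ((isOpen_lt continuous_const continuous_fst).mem_nhds hP))

/-- Points of the two remainders which are identified have the same polar coordinates. -/
theorem eq_of_jP_eq_jQ {q : ℝ × ℝ} {x : P.carrier} (hx : x ∈ P.keep) (hq : Q.R < q.1)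
    (h2 : -δ < (discPolar q).1) (h : G.jP x = G.jQ (Q.e q)) :
    discPolar q ∈ discStrip δ ∧ P.s (discPolar q) = x := by
  obtain ⟨z, hz, e1, e2⟩ := (G.overlap _ hx _ (Q.e_mem_keep hq (by linarith))).1 h
  have hab := abs_lt.1 hz.2
  have hzq := Q.eq_discPolar hq ⟨hz.1, by linarith⟩ e2
  rw [← hzq]
  exact ⟨hz, e1⟩

theorem eq_of_jQ_eq_jP {q : ℝ × ℝ} {x : Q.carrier} (hx : x ∈ Q.keep) (hq : P.R < q.1)
    (h2 : (discPolar q).1 < δ) (h : G.jQ x = G.jP (P.e q)) :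
    discPolar q ∈ discStrip δ ∧ Q.s (discPolar q) = x := by
  obtain ⟨z, hz, e1, e2⟩ := (G.overlap _ (P.e_mem_keep hq (by linarith)) _ hx).1 h.symm
  have hab := abs_lt.1 hz.2
  have hzq := P.eq_discPolar hq ⟨hz.1, by linarith⟩ e1
  rw [← hzq]
  exact ⟨hz, e2⟩

theorem injective_e {p q : ℝ × ℝ} (hpP : P.R < p.1) (hpQ : Q.R < p.1) (hqP : P.R < q.1)
    (hqQ : Q.R < q.1) (h : G.e p = G.e q) :
    p.1 = q.1 ∧ ∃ k : ℤ, p.2 = q.2 + k * (2 * Real.pi) := by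
  have hδ := P.δ_pos
  -- points over different half-circles which are identified lie in the strip and have the same
  -- coordinates `y`, but their first coordinates have different signs
  have mixed : ∀ {p q : ℝ × ℝ}, P.R < p.1 → Q.R < p.1 → P.R < q.1 → Q.R < q.1 →
      0 ≤ Real.cos p.2 → Real.cos q.2 < 0 → G.e p ≠ G.e q := by
    intro p q hpP hpQ hqP hqQ hp hq h
    have h1 := discPolar_fst_nonneg (P.isEnd.R_pos.trans hpP) hp
    have h2 := discPolar_fst_neg (P.isEnd.R_pos.trans hqP) hq
    rw [G.e_eq_jQ hpP hpQ (by linarith), G.e_eq_jP hqP hqQ (by linarith)] at h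
    obtain ⟨hs, e⟩ := G.eq_of_jP_eq_jQ (P.e_mem_keep hqP (by linarith)) hpQ
      (by linarith) h.symm
    have hab := abs_lt.1 hs.2
    have := P.eq_discPolar hqP ⟨hs.1, by linarith⟩ e
    rw [this] at h1
    linarith
  rcases le_or_gt 0 (Real.cos p.2) with hp | hp <;> rcases le_or_gt 0 (Real.cos q.2) with hq | hq
  · have h1 := discPolar_fst_nonneg (P.isEnd.R_pos.trans hpP) hp
    have h2 := discPolar_fst_nonneg (P.isEnd.R_pos.trans hqP) hq
    rw [G.e_eq_jQ hpP hpQ (by linarith), G.e_eq_jQ hqP hqQ (by linarith)] at h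
    exact Q.isEnd.injective p q hpQ hqQ (G.jQ_embedding.injOn (Q.e_mem_keep hpQ (by linarith))
      (Q.e_mem_keep hqQ (by linarith)) h)
  · exact absurd h (mixed hpP hpQ hqP hqQ hp hq)
  · exact absurd h.symm (mixed hqP hqQ hpP hpQ hq hp)
  · have h1 := discPolar_fst_neg (P.isEnd.R_pos.trans hpP) hp
    have h2 := discPolar_fst_neg (P.isEnd.R_pos.trans hqP) hq
    rw [G.e_eq_jP hpP hpQ (by linarith), G.e_eq_jP hqP hqQ (by linarith)] at h
    exact P.isEnd.injective p q hpP hqP (G.jP_embedding.injOn (P.e_mem_keep hpP (by linarith))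
      (P.e_mem_keep hqP (by linarith)) h)

theorem isClosed_e_image {R' : ℝ} (hP : P.R < R') (hQ : Q.R < R') :
    IsClosed (G.e '' {p | R' ≤ p.1}) := by
  have hδ := P.δ_pos
  -- the complement is the union of the complements of the ends of the two remainders
  have key : (G.e '' {p | R' ≤ p.1})ᶜ =
      G.jP '' ((P.e '' {p | R' ≤ p.1})ᶜ ∩ P.keep) ∪ G.jQ '' ((Q.e '' {p | R' ≤ p.1})ᶜ ∩ Q.keep) := by
    ext y
    constructor
    · intro hy
      have hyc : y ∈ G.jP '' P.keep ∪ G.jQ '' Q.keep := by rw [G.cover]; trivial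
      rcases hyc with ⟨x, hx, rfl⟩ | ⟨x, hx, rfl⟩
      · refine Or.inl ⟨x, ⟨?_, hx⟩, rfl⟩
        rintro ⟨p, hp, rfl⟩
        have hp1 : P.R < p.1 := hP.trans_le hp
        have := P.lt_of_e_mem_keep hp1 hx
        exact hy ⟨p, hp, G.e_eq_jP hp1 (hQ.trans_le hp) (by linarith)⟩
      · refine Or.inr ⟨x, ⟨?_, hx⟩, rfl⟩
        rintro ⟨p, hp, rfl⟩
        have hp1 : Q.R < p.1 := hQ.trans_le hp
        have := Q.lt_of_e_mem_keep hp1 hx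
        exact hy ⟨p, hp, G.e_eq_jQ (hP.trans_le hp) hp1 (by linarith)⟩
    · rintro (⟨x, ⟨hxe, hx⟩, rfl⟩ | ⟨x, ⟨hxe, hx⟩, rfl⟩) ⟨p, hp, h⟩
      · have hpP : P.R < p.1 := hP.trans_le hp
        have hpQ : Q.R < p.1 := hQ.trans_le hp
        rcases neg_lt_or_lt P.δ_pos (discPolar p).1 with hc | hc
        · rw [G.e_eq_jQ hpP hpQ hc] at h
          obtain ⟨hs, e⟩ := G.eq_of_jP_eq_jQ hx hpQ hc h.symm
          have hab := abs_lt.1 hs.2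
          exact hxe ⟨p, hp, (P.s_eq_e p hpP ⟨hs.1, by linarith⟩).symm.trans e⟩
        · rw [G.e_eq_jP hpP hpQ hc] at h
          exact hxe ⟨p, hp, G.jP_embedding.injOn (P.e_mem_keep hpP (by linarith)) hx h⟩
      · have hpP : P.R < p.1 := hP.trans_le hp
        have hpQ : Q.R < p.1 := hQ.trans_le hp
        rcases neg_lt_or_lt P.δ_pos (discPolar p).1 with hc | hc
        · rw [G.e_eq_jQ hpP hpQ hc] at h
          exact hxe ⟨p, hp, G.jQ_embedding.injOn (Q.e_mem_keep hpQ (by linarith)) hx h⟩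
        · rw [G.e_eq_jP hpP hpQ hc] at h
          obtain ⟨hs, e⟩ := G.eq_of_jQ_eq_jP hx hpP hc h.symm
          have hab := abs_lt.1 hs.2
          exact hxe ⟨p, hp, (Q.s_eq_e p hpQ ⟨hs.1, by linarith⟩).symm.trans e⟩
  rw [← isOpen_compl_iff, key]
  exact (G.jP_embedding.isOpen_image (P.isEnd.closed R' hP).isOpen_compl).union
    (G.jQ_embedding.isOpen_image (Q.isEnd.closed R' hQ).isOpen_compl)

theorem metricMatrix_eventuallyEq {p : ℝ × ℝ} (hP : P.R < p.1) (hQ : Q.R < p.1) :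
    metricMatrix G.toRiemannianSurface G.e =ᶠ[𝓝 p] metricMatrix Q.toRiemannianSurface Q.e ∨
    metricMatrix G.toRiemannianSurface G.e =ᶠ[𝓝 p] metricMatrix P.toRiemannianSurface P.e := by
  rcases neg_lt_or_lt P.δ_pos (discPolar p).1 with h | h
  · left
    filter_upwards [(isOpen_lt continuous_const continuous_fst).mem_nhds hP,
      (isOpen_lt continuous_const continuous_fst).mem_nhds hQ,
      (isOpen_lt continuous_const (continuous_fst.comp continuous_discPolar)).mem_nhds h]
      with q h1 h2 h3
    ext i j
    exact G.pullbackMetric_eq_Q h1 h2 h3 _ _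
  · right
    filter_upwards [(isOpen_lt continuous_const continuous_fst).mem_nhds hP,
      (isOpen_lt continuous_const continuous_fst).mem_nhds hQ,
      (isOpen_lt (continuous_fst.comp continuous_discPolar) continuous_const).mem_nhds h]
      with q h1 h2 h3
    ext i j
    exact G.pullbackMetric_eq_P h1 h2 h3 _ _

theorem metricError_eq (i j : Fin 2) {r φ : ℝ} (hP : P.R < r) (hQ : Q.R < r) :
    metricError G.toRiemannianSurface G.e i j (r, φ) =
      if 0 ≤ Real.cos φ then metricError Q.toRiemannianSurface Q.e i j (r, φ)
      else metricError P.toRiemannianSurface P.e i j (r, φ) := by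
  have hδ := P.δ_pos
  have hr : 0 < r := P.isEnd.R_pos.trans hP
  split_ifs with h
  · have := discPolar_fst_nonneg (p := (r, φ)) hr h
    exact metricError_congr (G.pullbackMetric_eq_Q (p := (r, φ)) hP hQ (by linarith)) i j
  · have := discPolar_fst_neg (p := (r, φ)) hr (not_le.1 h)
    exact metricError_congr (G.pullbackMetric_eq_P (p := (r, φ)) hP hQ (by linarith)) i j

theorem deriv_metricError_eq (i j : Fin 2) {r φ : ℝ} (hP : P.R < r) (hQ : Q.R < r) :
    deriv (fun t => metricError G.toRiemannianSurface G.e i j (t, φ)) r =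
      if 0 ≤ Real.cos φ then deriv (fun t => metricError Q.toRiemannianSurface Q.e i j (t, φ)) r
      else deriv (fun t => metricError P.toRiemannianSurface P.e i j (t, φ)) r := by
  have key : (fun t => metricError G.toRiemannianSurface G.e i j (t, φ)) =ᶠ[𝓝 r] fun t =>
      if 0 ≤ Real.cos φ then metricError Q.toRiemannianSurface Q.e i j (t, φ)
      else metricError P.toRiemannianSurface P.e i j (t, φ) := by
    filter_upwards [Ioi_mem_nhds hP, Ioi_mem_nhds hQ] with t h1 h2
    exact G.metricError_eq i j h1 h2
  rw [key.deriv_eq]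
  split_ifs <;> rfl

end MaskitGluing

theorem TendstoUniformly.ite {F F' H : ℝ → ℝ → ℝ} {f f' : ℝ → ℝ} {c : ℝ → Prop}
    [DecidablePred c] (h : TendstoUniformly F f atTop) (h' : TendstoUniformly F' f' atTop)
    (e : ∀ᶠ r in atTop, ∀ φ, H r φ = if c φ then F r φ else F' r φ) :
    TendstoUniformly H (fun φ => if c φ then f φ else f' φ) atTop := by
  rw [Metric.tendstoUniformly_iff] at h h' ⊢
  intro ε hε
  filter_upwards [h ε hε, h' ε hε, e] with r h1 h2 h3 φ
  rw [h3]
  split_ifs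
  · exact h1 φ
  · exact h2 φ

/-- Gluing along the arcs where both circle functions agree in a neighbourhood. -/
theorem IsCircleFunction.ite_cos {f g : ℝ → ℝ} (hf : IsCircleFunction f) (hg : IsCircleFunction g)
    {δ : ℝ} (hδ : 0 < δ) (h : ∀ φ, -δ < Real.cos φ → Real.cos φ < δ → f φ = g φ) :
    IsCircleFunction fun φ => if 0 ≤ Real.cos φ then f φ else g φ := by
  refine ⟨contDiff_iff_contDiffAt.2 fun φ => ?_, fun φ => ?_⟩
  · rcases le_or_gt 0 (Real.cos φ) with hc | hc
    · refine hf.smooth.contDiffAt.congr_of_eventuallyEq ?_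
      filter_upwards [(isOpen_lt continuous_const Real.continuous_cos).mem_nhds
        (show -δ < Real.cos φ by linarith)] with x hx
      split_ifs with h0
      · rfl
      · exact (h x hx (by linarith [not_le.1 h0])).symm
    · refine hg.smooth.contDiffAt.congr_of_eventuallyEq ?_
      filter_upwards [(isOpen_lt Real.continuous_cos continuous_const).mem_nhds hc] with x hx
      rw [if_neg (not_le.2 hx)]
  · rw [Real.cos_add_two_pi, hf.periodic, hg.periodic]

namespace MaskitGluing

variable {δ : ℝ} {P : MaskitPiece.{u} 1 δ} {Q : MaskitPiece.{v} (-1) δ}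
  (G : MaskitGluing.{u, v, w} P Q)

/-- The glued surface has an end with the glued coordinates and mass-aspect function. -/
theorem isALHEnd : IsALHEnd G.toRiemannianSurface (max P.R Q.R) G.e G.μ := by
  have hδ := P.δ_pos
  have hPR : ∀ {r : ℝ}, max P.R Q.R < r → P.R < r := fun h => (le_max_left _ _).trans_lt h
  have hQR : ∀ {r : ℝ}, max P.R Q.R < r → Q.R < r := fun h => (le_max_right _ _).trans_lt h
  refine ⟨lt_max_of_lt_left P.isEnd.R_pos,
    fun p hp => (G.contMDiffAt_e (hPR hp) (hQR hp)).contMDiffWithinAt, fun r φ => ?_,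
    fun p q hp hq h => G.injective_e (hPR hp) (hQR hp) (hPR hq) (hQR hq) h, fun p hp => ?_,
    fun R' h => G.isClosed_e_image (hPR h) (hQR h), fun p hp => ?_, ?_⟩
  · simp only [e, Real.cos_add_two_pi, Q.isEnd.periodic, P.isEnd.periodic]
  · refine injective_of_pullbackMetric_pos fun v hv => ?_
    rcases neg_lt_or_lt P.δ_pos (discPolar p).1 with h | h
    · rw [G.pullbackMetric_eq_Q (hPR hp) (hQR hp) h]
      exact pullbackMetric_pos (Q.isEnd.immersion p (hQR hp)) hv
    · rw [G.pullbackMetric_eq_P (hPR hp) (hQR hp) h]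
      exact pullbackMetric_pos (P.isEnd.immersion p (hPR hp)) hv
  · rcases G.metricMatrix_eventuallyEq (hPR hp) (hQR hp) with h | h
    · rw [scalarCurvature_congr h, Q.isEnd.curvature p (hQR hp)]
    · rw [scalarCurvature_congr h, P.isEnd.curvature p (hPR hp)]
  · obtain ⟨τP, p1, p2, p3, p4⟩ := P.isEnd.massAspect
    obtain ⟨τQ, q1, q2, q3, q4⟩ := Q.isEnd.massAspect
    refine ⟨fun i j φ => if 0 ≤ Real.cos φ then τQ i j φ else τP i j φ, fun i j => ?_,
      fun i j => ?_, fun i j => ?_, fun φ => ?_⟩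
    · refine (q1 i j).ite_cos (p1 i j) hδ fun φ h1 h2 => ?_
      rw [Q.massAspect_coeff q2 (by linarith), P.massAspect_coeff p2 (by linarith)]
    · refine (q2 i j).ite (p2 i j) ?_
      filter_upwards [eventually_gt_atTop (max P.R Q.R)] with r hr φ
      rw [G.metricError_eq i j (hPR hr) (hQR hr)]
      split_ifs <;> rfl
    · have := (q3 i j).ite (p3 i j) (c := fun φ => 0 ≤ Real.cos φ)
        (H := fun r φ => r ^ 3 * deriv (fun t => metricError G.toRiemannianSurface G.e i j (t, φ)) r)
        (by
          filter_upwards [eventually_gt_atTop (max P.R Q.R)] with r hr φ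
          rw [G.deriv_metricError_eq i j (hPR hr) (hQR hr)]
          split_ifs <;> rfl)
      convert this using 2 with φ
      simp only [mul_ite]
    · simp only [μ, p4, q4]
      split_ifs <;> rfl

theorem isGluedPotential : IsGluedPotential δ P.μ Q.μ G.μ where
  pos := P.δ_pos
  circle := G.isALHEnd.isCircleFunction
  first _ h := P.μ_eq_neg_one (by linarith)
  second _ h := Q.μ_eq_neg_one (by linarith)
  eq_ite _ := rfl

end MaskitGluing

/-! ### Existence of circle diffeomorphisms in normal form -/

/-- The pulled-back exponential basis is a Hill basis of the transformed potential and of its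
translate by a period, and a Hill basis determines its potential. -/
theorem massTransform_const_periodic {m : ℝ} (hm : 0 < m) {f : ℝ → ℝ} (hf : IsCircleDiffeo f)
    (x : ℝ) : massTransform (fun _ => m) f (x + 2 * Real.pi) = massTransform (fun _ => m) f x := by
  have h := (expBasis_isHillBasis hm).hillPull hf
  have hA := (expBasis_isMonodromy m).hillPull hf
  have h2 := h.mulVec (h.monodromy_det hA)
  have h1 := h.comp_add_const (2 * Real.pi)
  have e : (fun x => hillPull f (expBasis m) (x + 2 * Real.pi)) =
      fun x => expMonodromy m *ᵥ hillPull f (expBasis m) x :=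
    funext fun x => by rw [add_comm, hA]
  rw [e] at h1
  exact congrFun (h1.eq_potential h2) x

theorem massTransform_const_isCircleFunction {m : ℝ} (hm : 0 < m) {f : ℝ → ℝ}
    (hf : IsCircleDiffeo f) : IsCircleFunction (massTransform (fun _ => m) f) :=
  ⟨massTransform_contDiff contDiff_const hf, massTransform_const_periodic hm hf⟩

theorem IsCircleDiffeo.comp_add_const {f : ℝ → ℝ} (hf : IsCircleDiffeo f) (a : ℝ) :
    IsCircleDiffeo fun x => f (x + a) := by
  refine ⟨hf.smooth.comp (contDiff_id.add contDiff_const), fun x => ?_, fun x => ?_⟩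
  · rw [deriv_comp_add_const]
    exact hf.deriv_pos _
  · rw [← hf.equivariant]
    congr 1
    ring

theorem massTransform_const_comp_add_const {m : ℝ} (hm : 0 < m) {f : ℝ → ℝ}
    (hf : IsCircleDiffeo f) (a x : ℝ) :
    massTransform (fun _ => m) (fun x => f (x + a)) x = massTransform (fun _ => m) f (x + a) := by
  have h1 := (expBasis_isHillBasis hm).hillPull (hf.comp_add_const a)
  have h2 := ((expBasis_isHillBasis hm).hillPull hf).comp_add_const a
  have e : hillPull (fun x => f (x + a)) (expBasis m) = fun x => hillPull f (expBasis m) (x + a) := by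
    funext x i
    simp only [hillPull, deriv_comp_add_const]
  rw [e] at h1
  exact congrFun (h1.eq_potential h2) x

/-- The normal form `-m^(-1/2) log (c - tan (x/2))`. -/
def normalForm (m c x : ℝ) : ℝ := -(1 / √m) * Real.log (-Real.tan (x / 2) + c)

/-- The `2π`-periodic function whose product with `√m` is the reciprocal of the derivative of the
normal form. -/
def normalDenom (c x : ℝ) : ℝ := c * (1 + Real.cos x) - Real.sin x

theorem normalDenom_pos {c x : ℝ} (hc : 1 < c) (hx : (1 - c ^ 2) / (1 + c ^ 2) < Real.cos x) :
    0 < normalDenom c x := by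
  rw [div_lt_iff₀ (by positivity)] at hx
  have h1 : 0 < 1 + Real.cos x := by nlinarith [Real.neg_one_le_cos x]
  have hsc := Real.sin_sq_add_cos_sq x
  have h2 : Real.sin x ^ 2 < (c * (1 + Real.cos x)) ^ 2 := by
    have : Real.sin x ^ 2 = (1 - Real.cos x) * (1 + Real.cos x) := by linear_combination hsc
    rw [this, mul_pow, pow_two (1 + Real.cos x), ← mul_assoc]
    exact mul_lt_mul_of_pos_right (by linarith) h1
  have h3 := abs_lt_of_sq_lt_sq h2 (by positivity)
  rw [normalDenom]
  linarith [le_abs_self (Real.sin x)]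

theorem normalDenom_eq {c x : ℝ} (hcos : Real.cos (x / 2) ≠ 0) :
    normalDenom c x = 2 * Real.cos (x / 2) ^ 2 * (-Real.tan (x / 2) + c) := by
  have h1 : Real.cos x = 2 * Real.cos (x / 2) ^ 2 - 1 := by
    rw [← Real.cos_two_mul]; congr 1; ring
  have h2 : Real.sin x = 2 * Real.sin (x / 2) * Real.cos (x / 2) := by
    rw [← Real.sin_two_mul]; congr 1; ring
  rw [normalDenom, h1, h2, Real.tan_eq_sin_div_cos]
  field_simp
  ring

theorem normalForm_arg_pos {c x : ℝ} (hcos : 0 < Real.cos (x / 2)) (hD : 0 < normalDenom c x) :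
    0 < -Real.tan (x / 2) + c := by
  rw [normalDenom_eq hcos.ne'] at hD
  exact pos_of_mul_pos_right hD (by positivity)

theorem hasDerivAt_normalForm {m c x : ℝ} (hcos : 0 < Real.cos (x / 2))
    (hD : 0 < normalDenom c x) :
    HasDerivAt (normalForm m c) (1 / (√m * normalDenom c x)) x := by
  have hX := normalForm_arg_pos hcos hD
  have h1 : HasDerivAt (fun x : ℝ => x / 2) (1 / 2) x := (hasDerivAt_id' x).div_const 2
  have ht : HasDerivAt (fun x : ℝ => Real.tan (x / 2)) (1 / Real.cos (x / 2) ^ 2 * (1 / 2)) x :=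
    HasDerivAt.comp (h₂ := Real.tan) x (Real.hasDerivAt_tan hcos.ne') h1
  refine (((ht.neg.add_const c).log hX.ne').const_mul (-(1 / √m))).congr_deriv ?_
  rw [normalDenom_eq hcos.ne']
  simp only [Pi.neg_apply]
  field_simp

/-- For gluing parameter greater than one the normal form increases by less than `2π` over the
half-circle. -/
theorem normalForm_increment_lt {m κ : ℝ} (hm : 0 < m) (hκ : 1 < κ) :
    normalForm m (gluingConst m κ) (Real.pi / 2) - normalForm m (gluingConst m κ) (-(Real.pi / 2)) <
      2 * Real.pi := by
  have h1 : 0 < √m := Real.sqrt_pos.2 hm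
  have hc := one_lt_gluingConst hm hκ
  have hy : 0 < √m * Real.pi := mul_pos h1 Real.pi_pos
  have hs : 0 < Real.sinh (√m * Real.pi) := Real.sinh_pos_iff.2 hy
  have t1 : Real.tan (Real.pi / 2 / 2) = 1 := by
    rw [div_div, show (2 : ℝ) * 2 = 4 by norm_num, Real.tan_pi_div_four]
  have t2 : Real.tan (-(Real.pi / 2) / 2) = -1 := by
    rw [neg_div, Real.tan_neg, t1]
  rw [normalForm, normalForm, t1, t2, neg_neg]
  -- the difference of both sides is a positive multiple of `κ - 1`
  have key : 1 + gluingConst m κ <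
      (-1 + gluingConst m κ) * Real.exp (2 * (√m * Real.pi)) := by
    have e1 : gluingConst m κ * Real.sinh (√m * Real.pi) = κ * Real.cosh (√m * Real.pi) := by
      rw [gluingConst]; field_simp
    have e2 : (-1 + gluingConst m κ) * Real.exp (2 * (√m * Real.pi)) - (1 + gluingConst m κ) =
        2 * Real.exp (√m * Real.pi) * ((κ - 1) * Real.cosh (√m * Real.pi)) := by
      have e3 : Real.exp (√m * Real.pi) * Real.exp (-(√m * Real.pi)) = 1 := by
        rw [← Real.exp_add, add_neg_cancel, Real.exp_zero]
      have e4 : (κ - 1) * Real.cosh (√m * Real.pi) =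
        gluingConst m κ * Real.sinh (√m * Real.pi) - Real.cosh (√m * Real.pi) := by
        rw [e1]; ring
      rw [e4, Real.sinh_eq, Real.cosh_eq, two_mul (√m * Real.pi), Real.exp_add]
      linear_combination (gluingConst m κ + 1) * e3
    have h5 : 0 < 2 * Real.exp (√m * Real.pi) * ((κ - 1) * Real.cosh (√m * Real.pi)) :=
      mul_pos (by positivity) (mul_pos (by linarith) (Real.cosh_pos _))
    linarith
  have hlog := Real.log_lt_log (by linarith) key
  rw [Real.log_mul (by linarith) (Real.exp_pos _).ne', Real.log_exp] at hlog
  have : -(1 / √m) * Real.log (-1 + gluingConst m κ) - -(1 / √m) * Real.log (1 + gluingConst m κ) =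
      (Real.log (1 + gluingConst m κ) - Real.log (-1 + gluingConst m κ)) / √m := by ring
  rw [this, div_lt_iff₀ h1]
  linarith

theorem cos_half_pos {x : ℝ} (h : |x| < Real.pi) : 0 < Real.cos (x / 2) := by
  obtain ⟨h1, h2⟩ := abs_lt.1 h
  exact Real.cos_pos_of_mem_Ioo ⟨by linarith, by linarith⟩

/-- The normal form extends slightly beyond the half-circle, to the arc `cos x ≥ -η`, with
increment less than `2π`. -/
theorem exists_arc {m κ : ℝ} (hm : 0 < m) (hκ : 1 < κ) :
    ∃ η : ℝ, 0 < η ∧ η < 1 ∧ (∀ x, -η ≤ Real.cos x → 0 < normalDenom (gluingConst m κ) x) ∧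
      normalForm m (gluingConst m κ) (Real.arccos (-η)) -
        normalForm m (gluingConst m κ) (-Real.arccos (-η)) < 2 * Real.pi := by
  have hpi := Real.pi_pos
  have hc := one_lt_gluingConst hm hκ
  set c := gluingConst m κ with hcdef
  have hc2 : 0 < (c ^ 2 - 1) / (1 + c ^ 2) := div_pos (by nlinarith) (by positivity)
  have hD : ∀ x, Real.cos x = 0 → 0 < normalDenom c x := fun x hx =>
    normalDenom_pos hc (by rw [hx]; exact div_neg_of_neg_of_pos (by nlinarith) (by positivity))
  have hcont : ∀ x, |x| < Real.pi → Real.cos x = 0 → ContinuousAt (normalForm m c) x :=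
    fun x hx h0 => (hasDerivAt_normalForm (cos_half_pos hx) (hD x h0)).continuousAt
  have ha : Tendsto (fun η : ℝ => Real.arccos (-η)) (𝓝 0) (𝓝 (Real.pi / 2)) := by
    have : ContinuousAt (fun η : ℝ => Real.arccos (-η)) 0 :=
      (Real.continuous_arccos.comp continuous_neg).continuousAt
    rw [ContinuousAt, neg_zero, Real.arccos_zero] at this
    exact this
  have hpi2 : |Real.pi / 2| < Real.pi := by rw [abs_of_pos (by positivity)]; linarith
  have hF : Tendsto (fun η : ℝ => normalForm m c (Real.arccos (-η)) -
      normalForm m c (-Real.arccos (-η))) (𝓝 0)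
      (𝓝 (normalForm m c (Real.pi / 2) - normalForm m c (-(Real.pi / 2)))) := by
    refine ((hcont _ hpi2 Real.cos_pi_div_two).tendsto.comp ha).sub
      ((hcont _ (by rwa [abs_neg]) (by rw [Real.cos_neg, Real.cos_pi_div_two])).tendsto.comp ha.neg)
  have h1 := hF.eventually_lt_const (normalForm_increment_lt hm hκ)
  have h2 : ∀ᶠ η : ℝ in 𝓝 0, η < (c ^ 2 - 1) / (1 + c ^ 2) := Iio_mem_nhds hc2
  have h3 : ∀ᶠ η : ℝ in 𝓝 0, η < 1 := Iio_mem_nhds one_pos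
  have h4 : ∀ᶠ η : ℝ in 𝓝[>] 0, 0 < η := self_mem_nhdsWithin
  obtain ⟨η, ⟨⟨⟨e1, e2⟩, e3⟩, e4⟩⟩ :=
    ((((h1.and h2).and h3).filter_mono nhdsWithin_le_nhds).and h4).exists
  refine ⟨η, e4, e3, fun x hx => normalDenom_pos hc ?_, e1⟩
  have : (1 - c ^ 2) / (1 + c ^ 2) = -((c ^ 2 - 1) / (1 + c ^ 2)) := by ring
  rw [this]
  linarith

/-- The smooth cutoff in `cos x` which is one for `cos x ≥ -η / 2` and zero for `cos x ≤ -η`. -/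
def arcCutoff (η x : ℝ) : ℝ := Real.smoothTransition ((Real.cos x + η) / (η / 2))

theorem arcCutoff_contDiff (η : ℝ) : ContDiff ℝ ∞ (arcCutoff η) :=
  Real.smoothTransition.contDiff.comp ((Real.contDiff_cos.add contDiff_const).div_const _)

theorem arcCutoff_eq_one {η x : ℝ} (hη : 0 < η) (hx : -(η / 2) ≤ Real.cos x) :
    arcCutoff η x = 1 :=
  Real.smoothTransition.one_of_one_le (by rw [le_div_iff₀ (by positivity)]; linarith)

theorem arcCutoff_eq_zero {η x : ℝ} (hη : 0 < η) (hx : Real.cos x ≤ -η) : arcCutoff η x = 0 :=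
  Real.smoothTransition.zero_of_nonpos (div_nonpos_of_nonpos_of_nonneg (by linarith) (by linarith))

theorem arcCutoff_le_one (η x : ℝ) : arcCutoff η x ≤ 1 := Real.smoothTransition.le_one _

theorem arcCutoff_pos {η x : ℝ} (hη : 0 < η) (hx : -η < Real.cos x) : 0 < arcCutoff η x :=
  Real.smoothTransition.pos_of_pos (div_pos (by linarith) (by linarith))

/-- A positive smooth `2π`-periodic function of integral `2π`, equal to the derivative of the
normal form for `cos x ≥ -η / 2`. -/
theorem exists_periodic_derivative {m κ : ℝ} (hm : 0 < m) (hκ : 1 < κ) :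
    ∃ η : ℝ, 0 < η ∧ η < 1 ∧ (∀ x, -η ≤ Real.cos x → 0 < normalDenom (gluingConst m κ) x) ∧
      ∃ p : ℝ → ℝ, ContDiff ℝ ∞ p ∧ (∀ x, 0 < p x) ∧ Function.Periodic p (2 * Real.pi) ∧
        (∫ x in (-Real.pi)..Real.pi, p x) = 2 * Real.pi ∧
        ∀ x, -(η / 2) ≤ Real.cos x → p x = 1 / (√m * normalDenom (gluingConst m κ) x) := by
  obtain ⟨η, h0, h1, hD, hinc⟩ := exists_arc hm hκ
  refine ⟨η, h0, h1, hD, ?_⟩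
  have hpi := Real.pi_pos
  have hsm : 0 < √m := Real.sqrt_pos.2 hm
  set c := gluingConst m κ with hcdef
  set χ := arcCutoff η with hχ
  have hχc : ContDiff ℝ ∞ χ := arcCutoff_contDiff η
  have hDc : ContDiff ℝ ∞ (normalDenom c) :=
    (contDiff_const.mul (contDiff_const.add Real.contDiff_cos)).sub Real.contDiff_sin
  set p₁ : ℝ → ℝ := fun x => χ x / (√m * normalDenom c x) with hp₁
  have hp₁0 : ∀ x, Real.cos x ≤ -η → p₁ x = 0 := fun x hx => by
    simp only [hp₁, hχ, arcCutoff_eq_zero h0 hx, zero_div]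
  have hp₁c : ContDiff ℝ ∞ p₁ := by
    refine contDiff_iff_contDiffAt.2 fun x => ?_
    rcases lt_or_ge (Real.cos x) (-η) with hx | hx
    · refine (contDiffAt_const (c := (0 : ℝ))).congr_of_eventuallyEq ?_
      filter_upwards [(isOpen_lt Real.continuous_cos continuous_const).mem_nhds hx] with y hy
      exact hp₁0 y hy.le
    · exact hχc.contDiffAt.div (contDiffAt_const.mul hDc.contDiffAt)
        (mul_pos hsm (hD x hx)).ne'
  set b := Real.arccos (-η) with hb
  have hcosb : Real.cos b = -η := Real.cos_arccos (by linarith) (by linarith)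
  have hb0 : 0 ≤ b := Real.arccos_nonneg _
  have hbpi : b < Real.pi := by
    refine lt_of_le_of_ne (Real.arccos_le_pi _) fun h => ?_
    rw [h, Real.cos_pi] at hcosb
    linarith
  have hint : ∀ u v, IntervalIntegrable p₁ MeasureTheory.volume u v := fun u v =>
    hp₁c.continuous.intervalIntegrable u v
  have hout : ∀ x, b ≤ |x| → |x| ≤ Real.pi → p₁ x = 0 := fun x h2 h3 => by
    refine hp₁0 x ?_
    rw [← hcosb, ← Real.cos_abs x]
    exact Real.cos_le_cos_of_nonneg_of_le_pi hb0 h3 h2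
  have hin : ∀ x ∈ Set.Icc (-b) b, -η ≤ Real.cos x := fun x hx => by
    rw [← hcosb, ← Real.cos_abs x]
    exact Real.cos_le_cos_of_nonneg_of_le_pi (abs_nonneg x) hbpi.le (abs_le.2 hx)
  -- the part prescribed by the normal form leaves room for a positive complement
  have hI : (∫ x in (-Real.pi)..Real.pi, p₁ x) < 2 * Real.pi := by
    have i1 : (∫ x in (-Real.pi)..(-b), p₁ x) = 0 := by
      rw [intervalIntegral.integral_congr (g := fun _ => (0 : ℝ)), intervalIntegral.integral_zero]
      intro x hx
      rw [Set.uIcc_of_le (by linarith)] at hx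
      exact hout x (by rw [abs_of_nonpos (by linarith [hx.2])]; linarith [hx.2])
        (by rw [abs_of_nonpos (by linarith [hx.2])]; linarith [hx.1])
    have i2 : (∫ x in b..Real.pi, p₁ x) = 0 := by
      rw [intervalIntegral.integral_congr (g := fun _ => (0 : ℝ)), intervalIntegral.integral_zero]
      intro x hx
      rw [Set.uIcc_of_le hbpi.le] at hx
      exact hout x (by rw [abs_of_nonneg (by linarith [hx.1])]; linarith [hx.1])
        (by rw [abs_of_nonneg (by linarith [hx.1])]; linarith [hx.2])
    have hco : ContinuousOn (fun x => 1 / (√m * normalDenom c x)) (Set.Icc (-b) b) :=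
      continuousOn_const.div (continuousOn_const.mul hDc.continuous.continuousOn)
        fun x hx => (mul_pos hsm (hD x (hin x hx))).ne'
    have hii : IntervalIntegrable (fun x => 1 / (√m * normalDenom c x)) MeasureTheory.volume (-b) b :=
      ContinuousOn.intervalIntegrable (by rwa [Set.uIcc_of_le (by linarith)])
    have i3 : (∫ x in (-b)..b, p₁ x) ≤ ∫ x in (-b)..b, 1 / (√m * normalDenom c x) :=
      intervalIntegral.integral_mono_on (by linarith) (hint _ _) hii fun x hx =>
        div_le_div_of_nonneg_right (arcCutoff_le_one η x) (mul_pos hsm (hD x (hin x hx))).le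
    have i4 : (∫ x in (-b)..b, 1 / (√m * normalDenom c x)) =
        normalForm m c b - normalForm m c (-b) := by
      refine intervalIntegral.integral_eq_sub_of_hasDerivAt (fun x hx => ?_) hii
      rw [Set.uIcc_of_le (by linarith)] at hx
      exact hasDerivAt_normalForm (cos_half_pos ((abs_le.2 hx).trans_lt hbpi)) (hD x (hin x hx))
    rw [← intervalIntegral.integral_add_adjacent_intervals (hint (-Real.pi) (-b)) (hint (-b) Real.pi),
      ← intervalIntegral.integral_add_adjacent_intervals (hint (-b) b) (hint b Real.pi), i1, i2]
    linarith
  have hJ : 0 < ∫ x in (-Real.pi)..Real.pi, (1 - χ x) := by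
    refine intervalIntegral.integral_pos (by linarith)
      (continuous_const.sub hχc.continuous).continuousOn
      (fun x _ => sub_nonneg.2 (arcCutoff_le_one η x)) ⟨Real.pi, ⟨by linarith, le_rfl⟩, ?_⟩
    rw [hχ, arcCutoff_eq_zero h0 (by rw [Real.cos_pi]; linarith)]
    norm_num
  -- the constant which makes the integral over a period equal to `2π`
  set C := (2 * Real.pi - ∫ x in (-Real.pi)..Real.pi, p₁ x) /
    ∫ x in (-Real.pi)..Real.pi, (1 - χ x) with hC
  have hC0 : 0 < C := div_pos (by linarith) hJ
  have hC1 : C * (∫ x in (-Real.pi)..Real.pi, (1 - χ x)) =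
      2 * Real.pi - ∫ x in (-Real.pi)..Real.pi, p₁ x := div_mul_cancel₀ _ hJ.ne'
  refine ⟨fun x => p₁ x + C * (1 - χ x), hp₁c.add (contDiff_const.mul (contDiff_const.sub hχc)),
    fun x => ?_, fun x => ?_, ?_, fun x hx => ?_⟩
  · rcases le_or_gt (Real.cos x) (-η) with hx | hx
    · simp only [hp₁0 x hx, hχ, arcCutoff_eq_zero h0 hx]
      linarith
    · have h2 : 0 < p₁ x := div_pos (arcCutoff_pos h0 hx) (mul_pos hsm (hD x hx.le))
      have h3 : 0 ≤ C * (1 - χ x) := mul_nonneg hC0.le (sub_nonneg.2 (arcCutoff_le_one η x))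
      linarith
  · simp only [hp₁, hχ, arcCutoff, normalDenom, Real.cos_add_two_pi, Real.sin_add_two_pi]
  · have hi : IntervalIntegrable (fun x => C * (1 - χ x)) MeasureTheory.volume (-Real.pi) Real.pi :=
      (continuous_const.mul (continuous_const.sub hχc.continuous)).intervalIntegrable _ _
    refine (intervalIntegral.integral_add (hint _ _) hi).trans ?_
    rw [intervalIntegral.integral_const_mul, hC1]
    ring
  · simp only [hp₁, hχ, arcCutoff_eq_one h0 hx]
    ring

/-- Existence of the diffeomorphism of the first piece. Its potential takes the value `-1` of the
hyperbolic plane on a neighbourhood of the half-circle. -/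
theorem exists_isFirstGauge {m κ : ℝ} (hm : 0 < m) (hκ : 1 < κ) :
    ∃ (f : ℝ → ℝ) (δ : ℝ), 0 < δ ∧ δ < 1 ∧ IsFirstGauge m κ f (massTransform (fun _ => m) f) ∧
      ∀ x, -δ < Real.cos x → massTransform (fun _ => m) f x = -1 := by
  obtain ⟨η, h0, h1, hD, p, pc, pp, pper, pint, pe⟩ := exists_periodic_derivative hm hκ
  have hpi := Real.pi_pos
  set c := gluingConst m κ with hc
  have hii : ∀ a b, IntervalIntegrable p MeasureTheory.volume a b := fun a b =>
    pc.continuous.intervalIntegrable a b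
  set f : ℝ → ℝ := fun x => normalForm m c 0 + ∫ t in (0 : ℝ)..x, p t with hf
  have fd : ∀ x, HasDerivAt f (p x) x := fun x =>
    (intervalIntegral.integral_hasDerivAt_right (hii 0 x)
      (pc.continuous.stronglyMeasurableAtFilter _ _) pc.continuous.continuousAt).const_add _
  have fd' : deriv f = p := funext fun x => (fd x).deriv
  have hfd : IsCircleDiffeo f := by
    refine ⟨contDiff_infty_iff_deriv.2 ⟨fun x => (fd x).differentiableAt, by rwa [fd']⟩,
      fun x => by rw [fd']; exact pp x, fun x => ?_⟩
    have e1 := intervalIntegral.integral_add_adjacent_intervals (hii 0 x) (hii x (x + 2 * Real.pi))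
    have e2 := pper.intervalIntegral_add_eq x (-Real.pi)
    rw [show -Real.pi + 2 * Real.pi = Real.pi by ring, pint] at e2
    simp only [hf]
    rw [← e1, e2]
    ring
  -- on the extended arc `f` is the normal form
  have hnf : ∀ x, |x| < Real.pi → -(η / 2) ≤ Real.cos x → f x = normalForm m c x := by
    intro x hx hcx
    have hseg : ∀ t ∈ Set.uIcc 0 x, |t| ≤ |x| := fun t ht => by
      have := Set.abs_sub_left_of_mem_uIcc ht
      simpa using this
    have hcos : ∀ t ∈ Set.uIcc 0 x, -(η / 2) ≤ Real.cos t := fun t ht => by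
      refine hcx.trans ?_
      rw [← Real.cos_abs x, ← Real.cos_abs t]
      exact Real.cos_le_cos_of_nonneg_of_le_pi (abs_nonneg t) hx.le (hseg t ht)
    have e1 : (∫ t in (0 : ℝ)..x, p t) = normalForm m c x - normalForm m c 0 := by
      refine intervalIntegral.integral_eq_sub_of_hasDerivAt (fun t ht => ?_) (hii 0 x)
      rw [pe t (hcos t ht)]
      exact hasDerivAt_normalForm (cos_half_pos ((hseg t ht).trans_lt hx))
        (hD t (by linarith [hcos t ht]))
    simp only [hf]
    rw [e1]
    ring
  refine ⟨f, η / 2, by positivity, by linarith, ⟨hfd, fun _ => rfl, fun x hx => ?_⟩,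
    fun x hx => ?_⟩
  · have hax : |x| ≤ Real.pi / 2 := abs_le.2 hx
    exact hnf x (by linarith) (by linarith [Real.cos_nonneg_of_mem_Icc hx])
  · -- by periodicity it suffices to consider `x` in `(-π, π]`
    set k : ℤ := toIocDiv Real.two_pi_pos (-Real.pi) x with hk
    have hmem : x - k * (2 * Real.pi) ∈ Set.Ioc (-Real.pi) (-Real.pi + 2 * Real.pi) := by
      have := sub_toIocDiv_zsmul_mem_Ioc Real.two_pi_pos (-Real.pi) x
      rwa [zsmul_eq_mul] at this
    have hper : Function.Periodic (massTransform (fun _ => m) f) (2 * Real.pi) :=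
      massTransform_const_periodic hm hfd
    rw [← hper.sub_int_mul_eq k]
    rw [← Real.cos_sub_int_mul_two_pi x k] at hx
    set y := x - k * (2 * Real.pi) with hy
    have hylt : |y| < Real.pi := by
      refine lt_of_le_of_ne (abs_le.2 ⟨hmem.1.le, by linarith [hmem.2]⟩) fun h => ?_
      rw [← Real.cos_abs, h, Real.cos_pi] at hx
      linarith
    have hev : f =ᶠ[𝓝 y] normalForm m c := by
      filter_upwards [(isOpen_lt continuous_abs continuous_const).mem_nhds hylt,
        (isOpen_lt continuous_const Real.continuous_cos).mem_nhds hx] with z hz hz'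
      exact hnf z hz hz'.le
    have hDpos : ∀ {z}, -(η / 2) < Real.cos z → 0 < normalDenom c z := fun hz => hD _ (by linarith)
    have hB := (halfAngleBasis_isHillBasis).mulVec (B := firstMatrix c) (by
      simp [firstMatrix, Matrix.det_fin_two])
    refine IsHillBasis.eq_potential_at ((expBasis_isHillBasis hm).hillPull hfd) hB ?_
    filter_upwards [hev.eventuallyEq_nhds, (isOpen_lt continuous_abs continuous_const).mem_nhds hylt,
        (isOpen_lt continuous_const Real.continuous_cos).mem_nhds hx] with z hz h2 h3
    exact hillPull_expBasis_of_eventuallyEq hm (cos_half_pos h2)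
      (normalForm_arg_pos (cos_half_pos h2) (hDpos h3)) hz

/-- Rotation of the circle by `π` exchanges both normal forms. -/
theorem IsFirstGauge.isSecondGauge {m κ : ℝ} (hm : 0 < m) {f μ : ℝ → ℝ}
    (h : IsFirstGauge m κ f μ) :
    IsSecondGauge m κ (fun x => f (x + -Real.pi)) (fun x => μ (x + -Real.pi)) := by
  refine ⟨h.diffeo.comp_add_const _, fun x => ?_, fun x hx => ?_⟩
  · rw [massTransform_const_comp_add_const hm h.diffeo, h.transform]
  · rw [h.normalForm _ ⟨by linarith [hx.1], by linarith [hx.2]⟩]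
    have : -Real.tan ((x + -Real.pi) / 2) = Real.cot (x / 2) := by
      rw [← Real.tan_neg, show -((x + -Real.pi) / 2) = Real.pi / 2 - x / 2 by ring,
        Real.tan_pi_div_two_sub, Real.tan_inv_eq_cot]
    rw [this]

/-! ### Metrics on the plane -/

open Bundle ContinuousLinearMap in
/-- A smooth field of bilinear forms on a vector space is a smooth section of the bundle of bilinear
forms on the tangent spaces. -/
theorem contMDiff_bilinearField {F : Type*} [NormedAddCommGroup F] [NormedSpace ℝ F]
    (B : ∀ x : F, TangentSpace 𝓘(ℝ, F) x →L[ℝ] TangentSpace 𝓘(ℝ, F) x →L[ℝ] ℝ)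
    (C : F → F →L[ℝ] F →L[ℝ] ℝ) (h : ∀ x v w, B x v w = C x v w) (hC : ContDiff ℝ ∞ C) :
    ContMDiff 𝓘(ℝ, F) (𝓘(ℝ, F).prod 𝓘(ℝ, F →L[ℝ] F →L[ℝ] ℝ)) ∞
      (fun b ↦ TotalSpace.mk' (F →L[ℝ] F →L[ℝ] ℝ)
        (E := fun x : F => TangentSpace 𝓘(ℝ, F) x →L[ℝ] TangentSpace 𝓘(ℝ, F) x →L[ℝ] ℝ) b (B b)) := by
  intro x
  rw [contMDiffAt_section]
  have := (hC.contDiffAt (x := x)).contMDiffAt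
  refine this.congr_of_eventuallyEq (Filter.Eventually.of_forall fun y => ?_)
  ext v w
  refine Eq.trans ?_ (h y v w)
  change inCoordinates F (fun x : F => TangentSpace 𝓘(ℝ, F) x) (F →L[ℝ] ℝ)
    (fun x : F => TangentSpace 𝓘(ℝ, F) x →L[ℝ] ℝ) x y x y (B y) v w = _
  have hy : y ∈ (trivializationAt F (TangentSpace 𝓘(ℝ, F)) x).baseSet := by
    rw [TangentBundle.trivializationAt_baseSet]
    exact Set.mem_univ _
  have hs : ∀ u : F, (trivializationAt F (TangentSpace 𝓘(ℝ, F)) x).symm y u = u := fun u => by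
    have := DFunLike.congr_fun (TangentBundle.symmL_model_space (𝕜 := ℝ) x y) u
    rwa [Trivialization.symmL_apply _ hy] at this
  rw [inCoordinates_apply_eq₂ hy hy (Set.mem_univ _)]
  simp only [Bundle.Trivial.fiberBundle_trivializationAt', Bundle.Trivial.linearMapAt_trivialization,
    LinearMap.id_coe, id_eq]
  rw [hs, hs]

/-- The Euclidean plane. -/
abbrev Plane := EuclideanSpace ℝ (Fin 2)

/-- The squared distance from the origin. -/
def normSq (X : Plane) : ℝ := X 0 ^ 2 + X 1 ^ 2

theorem normSq_nonneg (X : Plane) : 0 ≤ normSq X := by unfold normSq; positivity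

theorem coord_contDiff (i : Fin 2) : ContDiff ℝ ∞ fun X : Plane => X i :=
  (EuclideanSpace.proj (𝕜 := ℝ) i).contDiff

theorem normSq_contDiff : ContDiff ℝ ∞ normSq :=
  ((coord_contDiff 0).pow 2).add ((coord_contDiff 1).pow 2)

/-- The bilinear form `dX² - (X · dX)² / (1 + |X|²) + H(X) (X₀ dX₁ - X₁ dX₀)²`. For `H = 0` this is
the hyperbolic metric in the coordinates `X = (r cos φ, r sin φ)`. -/
def planeForm (H : Plane → ℝ) (X : Plane) : Plane →L[ℝ] Plane →L[ℝ] ℝ :=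
  (EuclideanSpace.proj (𝕜 := ℝ) (0 : Fin 2)).smulRight (EuclideanSpace.proj (𝕜 := ℝ) (0 : Fin 2)) +
    (EuclideanSpace.proj (𝕜 := ℝ) (1 : Fin 2)).smulRight
      (EuclideanSpace.proj (𝕜 := ℝ) (1 : Fin 2)) -
    (1 + normSq X)⁻¹ •
      (X 0 • EuclideanSpace.proj (𝕜 := ℝ) (0 : Fin 2) +
          X 1 • EuclideanSpace.proj (𝕜 := ℝ) (1 : Fin 2)).smulRight
        (X 0 • EuclideanSpace.proj (𝕜 := ℝ) (0 : Fin 2) +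
          X 1 • EuclideanSpace.proj (𝕜 := ℝ) (1 : Fin 2)) +
    H X •
      (X 0 • EuclideanSpace.proj (𝕜 := ℝ) (1 : Fin 2) -
          X 1 • EuclideanSpace.proj (𝕜 := ℝ) (0 : Fin 2)).smulRight
        (X 0 • EuclideanSpace.proj (𝕜 := ℝ) (1 : Fin 2) -
          X 1 • EuclideanSpace.proj (𝕜 := ℝ) (0 : Fin 2))

theorem planeForm_apply (H : Plane → ℝ) (X v w : Plane) :
    planeForm H X v w = v 0 * w 0 + v 1 * w 1 -
      (X 0 * v 0 + X 1 * v 1) * (X 0 * w 0 + X 1 * w 1) / (1 + normSq X) +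
      H X * ((X 0 * v 1 - X 1 * v 0) * (X 0 * w 1 - X 1 * w 0)) := by
  simp [planeForm]
  ring

theorem planeForm_symm (H : Plane → ℝ) (X v w : Plane) : planeForm H X v w = planeForm H X w v := by
  rw [planeForm_apply, planeForm_apply]
  ring

theorem planeForm_contDiff {H : Plane → ℝ} (hH : ContDiff ℝ ∞ H) : ContDiff ℝ ∞ (planeForm H) := by
  have h0 := coord_contDiff 0
  have h1 := coord_contDiff 1
  have ha : ContDiff ℝ ∞ fun X : Plane => X 0 • EuclideanSpace.proj (𝕜 := ℝ) (0 : Fin 2) +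
      X 1 • EuclideanSpace.proj (𝕜 := ℝ) (1 : Fin 2) :=
    (h0.smul contDiff_const).add (h1.smul contDiff_const)
  have hb : ContDiff ℝ ∞ fun X : Plane => X 0 • EuclideanSpace.proj (𝕜 := ℝ) (1 : Fin 2) -
      X 1 • EuclideanSpace.proj (𝕜 := ℝ) (0 : Fin 2) :=
    (h0.smul contDiff_const).sub (h1.smul contDiff_const)
  have hN : ContDiff ℝ ∞ fun X : Plane => (1 + normSq X)⁻¹ :=
    (contDiff_const.add normSq_contDiff).inv fun X => by linarith [normSq_nonneg X]
  exact (contDiff_const.sub (hN.smul (ha.smulRight ha))).add (hH.smul (hb.smulRight hb))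

/-- The form is bounded below by a multiple of the Euclidean metric. -/
theorem le_planeForm {H : Plane → ℝ} {X : Plane} (v : Plane) :
    min (1 / (1 + normSq X)) (1 + normSq X * H X) * (v 0 ^ 2 + v 1 ^ 2) ≤ planeForm H X v v := by
  have hN := normSq_nonneg X
  set q := v 0 ^ 2 + v 1 ^ 2 with hq
  set t := (X 0 * v 1 - X 1 * v 0) ^ 2 with ht
  have hq0 : 0 ≤ q := by positivity
  have ht0 : 0 ≤ t := by positivity
  have hlag : (X 0 * v 0 + X 1 * v 1) ^ 2 = normSq X * q - t := by rw [ht, hq, normSq]; ring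
  have htq : t ≤ normSq X * q := by nlinarith [sq_nonneg (X 0 * v 0 + X 1 * v 1)]
  have e : planeForm H X v v = 1 / (1 + normSq X) * q + t * (1 / (1 + normSq X) + H X) := by
    have e1 : planeForm H X v v = q - (X 0 * v 0 + X 1 * v 1) ^ 2 / (1 + normSq X) + H X * t := by
      rw [planeForm_apply]; ring
    rw [e1, hlag]
    field_simp
    ring
  rw [e]
  rcases le_total 0 (1 / (1 + normSq X) + H X) with hc | hc
  · have := mul_le_mul_of_nonneg_right (min_le_left (1 / (1 + normSq X)) (1 + normSq X * H X)) hq0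
    linarith [mul_nonneg ht0 hc]
  · have h1 := mul_le_mul_of_nonneg_right
      (min_le_right (1 / (1 + normSq X)) (1 + normSq X * H X)) hq0
    have h2 := mul_le_mul_of_nonpos_right htq hc
    have h3 : 1 / (1 + normSq X) * q + normSq X * q * (1 / (1 + normSq X) + H X) =
        (1 + normSq X * H X) * q := by field_simp; ring
    linarith

/-- A smooth function `H` on the plane for which `planeForm H` is positive definite. -/
structure AngularProfile where
  toFun : Plane → ℝ
  smooth : ContDiff ℝ ∞ toFun
  pos : ∀ X, 0 < 1 + normSq X * toFun X

namespace AngularProfile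

variable (H : AngularProfile)

theorem bound_pos (X : Plane) : 0 < min (1 / (1 + normSq X)) (1 + normSq X * H.toFun X) :=
  lt_min (by have := normSq_nonneg X; positivity) (H.pos X)

theorem planeForm_pos (X v : Plane) (hv : v ≠ 0) : 0 < planeForm H.toFun X v v := by
  refine lt_of_lt_of_le (mul_pos (H.bound_pos X) ?_) (le_planeForm v)
  have h2 : ‖v‖ ^ 2 = v 0 ^ 2 + v 1 ^ 2 := by
    rw [EuclideanSpace.real_norm_sq_eq, Fin.sum_univ_two]
  rw [← h2]
  have := norm_pos_iff.2 hv
  positivity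

theorem isVonNBounded (X : Plane) :
    Bornology.IsVonNBounded ℝ {v : Plane | planeForm H.toFun X v v < 1} := by
  set κ := min (1 / (1 + normSq X)) (1 + normSq X * H.toFun X) with hκ
  have hκ0 : 0 < κ := H.bound_pos X
  refine (NormedSpace.isVonNBounded_ball ℝ Plane (1 + κ⁻¹)).subset fun v hv => ?_
  have h1 : κ * (v 0 ^ 2 + v 1 ^ 2) < 1 := (le_planeForm v).trans_lt hv
  have h2 : ‖v‖ ^ 2 = v 0 ^ 2 + v 1 ^ 2 := by
    rw [EuclideanSpace.real_norm_sq_eq, Fin.sum_univ_two]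
  rw [← h2] at h1
  have h3 : ‖v‖ ^ 2 < κ⁻¹ := by
    rw [← one_div, lt_div_iff₀ hκ0]; linarith
  rw [mem_ball_zero_iff]
  have : 0 < κ⁻¹ := inv_pos.2 hκ0
  nlinarith [norm_nonneg v]

/-- The plane with the metric `planeForm H`. -/
def surface : RiemannianSurface.{0} where
  carrier := Plane
  charted := chartedSpaceSelf Plane
  manifold := instIsManifoldModelSpace
  metric :=
    { inner := fun X => (planeForm H.toFun X : Plane →L[ℝ] Plane →L[ℝ] ℝ)
      symm := planeForm_symm H.toFun
      pos := H.planeForm_pos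
      isVonNBounded := H.isVonNBounded
      contMDiff := contMDiff_bilinearField _ (planeForm H.toFun) (fun _ _ _ => rfl)
        (planeForm_contDiff H.smooth) }

theorem pullbackMetric_surface (e : ℝ × ℝ → Plane) (p v w : ℝ × ℝ) :
    pullbackMetric H.surface e p v w =
      planeForm H.toFun (e p) (fderiv ℝ e p v) (fderiv ℝ e p w) := by
  rw [← mfderiv_eq_fderiv]
  rfl

end AngularProfile

theorem fderiv_coord {e : ℝ × ℝ → Plane} {p : ℝ × ℝ} (h : DifferentiableAt ℝ e p) (v : ℝ × ℝ)
    (i : Fin 2) : fderiv ℝ e p v i = fderiv ℝ (fun q => e q i) p v := by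
  have := ((EuclideanSpace.proj (𝕜 := ℝ) i).hasFDerivAt (x := e p)).comp p h.hasFDerivAt
  have e2 : HasFDerivAt (fun q => e q i) _ p := this
  rw [e2.fderiv]
  rfl

/-! ### Polar and disc coordinates on the plane -/

/-- Polar coordinates on the plane. -/
def planePolar (p : ℝ × ℝ) : Plane := !₂[p.1 * Real.cos p.2, p.1 * Real.sin p.2]

theorem planePolar_zero (p : ℝ × ℝ) : planePolar p 0 = p.1 * Real.cos p.2 := rfl

theorem planePolar_one (p : ℝ × ℝ) : planePolar p 1 = p.1 * Real.sin p.2 := rfl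

theorem normSq_planePolar (p : ℝ × ℝ) : normSq (planePolar p) = p.1 ^ 2 := by
  rw [normSq, planePolar_zero, planePolar_one]
  linear_combination p.1 ^ 2 * Real.sin_sq_add_cos_sq p.2

theorem contDiff_planePolar : ContDiff ℝ ∞ planePolar := by
  refine contDiff_euclidean.2 fun i => ?_
  fin_cases i
  · exact contDiff_fst.mul (Real.contDiff_cos.comp contDiff_snd)
  · exact contDiff_fst.mul (Real.contDiff_sin.comp contDiff_snd)

theorem fderiv_planePolar_zero (p v : ℝ × ℝ) :
    fderiv ℝ planePolar p v 0 = v.1 * Real.cos p.2 - p.1 * Real.sin p.2 * v.2 := by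
  rw [fderiv_coord (contDiff_planePolar.differentiable (by simp) p)]
  have hc : HasFDerivAt (fun q : ℝ × ℝ => Real.cos q.2) _ p :=
    (Real.hasDerivAt_cos p.2).comp_hasFDerivAt (f := Prod.snd)
      (f' := ContinuousLinearMap.snd ℝ ℝ ℝ) p hasFDerivAt_snd
  have h : HasFDerivAt (fun q : ℝ × ℝ => planePolar q 0) _ p :=
    (hasFDerivAt_fst (𝕜 := ℝ) (p := p)).mul hc
  rw [h.fderiv]
  simp
  ring

theorem fderiv_planePolar_one (p v : ℝ × ℝ) :
    fderiv ℝ planePolar p v 1 = v.1 * Real.sin p.2 + p.1 * Real.cos p.2 * v.2 := by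
  rw [fderiv_coord (contDiff_planePolar.differentiable (by simp) p)]
  have hs : HasFDerivAt (fun q : ℝ × ℝ => Real.sin q.2) _ p :=
    (Real.hasDerivAt_sin p.2).comp_hasFDerivAt (f := Prod.snd)
      (f' := ContinuousLinearMap.snd ℝ ℝ ℝ) p hasFDerivAt_snd
  have h : HasFDerivAt (fun q : ℝ × ℝ => planePolar q 1) _ p :=
    (hasFDerivAt_fst (𝕜 := ℝ) (p := p)).mul hs
  rw [h.fderiv]
  simp
  ring

/-- The metric of the plane in polar coordinates. -/
theorem AngularProfile.pullbackMetric_planePolar (H : AngularProfile) (p v w : ℝ × ℝ) :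
    pullbackMetric H.surface planePolar p v w =
      v.1 * w.1 / (1 + p.1 ^ 2) +
        p.1 ^ 2 * (1 + p.1 ^ 2 * H.toFun (planePolar p)) * (v.2 * w.2) := by
  rw [H.pullbackMetric_surface, planeForm_apply, normSq_planePolar, fderiv_planePolar_zero,
    fderiv_planePolar_one, fderiv_planePolar_zero, fderiv_planePolar_one, planePolar_zero,
    planePolar_one]
  have hsc := Real.sin_sq_add_cos_sq p.2
  set c := Real.cos p.2
  set s := Real.sin p.2
  have h0 : 0 < 1 + p.1 ^ 2 := by positivity
  have e1 : ∀ v : ℝ × ℝ, p.1 * c * (v.1 * c - p.1 * s * v.2) + p.1 * s * (v.1 * s + p.1 * c * v.2) =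
      p.1 * v.1 := fun v => by linear_combination p.1 * v.1 * hsc
  have e2 : ∀ v : ℝ × ℝ, p.1 * c * (v.1 * s + p.1 * c * v.2) - p.1 * s * (v.1 * c - p.1 * s * v.2) =
      p.1 ^ 2 * v.2 := fun v => by linear_combination p.1 ^ 2 * v.2 * hsc
  have e3 : (v.1 * c - p.1 * s * v.2) * (w.1 * c - p.1 * s * w.2) +
      (v.1 * s + p.1 * c * v.2) * (w.1 * s + p.1 * c * w.2) = v.1 * w.1 + p.1 ^ 2 * (v.2 * w.2) := by
    linear_combination (v.1 * w.1 + p.1 ^ 2 * (v.2 * w.2)) * hsc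
  rw [e1, e1, e2, e2, e3]
  field_simp
  ring

/-- The identification of the Poincaré disc with the plane, preserving polar coordinates. -/
def ofDisc (y : ℝ × ℝ) : Plane :=
  !₂[2 * y.1 / (1 - y.1 ^ 2 - y.2 ^ 2), 2 * y.2 / (1 - y.1 ^ 2 - y.2 ^ 2)]

/-- The inverse of `ofDisc`. -/
def toDisc (X : Plane) : ℝ × ℝ := (X 0 / (1 + √(1 + normSq X)), X 1 / (1 + √(1 + normSq X)))

theorem ofDisc_zero (y : ℝ × ℝ) : ofDisc y 0 = 2 * y.1 / (1 - y.1 ^ 2 - y.2 ^ 2) := rfl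

theorem ofDisc_one (y : ℝ × ℝ) : ofDisc y 1 = 2 * y.2 / (1 - y.1 ^ 2 - y.2 ^ 2) := rfl

theorem unitDisc_denom_pos {y : ℝ × ℝ} (hy : y ∈ unitDisc) : 0 < 1 - y.1 ^ 2 - y.2 ^ 2 := by
  have : y.1 ^ 2 + y.2 ^ 2 < 1 := hy
  linarith

theorem continuous_toDisc : Continuous toDisc := by
  have h0 := (coord_contDiff 0).continuous
  have h1 := (coord_contDiff 1).continuous
  have hN := normSq_contDiff.continuous
  have hd : Continuous fun X : Plane => 1 + √(1 + normSq X) := by fun_prop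
  have hne : ∀ X : Plane, 1 + √(1 + normSq X) ≠ 0 := fun X => by positivity
  exact (h0.div hd hne).prodMk (h1.div hd hne)

theorem one_add_normSq_ofDisc {y : ℝ × ℝ} (hy : y ∈ unitDisc) :
    1 + normSq (ofDisc y) = ((1 + y.1 ^ 2 + y.2 ^ 2) / (1 - y.1 ^ 2 - y.2 ^ 2)) ^ 2 := by
  have := (unitDisc_denom_pos hy).ne'
  rw [normSq, ofDisc_zero, ofDisc_one]
  field_simp
  ring

theorem toDisc_ofDisc {y : ℝ × ℝ} (hy : y ∈ unitDisc) : toDisc (ofDisc y) = y := by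
  have hu := unitDisc_denom_pos hy
  have hs : 1 + √(1 + normSq (ofDisc y)) = 2 / (1 - y.1 ^ 2 - y.2 ^ 2) := by
    rw [one_add_normSq_ofDisc hy, Real.sqrt_sq (by positivity)]
    field_simp
    ring
  ext
  · simp only [toDisc, hs, ofDisc_zero]; field_simp
  · simp only [toDisc, hs, ofDisc_one]; field_simp

theorem one_sub_toDisc (X : Plane) :
    1 - (toDisc X).1 ^ 2 - (toDisc X).2 ^ 2 = 2 / (1 + √(1 + normSq X)) := by
  have hN := normSq_nonneg X
  have hs : √(1 + normSq X) ^ 2 = 1 + normSq X := Real.sq_sqrt (by linarith)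
  have hn : X 0 ^ 2 + X 1 ^ 2 = normSq X := rfl
  simp only [toDisc]
  field_simp
  linear_combination hs - hn

theorem toDisc_mem (X : Plane) : toDisc X ∈ unitDisc := by
  have h1 : 0 < 2 / (1 + √(1 + normSq X)) := by positivity
  rw [← one_sub_toDisc] at h1
  change (toDisc X).1 ^ 2 + (toDisc X).2 ^ 2 < 1
  linarith

theorem ofDisc_toDisc (X : Plane) : ofDisc (toDisc X) = X := by
  ext i
  fin_cases i
  · change ofDisc (toDisc X) 0 = X 0
    rw [ofDisc_zero, one_sub_toDisc]; simp only [toDisc]; field_simp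
  · change ofDisc (toDisc X) 1 = X 1
    rw [ofDisc_one, one_sub_toDisc]; simp only [toDisc]; field_simp

theorem toDisc_planePolar (p : ℝ × ℝ) : toDisc (planePolar p) = discPolar p := by
  ext
  · simp only [toDisc, normSq_planePolar, planePolar_zero, discPolar]; ring
  · simp only [toDisc, normSq_planePolar, planePolar_one, discPolar]; ring

theorem ofDisc_discPolar (p : ℝ × ℝ) : ofDisc (discPolar p) = planePolar p := by
  rw [← toDisc_planePolar, ofDisc_toDisc]

theorem contDiffAt_ofDisc {y : ℝ × ℝ} (hy : y ∈ unitDisc) : ContDiffAt ℝ ∞ ofDisc y := by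
  have hu := (unitDisc_denom_pos hy).ne'
  refine contDiffAt_euclidean.2 fun i => ?_
  fin_cases i
  · exact (contDiffAt_const.mul contDiffAt_fst).div
      ((contDiffAt_const.sub (contDiffAt_fst.pow 2)).sub (contDiffAt_snd.pow 2)) hu
  · exact (contDiffAt_const.mul contDiffAt_snd).div
      ((contDiffAt_const.sub (contDiffAt_fst.pow 2)).sub (contDiffAt_snd.pow 2)) hu

theorem hasFDerivAt_discDenom (y : ℝ × ℝ) : ∃ D : ℝ × ℝ →L[ℝ] ℝ,
    HasFDerivAt (fun y : ℝ × ℝ => 1 - y.1 ^ 2 - y.2 ^ 2) D y ∧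
      ∀ v, D v = -(2 * (y.1 * v.1 + y.2 * v.2)) := by
  have h := (((hasFDerivAt_fst (𝕜 := ℝ) (p := y)).pow 2).const_sub 1).sub
    ((hasFDerivAt_snd (𝕜 := ℝ) (p := y)).pow 2)
  refine ⟨_, h, fun v => ?_⟩
  simp
  ring

theorem fderiv_ofDisc_zero {y : ℝ × ℝ} (hy : y ∈ unitDisc) (v : ℝ × ℝ) :
    fderiv ℝ ofDisc y v 0 = 2 * v.1 / (1 - y.1 ^ 2 - y.2 ^ 2) +
      4 * y.1 * (y.1 * v.1 + y.2 * v.2) / (1 - y.1 ^ 2 - y.2 ^ 2) ^ 2 := by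
  have hu := (unitDisc_denom_pos hy).ne'
  rw [fderiv_coord ((contDiffAt_ofDisc hy).differentiableAt (by simp))]
  obtain ⟨D, hD, e⟩ := hasFDerivAt_discDenom y
  have h : HasFDerivAt (fun q : ℝ × ℝ => ofDisc q 0) _ y :=
    ((hasFDerivAt_fst (𝕜 := ℝ) (p := y)).const_mul 2).mul
      ((hasDerivAt_inv hu).comp_hasFDerivAt y hD)
  rw [h.fderiv]
  simp [e]
  field_simp
  ring

theorem fderiv_ofDisc_one {y : ℝ × ℝ} (hy : y ∈ unitDisc) (v : ℝ × ℝ) :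
    fderiv ℝ ofDisc y v 1 = 2 * v.2 / (1 - y.1 ^ 2 - y.2 ^ 2) +
      4 * y.2 * (y.1 * v.1 + y.2 * v.2) / (1 - y.1 ^ 2 - y.2 ^ 2) ^ 2 := by
  have hu := (unitDisc_denom_pos hy).ne'
  rw [fderiv_coord ((contDiffAt_ofDisc hy).differentiableAt (by simp))]
  obtain ⟨D, hD, e⟩ := hasFDerivAt_discDenom y
  have h : HasFDerivAt (fun q : ℝ × ℝ => ofDisc q 1) _ y :=
    ((hasFDerivAt_snd (𝕜 := ℝ) (p := y)).const_mul 2).mul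
      ((hasDerivAt_inv hu).comp_hasFDerivAt y hD)
  rw [h.fderiv]
  simp [e]
  field_simp
  ring

/-- Where `H` vanishes, the disc is embedded isometrically. -/
theorem AngularProfile.pullbackMetric_ofDisc (H : AngularProfile) {y : ℝ × ℝ} (hy : y ∈ unitDisc)
    (h0 : H.toFun (ofDisc y) = 0) (v w : ℝ × ℝ) :
    pullbackMetric H.surface ofDisc y v w = poincareMetric y v w := by
  have hu := (unitDisc_denom_pos hy).ne'
  have hp : 0 < 1 + y.1 ^ 2 + y.2 ^ 2 := by positivity
  rw [H.pullbackMetric_surface, planeForm_apply, h0, one_add_normSq_ofDisc hy,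
    fderiv_ofDisc_zero hy, fderiv_ofDisc_one hy, fderiv_ofDisc_zero hy, fderiv_ofDisc_one hy,
    ofDisc_zero, ofDisc_one, poincareMetric, zero_mul, add_zero]
  have e : ∀ v : ℝ × ℝ, 2 * y.1 / (1 - y.1 ^ 2 - y.2 ^ 2) * (2 * v.1 / (1 - y.1 ^ 2 - y.2 ^ 2) +
      4 * y.1 * (y.1 * v.1 + y.2 * v.2) / (1 - y.1 ^ 2 - y.2 ^ 2) ^ 2) +
      2 * y.2 / (1 - y.1 ^ 2 - y.2 ^ 2) * (2 * v.2 / (1 - y.1 ^ 2 - y.2 ^ 2) +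
      4 * y.2 * (y.1 * v.1 + y.2 * v.2) / (1 - y.1 ^ 2 - y.2 ^ 2) ^ 2) =
      4 * (y.1 * v.1 + y.2 * v.2) / (1 - y.1 ^ 2 - y.2 ^ 2) ^ 2 *
        ((1 + y.1 ^ 2 + y.2 ^ 2) / (1 - y.1 ^ 2 - y.2 ^ 2)) := fun v => by
    field_simp
    ring
  rw [e, e]
  field_simp
  ring

/-! ### Curvature in polar coordinates -/

theorem partialDeriv_zero_eq {F : ℝ × ℝ → ℝ} {p : ℝ × ℝ} {d : ℝ} (hF : DifferentiableAt ℝ F p)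
    (h : HasDerivAt (fun t => F (t, p.2)) d p.1) : partialDeriv 0 F p = d := by
  have h1 := hF.hasFDerivAt.comp_hasDerivAt p.1
    ((hasDerivAt_id' p.1).prodMk (hasDerivAt_const p.1 p.2))
  exact h1.unique h

theorem partialDeriv_one_eq {F : ℝ × ℝ → ℝ} {p : ℝ × ℝ} {d : ℝ} (hF : DifferentiableAt ℝ F p)
    (h : HasDerivAt (fun t => F (p.1, t)) d p.2) : partialDeriv 1 F p = d := by
  have h1 := hF.hasFDerivAt.comp_hasDerivAt p.2
    ((hasDerivAt_const p.2 p.1).prodMk (hasDerivAt_id' p.2))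
  exact h1.unique h

theorem partialDeriv_const (i : Fin 2) (c : ℝ) (p : ℝ × ℝ) : partialDeriv i (fun _ => c) p = 0 := by
  simp [partialDeriv]

/-- Let `F₁ = ∂F/∂r` and `F₂ = ∂²F/∂r²`. A metric `dr² / (1 + r²) + F² dφ²` has scalar curvature `-2` if `F` solves the Jacobi equation
along the radial geodesics. -/
theorem scalarCurvature_of_jacobi {g : ℝ × ℝ → Matrix (Fin 2) (Fin 2) ℝ} {U : Set (ℝ × ℝ)}
    (hU : IsOpen U) {F F₁ : ℝ × ℝ → ℝ} {F₂ : ℝ} {p : ℝ × ℝ} (hp : p ∈ U)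
    (hg : ∀ q ∈ U, g q = !![(1 + q.1 ^ 2)⁻¹, 0; 0, F q ^ 2]) (hF0 : ∀ q ∈ U, F q ≠ 0)
    (hF : ∀ q ∈ U, DifferentiableAt ℝ F q)
    (h1 : ∀ q ∈ U, HasDerivAt (fun t => F (t, q.2)) (F₁ q) q.1)
    (hF1 : DifferentiableAt ℝ F₁ p) (h2 : HasDerivAt (fun t => F₁ (t, p.2)) F₂ p.1)
    (hj : (1 + p.1 ^ 2) * F₂ + p.1 * F₁ p = F p) : scalarCurvature g p = -2 := by
  have hnhds : ∀ q ∈ U, U ∈ 𝓝 q := fun q hq => hU.mem_nhds hq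
  have hpos : ∀ r : ℝ, 1 + r ^ 2 ≠ 0 := fun r => by positivity
  have hinv : ∀ q ∈ U, (g q)⁻¹ = !![1 + q.1 ^ 2, 0; 0, (F q ^ 2)⁻¹] := fun q hq => by
    refine Matrix.inv_eq_right_inv ?_
    have := hF0 q hq
    have := hpos q.1
    rw [hg q hq]
    ext i j
    fin_cases i <;> fin_cases j <;> simp [Matrix.mul_apply, *]
  have hev : ∀ i j, ∀ q ∈ U, (fun x => g x i j) =ᶠ[𝓝 q]
      fun x => !![(1 + x.1 ^ 2)⁻¹, 0; 0, F x ^ 2] i j := fun i j q hq => by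
    filter_upwards [hnhds q hq] with x hx
    rw [hg x hx]
  have d01 : ∀ k, ∀ q ∈ U, partialDeriv k (fun x => g x 0 1) q = 0 := fun k q hq =>
    (partialDeriv_congr (hev 0 1 q hq) k).trans (partialDeriv_const k 0 q)
  have d10 : ∀ k, ∀ q ∈ U, partialDeriv k (fun x => g x 1 0) q = 0 := fun k q hq =>
    (partialDeriv_congr (hev 1 0 q hq) k).trans (partialDeriv_const k 0 q)
  have hd : ∀ q : ℝ × ℝ, DifferentiableAt ℝ (fun x : ℝ × ℝ => (1 + x.1 ^ 2)⁻¹) q := fun q =>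
    (((differentiableAt_fst).pow 2).const_add 1).inv (hpos q.1)
  have d000 : ∀ q ∈ U, partialDeriv 0 (fun x => g x 0 0) q = -(2 * q.1) / (1 + q.1 ^ 2) ^ 2 :=
    fun q hq => by
    refine (partialDeriv_congr (hev 0 0 q hq) 0).trans (partialDeriv_zero_eq (hd q) ?_)
    have := (((hasDerivAt_id' q.1).fun_pow 2).const_add 1).fun_inv (hpos q.1)
    simpa using this
  have d100 : ∀ q ∈ U, partialDeriv 1 (fun x => g x 0 0) q = 0 := fun q hq =>
    (partialDeriv_congr (hev 0 0 q hq) 1).trans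
      (partialDeriv_one_eq (hd q) (hasDerivAt_const q.2 (1 + q.1 ^ 2)⁻¹))
  have d011 : ∀ q ∈ U, partialDeriv 0 (fun x => g x 1 1) q = 2 * F q * F₁ q := fun q hq => by
    refine (partialDeriv_congr (hev 1 1 q hq) 0).trans (partialDeriv_zero_eq ((hF q hq).pow 2) ?_)
    have := (h1 q hq).fun_pow 2
    simpa using this
  have c000 : ∀ q ∈ U, christoffel g 0 0 0 q = -q.1 / (1 + q.1 ^ 2) := fun q hq => by
    simp only [christoffel, Fin.sum_univ_two, hinv q hq, d000 q hq]
    have := hpos q.1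
    simp
    field_simp
  have c001 : ∀ q ∈ U, christoffel g 0 0 1 q = 0 := fun q hq => by
    simp [christoffel, Fin.sum_univ_two, hinv q hq, d100 q hq, d01 _ q hq, d10 _ q hq]
  have c010 : ∀ q ∈ U, christoffel g 0 1 0 q = 0 := fun q hq => by
    simp [christoffel, Fin.sum_univ_two, hinv q hq, d100 q hq, d01 _ q hq, d10 _ q hq]
  have c011 : ∀ q ∈ U, christoffel g 0 1 1 q = -((1 + q.1 ^ 2) * (F q * F₁ q)) := fun q hq => by
    simp [christoffel, Fin.sum_univ_two, hinv q hq, d011 q hq, d01 _ q hq]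
    ring
  have c100 : ∀ q ∈ U, christoffel g 1 0 0 q = 0 := fun q hq => by
    simp [christoffel, Fin.sum_univ_two, hinv q hq, d100 q hq, d10 _ q hq]
  have c101 : ∀ q ∈ U, christoffel g 1 0 1 q = F₁ q / F q := fun q hq => by
    have := hF0 q hq
    simp [christoffel, Fin.sum_univ_two, hinv q hq, d011 q hq, d10 _ q hq, d01 _ q hq]
    field_simp
  have c110 : ∀ q ∈ U, christoffel g 1 1 0 q = F₁ q / F q := fun q hq => by
    have := hF0 q hq
    simp [christoffel, Fin.sum_univ_two, hinv q hq, d011 q hq, d10 _ q hq, d01 _ q hq]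
    field_simp
  -- `Γ¹₁₁` and the other derivatives drop out of the diagonal components of the Ricci tensor
  have hloc : ∀ {c c' : ℝ × ℝ → ℝ} (i : Fin 2), (∀ q ∈ U, c q = c' q) →
      partialDeriv i c p = partialDeriv i c' p := fun i h =>
    partialDeriv_congr (by filter_upwards [hnhds p hp] with q hq using h q hq) i
  have e1 : partialDeriv 0 (christoffel g 1 0 1) p = (F₂ * F p - F₁ p * F₁ p) / F p ^ 2 :=
    (hloc 0 c101).trans (partialDeriv_zero_eq
      (by simpa only [div_eq_mul_inv] using hF1.fun_mul ((hF p hp).fun_inv (hF0 p hp)))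
      (h2.fun_div (h1 p hp) (hF0 p hp)))
  have e2 : partialDeriv 1 (christoffel g 1 0 0) p = 0 := (hloc 1 c100).trans (partialDeriv_const _ _ _)
  have e3 : partialDeriv 1 (christoffel g 0 1 0) p = 0 := (hloc 1 c010).trans (partialDeriv_const _ _ _)
  have e4 : partialDeriv 0 (christoffel g 0 1 1) p =
      -(2 * p.1 * (F p * F₁ p) + (1 + p.1 ^ 2) * (F₁ p * F₁ p + F p * F₂)) := by
    refine (hloc 0 c011).trans (partialDeriv_zero_eq ?_ ?_)
    · exact ((((differentiableAt_fst).pow 2).const_add 1).mul ((hF p hp).mul hF1)).neg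
    · have := ((((hasDerivAt_id' p.1).fun_pow 2).const_add 1).fun_mul
        ((h1 p hp).fun_mul h2)).fun_neg
      simpa using this
  have := hF0 p hp
  have := hpos p.1
  simp only [scalarCurvature, ricci, Fin.sum_univ_two, hinv p hp, e1, e2, e3, e4, c000 p hp,
    c001 p hp, c010 p hp, c011 p hp, c100 p hp, c101 p hp, c110 p hp]
  simp
  field_simp
  linear_combination (-2 * F p) * hj

/-! ### Ends with prescribed mass-aspect function -/

/-- The function `√(1 + r²) - r`, a solution, decaying at infinity, of the Jacobi equation of the
hyperbolic plane. -/
def jacobiDecay (r : ℝ) : ℝ := √(1 + r ^ 2) - r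

theorem sqrt_one_add_sq_pos (r : ℝ) : 0 < √(1 + r ^ 2) := Real.sqrt_pos.2 (by positivity)

theorem sq_sqrt_one_add_sq (r : ℝ) : √(1 + r ^ 2) ^ 2 = 1 + r ^ 2 := Real.sq_sqrt (by positivity)

theorem hasDerivAt_sqrt_one_add_sq (r : ℝ) :
    HasDerivAt (fun r : ℝ => √(1 + r ^ 2)) (r / √(1 + r ^ 2)) r := by
  have hq : HasDerivAt (fun r : ℝ => 1 + r ^ 2) (2 * r) r := by
    simpa using ((hasDerivAt_id' r).fun_pow 2).const_add 1
  refine (hq.sqrt (by positivity)).congr_deriv ?_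
  have := sqrt_one_add_sq_pos r
  field_simp

theorem jacobiDecay_mul (r : ℝ) : jacobiDecay r * (√(1 + r ^ 2) + r) = 1 := by
  rw [jacobiDecay]
  linear_combination sq_sqrt_one_add_sq r

theorem jacobiDecay_pos (r : ℝ) : 0 < jacobiDecay r := by
  have h : |r| < √(1 + r ^ 2) := by
    rw [← Real.sqrt_sq_eq_abs]
    exact Real.sqrt_lt_sqrt (sq_nonneg r) (by linarith)
  rw [jacobiDecay]
  linarith [le_abs_self r]

theorem jacobiDecay_lt {r : ℝ} (hr : 0 < r) : jacobiDecay r < r⁻¹ := by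
  have h := jacobiDecay_mul r
  have h1 := jacobiDecay_pos r
  have h2 := sqrt_one_add_sq_pos r
  rw [← one_div, lt_div_iff₀ hr]
  nlinarith

theorem hasDerivAt_jacobiDecay (r : ℝ) :
    HasDerivAt jacobiDecay (r / √(1 + r ^ 2) - 1) r :=
  (hasDerivAt_sqrt_one_add_sq r).sub (hasDerivAt_id' r)

theorem hasDerivAt_deriv_jacobiDecay (r : ℝ) :
    HasDerivAt (fun r : ℝ => r / √(1 + r ^ 2) - 1) (1 / √(1 + r ^ 2) ^ 3) r := by
  have h0 := sqrt_one_add_sq_pos r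
  refine (((hasDerivAt_id' r).fun_div (hasDerivAt_sqrt_one_add_sq r) h0.ne').sub_const 1).congr_deriv
    ?_
  field_simp
  linear_combination sq_sqrt_one_add_sq r

theorem tendsto_jacobiDecay : Tendsto jacobiDecay atTop (𝓝 0) :=
  tendsto_of_tendsto_of_tendsto_of_le_of_le' tendsto_const_nhds tendsto_inv_atTop_zero
    (Eventually.of_forall fun r => (jacobiDecay_pos r).le)
    ((eventually_gt_atTop 0).mono fun _ hr => (jacobiDecay_lt hr).le)

theorem two_mul_mul_jacobiDecay (r : ℝ) : 2 * r * jacobiDecay r = 1 - jacobiDecay r ^ 2 := by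
  rw [jacobiDecay]
  linear_combination sq_sqrt_one_add_sq r

theorem tendsto_two_mul_mul_jacobiDecay :
    Tendsto (fun r => 2 * r * jacobiDecay r) atTop (𝓝 1) := by
  have h := (tendsto_jacobiDecay.pow 2).const_sub 1
  rw [zero_pow two_ne_zero, sub_zero] at h
  exact h.congr fun r => (two_mul_mul_jacobiDecay r).symm

theorem tendsto_jacobiDecay_div : Tendsto (fun r => jacobiDecay r / r) atTop (𝓝 0) := by
  have h := tendsto_jacobiDecay.mul tendsto_inv_atTop_zero
  rw [mul_zero] at h
  exact h

theorem tendsto_div_sqrt : Tendsto (fun r : ℝ => r / √(1 + r ^ 2)) atTop (𝓝 1) := by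
  have h := ((tendsto_jacobiDecay_div.const_add 1).inv₀ (by norm_num))
  rw [add_zero, inv_one] at h
  refine h.congr' ((eventually_gt_atTop 0).mono fun r hr => ?_)
  have := sqrt_one_add_sq_pos r
  have e : 1 + jacobiDecay r / r = √(1 + r ^ 2) / r := by
    rw [jacobiDecay]
    field_simp
    ring
  rw [e, inv_div]

theorem hasDerivAt_jacobiDecay_div {r : ℝ} (hr : r ≠ 0) :
    HasDerivAt (fun r => jacobiDecay r / r) (-(1 / (√(1 + r ^ 2) * r ^ 2))) r := by
  refine ((hasDerivAt_jacobiDecay r).fun_div (hasDerivAt_id' r) hr).congr_deriv ?_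
  have := sqrt_one_add_sq_pos r
  rw [jacobiDecay]
  field_simp
  linear_combination -sq_sqrt_one_add_sq r

/-- Uniform convergence of a quadratic polynomial in a bounded function whose coefficients
converge, the quadratic one to zero. -/
theorem tendstoUniformly_quadratic {a b : ℝ → ℝ} {a₀ K : ℝ} {ν : ℝ → ℝ}
    (hK : ∀ x, |ν x| ≤ K) (ha : Tendsto a atTop (𝓝 a₀)) (hb : Tendsto b atTop (𝓝 0))
    {G : ℝ → ℝ → ℝ} (hG : ∀ᶠ r in atTop, ∀ φ, G r φ = a r * ν φ + b r * ν φ ^ 2) :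
    TendstoUniformly G (fun φ => a₀ * ν φ) atTop := by
  have hlim : Tendsto (fun r => |a r - a₀| * K + |b r| * K ^ 2) atTop (𝓝 0) := by
    have h1 := ((ha.sub_const a₀).abs.mul_const K).add (hb.abs.mul_const (K ^ 2))
    simpa using h1
  refine Metric.tendstoUniformly_iff.2 fun ε hε => ?_
  filter_upwards [hlim.eventually_lt_const hε, hG] with r hr hG φ
  refine lt_of_le_of_lt ?_ hr
  rw [dist_comm, Real.dist_eq, hG]
  have e : a r * ν φ + b r * ν φ ^ 2 - a₀ * ν φ = (a r - a₀) * ν φ + b r * ν φ ^ 2 := by ring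
  rw [e]
  refine (abs_add_le _ _).trans ?_
  rw [abs_mul, abs_mul, abs_pow]
  have := hK φ
  gcongr

/-- The length of `∂_φ` in the metric of mass-aspect function `2 ν - 1`. -/
def massRadius (ν : ℝ → ℝ) (p : ℝ × ℝ) : ℝ := p.1 + ν p.2 * jacobiDecay p.1

theorem differentiableAt_massRadius {ν : ℝ → ℝ} (hν : ContDiff ℝ ∞ ν) (p : ℝ × ℝ) :
    DifferentiableAt ℝ (massRadius ν) p :=
  differentiableAt_fst.add
    (((hν.differentiable (by simp) p.2).comp p differentiableAt_snd).mul
      ((hasDerivAt_jacobiDecay p.1).differentiableAt.comp p differentiableAt_fst))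

namespace AngularProfile

/-- Polar coordinates on the surface. -/
def polar (H : AngularProfile) : ℝ × ℝ → H.surface.carrier := planePolar

theorem pullbackMetric_polar (H : AngularProfile) (p v w : ℝ × ℝ) :
    pullbackMetric H.surface H.polar p v w =
      v.1 * w.1 / (1 + p.1 ^ 2) +
        p.1 ^ 2 * (1 + p.1 ^ 2 * H.toFun (planePolar p)) * (v.2 * w.2) :=
  H.pullbackMetric_planePolar p v w

variable {H : AngularProfile} {ν : ℝ → ℝ} {R : ℝ}

theorem metricMatrix_polar
    (hH : ∀ p : ℝ × ℝ, R < p.1 → 0 < massRadius ν p ∧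
      p.1 ^ 2 * (1 + p.1 ^ 2 * H.toFun (planePolar p)) = massRadius ν p ^ 2) {p : ℝ × ℝ}
    (hp : R < p.1) : metricMatrix H.surface H.polar p =
      !![(1 + p.1 ^ 2)⁻¹, 0; 0, massRadius ν p ^ 2] := by
  ext i j
  rw [metricMatrix, Matrix.of_apply, H.pullbackMetric_polar, (hH p hp).2]
  fin_cases i <;> fin_cases j <;> simp [coordVec]

theorem scalarCurvature_polar (hν : ContDiff ℝ ∞ ν)
    (hH : ∀ p : ℝ × ℝ, R < p.1 → 0 < massRadius ν p ∧
      p.1 ^ 2 * (1 + p.1 ^ 2 * H.toFun (planePolar p)) = massRadius ν p ^ 2) {p : ℝ × ℝ}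
    (hp : R < p.1) : scalarCurvature (metricMatrix H.surface H.polar) p = -2 := by
  refine scalarCurvature_of_jacobi (U := {q | R < q.1}) (F := massRadius ν)
    (F₁ := fun q => 1 + ν q.2 * (q.1 / √(1 + q.1 ^ 2) - 1))
    (F₂ := ν p.2 * (1 / √(1 + p.1 ^ 2) ^ 3)) (isOpen_lt continuous_const continuous_fst) hp
    (fun q hq => metricMatrix_polar hH hq) (fun q hq => (hH q hq).1.ne')
    (fun q _ => differentiableAt_massRadius hν q)
    (fun q _ => (hasDerivAt_id' q.1).add ((hasDerivAt_jacobiDecay q.1).const_mul (ν q.2))) ?_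
    (((hasDerivAt_deriv_jacobiDecay p.1).const_mul (ν p.2)).const_add 1) ?_
  · exact (((hν.differentiable (by simp) p.2).comp p differentiableAt_snd).mul
      ((hasDerivAt_deriv_jacobiDecay p.1).differentiableAt.comp p differentiableAt_fst)).const_add 1
  · have h0 := sqrt_one_add_sq_pos p.1
    have h1 := sq_sqrt_one_add_sq p.1
    rw [massRadius, jacobiDecay]
    generalize √(1 + p.1 ^ 2) = S at h0 h1 ⊢
    rw [← h1]
    field_simp
    linear_combination (-ν p.2) * h1

theorem metricError_polar (hR : 0 ≤ R)
    (hH : ∀ p : ℝ × ℝ, R < p.1 → 0 < massRadius ν p ∧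
      p.1 ^ 2 * (1 + p.1 ^ 2 * H.toFun (planePolar p)) = massRadius ν p ^ 2) {r : ℝ} (φ : ℝ)
    (hr : R < r) : ∀ i j, metricError H.surface H.polar i j (r, φ) =
      !![-1 / (1 + r ^ 2), 0; 0, 2 * ν φ * (jacobiDecay r / r) + ν φ ^ 2 * (jacobiDecay r / r) ^ 2]
        i j := by
  have h0 : r ≠ 0 := (hR.trans_lt hr).ne'
  intro i j
  rw [metricError, H.pullbackMetric_polar, (hH (r, φ) hr).2]
  fin_cases i <;> fin_cases j <;> simp [frameVec, massRadius]
  · field_simp; ring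
  · field_simp; ring

/-- The metric of the plane with profile `(1 + r² H) r² = (r + ν (√(1 + r²) - r))²` near infinity has
an asymptotically locally hyperbolic end of mass-aspect function `2 ν - 1`. -/
theorem isALHEnd (hν : IsCircleFunction ν) {K : ℝ} (hK : ∀ x, |ν x| ≤ K) (hR : 0 < R)
    (hH : ∀ p : ℝ × ℝ, R < p.1 → 0 < massRadius ν p ∧
      p.1 ^ 2 * (1 + p.1 ^ 2 * H.toFun (planePolar p)) = massRadius ν p ^ 2) :
    IsALHEnd H.surface R H.polar (fun φ => 2 * ν φ - 1) where
  R_pos := hR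
  smooth := contDiff_planePolar.contMDiff.contMDiffOn
  periodic r φ := by
    change planePolar _ = planePolar _
    simp only [planePolar, Real.cos_add_two_pi, Real.sin_add_two_pi]
  injective p q hp hq h := by
    have h : planePolar p = planePolar q := h
    have h1 := congrArg normSq h
    rw [normSq_planePolar, normSq_planePolar] at h1
    have hp0 := hR.trans hp
    have h2 : p.1 = q.1 := by
      have := abs_eq_abs.2 (sq_eq_sq_iff_eq_or_eq_neg.1 h1)
      rwa [abs_of_pos hp0, abs_of_pos (hR.trans hq)] at this
    refine ⟨h2, ?_⟩
    have hc : p.1 * Real.cos p.2 = q.1 * Real.cos q.2 := congrArg (fun X : Plane => X 0) h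
    have hs : p.1 * Real.sin p.2 = q.1 * Real.sin q.2 := congrArg (fun X : Plane => X 1) h
    rw [← h2] at hc hs
    have := Real.Angle.cos_sin_inj (mul_left_cancel₀ hp0.ne' hc) (mul_left_cancel₀ hp0.ne' hs)
    obtain ⟨k, hk⟩ := Real.Angle.angle_eq_iff_two_pi_dvd_sub.1 this
    exact ⟨k, by linarith⟩
  immersion p hp := by
    refine injective_of_pullbackMetric_pos fun v hv => ?_
    rw [H.pullbackMetric_polar, (hH p hp).2]
    have h0 := (hH p hp).1
    have h1 : 0 < 1 + p.1 ^ 2 := by positivity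
    by_cases hv1 : v.1 = 0
    · have hv2 : v.2 ≠ 0 := fun h => hv (Prod.ext hv1 h)
      have := mul_self_pos.2 hv2
      have := mul_self_nonneg v.1
      positivity
    · have := mul_self_pos.2 hv1
      have := mul_self_nonneg v.2
      positivity
  closed R' hR' := by
    have hR0 : 0 < R' := hR.trans hR'
    have e : planePolar '' {p | R' ≤ p.1} = {X | R' ^ 2 ≤ normSq X} := by
      ext X
      constructor
      · rintro ⟨p, hp, rfl⟩
        have hp : R' ≤ p.1 := hp
        change R' ^ 2 ≤ normSq (planePolar p)
        rw [normSq_planePolar]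
        gcongr
      · intro hX
        have hX : R' ^ 2 ≤ normSq X := hX
        set z : ℂ := ⟨X 0, X 1⟩ with hz
        have hn : ‖z‖ ^ 2 = normSq X := by
          rw [Complex.sq_norm, Complex.normSq_apply, normSq]; ring
        refine ⟨(‖z‖, z.arg), ?_, ?_⟩
        · exact abs_le_of_sq_le_sq' (by rw [hn]; exact hX) (norm_nonneg z) |>.2
        · ext i
          fin_cases i
          · exact Complex.norm_mul_cos_arg z
          · exact Complex.norm_mul_sin_arg z
    change IsClosed (planePolar '' {p | R' ≤ p.1})
    rw [e]
    exact isClosed_le continuous_const normSq_contDiff.continuous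
  curvature p hp := scalarCurvature_polar hν.smooth hH hp
  massAspect := by
    have hR0 := hR.le
    have hev : ∀ᶠ r in atTop, R < r := eventually_gt_atTop R
    have hone : ∀ x : ℝ, |(1 : ℝ)| ≤ 1 := fun _ => abs_one.le
    have h0 : ∀ {k : ℕ} {G : ℝ → ℝ → ℝ} {g : ℝ → ℝ}, (∀ φ, g φ = 0) →
        (∀ r φ, R < r → G r φ = 0) → TendstoUniformly (fun r φ => r ^ k * G r φ) g atTop := by
      intro k G g hg hG
      have := tendstoUniformly_quadratic (a := fun _ => 0) (b := fun _ => 0)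
        (G := fun r φ => r ^ k * G r φ) hK tendsto_const_nhds tendsto_const_nhds
        (hev.mono fun r hr φ => by rw [hG r φ hr]; ring)
      refine (funext fun φ => ?_ : _ = g) ▸ this
      rw [hg, zero_mul]
    have hder : ∀ {r : ℝ} φ, R < r → ∀ i j, deriv (fun t => metricError H.surface H.polar i j (t, φ)) r
        = deriv (fun t => !![-1 / (1 + t ^ 2), 0; 0, 2 * ν φ * (jacobiDecay t / t) +
          ν φ ^ 2 * (jacobiDecay t / t) ^ 2] i j) r := fun {r} φ hr i j =>
      Filter.EventuallyEq.deriv_eq ((eventually_gt_nhds hr).mono fun t ht =>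
        metricError_polar hR0 hH φ ht i j)
    refine ⟨fun i j φ => !![-1, 0; 0, ν φ] i j, fun i j => ?_, fun i j => ?_, fun i j => ?_,
      fun φ => ?_⟩
    · fin_cases i <;> fin_cases j
      · exact ⟨contDiff_const, fun _ => rfl⟩
      · exact ⟨contDiff_const, fun _ => rfl⟩
      · exact ⟨contDiff_const, fun _ => rfl⟩
      · exact hν
    · fin_cases i <;> fin_cases j
      · have := tendstoUniformly_quadratic (ν := fun _ => 1) (b := fun _ => 0)
          (G := fun r φ => r ^ 2 * metricError H.surface H.polar 0 0 (r, φ)) hone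
          MaskitPiece.tendsto_sq_div tendsto_const_nhds
          (hev.mono fun r hr φ => by rw [metricError_polar hR0 hH φ hr]; simp)
        simpa using this
      · exact h0 (fun _ => rfl) fun r φ hr => metricError_polar hR0 hH φ hr 0 1
      · exact h0 (fun _ => rfl) fun r φ hr => metricError_polar hR0 hH φ hr 1 0
      · have := tendstoUniformly_quadratic
          (G := fun r φ => r ^ 2 * metricError H.surface H.polar 1 1 (r, φ)) hK
          tendsto_two_mul_mul_jacobiDecay (by simpa using tendsto_jacobiDecay.pow 2)
          (hev.mono fun r hr φ => by
            have := (hR.trans hr).ne'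
            rw [metricError_polar hR0 hH φ hr]
            simp
            field_simp)
        simpa using this
    · fin_cases i <;> fin_cases j
      · have := tendstoUniformly_quadratic (ν := fun _ => 1) (a₀ := 2) (b := fun _ => 0)
          (a := fun r => 2 * (r ^ 2 * (-1 / (1 + r ^ 2))) ^ 2)
          (G := fun r φ => r ^ 3 * deriv (fun t => metricError H.surface H.polar 0 0 (t, φ)) r) hone
          (by simpa using (MaskitPiece.tendsto_sq_div.pow 2).const_mul 2) tendsto_const_nhds
          (hev.mono fun r hr φ => by
            have hd : HasDerivAt (fun t : ℝ => -1 / (1 + t ^ 2)) (2 * r / (1 + r ^ 2) ^ 2) r := by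
              have := (hasDerivAt_const r (-1 : ℝ)).fun_div
                (((hasDerivAt_id' r).fun_pow 2).const_add 1) (by positivity)
              simpa using this
            rw [hder φ hr]
            refine (congrArg (r ^ 3 * ·) hd.deriv).trans ?_
            have : 1 + r ^ 2 ≠ 0 := by positivity
            field_simp
            ring)
        simpa using this
      · exact h0 (fun _ => mul_zero _) fun r φ hr =>
          (hder φ hr 0 1).trans (deriv_const r (0 : ℝ))
      · exact h0 (fun _ => mul_zero _) fun r φ hr =>
          (hder φ hr 1 0).trans (deriv_const r (0 : ℝ))
      · have := tendstoUniformly_quadratic (a₀ := -2) (a := fun r => -2 * (r / √(1 + r ^ 2)))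
          (b := fun r => -2 * (r / √(1 + r ^ 2)) * (jacobiDecay r / r))
          (G := fun r φ => r ^ 3 * deriv (fun t => metricError H.surface H.polar 1 1 (t, φ)) r) hK
          (by simpa using tendsto_div_sqrt.const_mul (-2))
          (by simpa using (tendsto_div_sqrt.const_mul (-2)).mul tendsto_jacobiDecay_div)
          (hev.mono fun r hr φ => by
            have hr0 := (hR.trans hr).ne'
            have hq := hasDerivAt_jacobiDecay_div hr0
            have hd := (hq.const_mul (2 * ν φ)).fun_add ((hq.fun_pow 2).const_mul (ν φ ^ 2))
            rw [hder φ hr]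
            refine (congrArg (r ^ 3 * ·) hd.deriv).trans ?_
            have := sqrt_one_add_sq_pos r
            simp
            field_simp)
        exact this
    · simp; ring

end AngularProfile

/-! ### Profiles with prescribed mass-aspect function -/

theorem IsCircleFunction.exists_bound {ν : ℝ → ℝ} (hν : IsCircleFunction ν) :
    ∃ K : ℝ, 1 ≤ K ∧ ∀ x, |ν x| ≤ K := by
  obtain ⟨C, hC⟩ := (isCompact_Icc (a := (0 : ℝ)) (b := 2 * Real.pi)).exists_bound_of_continuousOn
    hν.smooth.continuous.continuousOn
  refine ⟨max C 1, le_max_right _ _, fun x => ?_⟩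
  obtain ⟨y, hy, e⟩ := Function.Periodic.exists_mem_Ico₀ (f := ν) hν.periodic Real.two_pi_pos x
  rw [e]
  exact (hC y ⟨hy.1, hy.2.le⟩).trans (le_max_left _ _)

/-- The polar angle on the half-plane `X₀ < 0`. -/
def leftAngle (X : Plane) : ℝ := Real.pi + Real.arctan (X 1 / X 0)

theorem cos_leftAngle {X : Plane} (h : X 0 < 0) : Real.cos (leftAngle X) = X 0 / √(normSq X) := by
  have h2 : √(normSq X) = √(1 + (X 1 / X 0) ^ 2) * -X 0 := by
    rw [← Real.sqrt_sq (neg_pos.2 h).le, ← Real.sqrt_mul (by positivity), normSq]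
    congr 1
    have := h.ne
    field_simp
  have h3 : 0 < √(1 + (X 1 / X 0) ^ 2) := Real.sqrt_pos.2 (by positivity)
  rw [leftAngle, add_comm, Real.cos_add_pi, Real.cos_arctan, h2]
  have := h.ne
  field_simp

theorem sin_leftAngle {X : Plane} (h : X 0 < 0) : Real.sin (leftAngle X) = X 1 / √(normSq X) := by
  have h2 : √(normSq X) = √(1 + (X 1 / X 0) ^ 2) * -X 0 := by
    rw [← Real.sqrt_sq (neg_pos.2 h).le, ← Real.sqrt_mul (by positivity), normSq]
    congr 1
    have := h.ne
    field_simp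
  have h3 : 0 < √(1 + (X 1 / X 0) ^ 2) := Real.sqrt_pos.2 (by positivity)
  rw [leftAngle, add_comm, Real.sin_add_pi, Real.sin_arctan, h2]
  have := h.ne
  field_simp

theorem IsCircleFunction.eq_of_cos_sin {ν : ℝ → ℝ} (hν : IsCircleFunction ν) {x y : ℝ}
    (hc : Real.cos x = Real.cos y) (hs : Real.sin x = Real.sin y) : ν x = ν y := by
  obtain ⟨k, hk⟩ := Real.Angle.angle_eq_iff_two_pi_dvd_sub.1 (Real.Angle.cos_sin_inj hc hs)
  have := Function.Periodic.int_mul (f := ν) hν.periodic k y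
  rw [← this]
  congr 1
  linarith

theorem eq_leftAngle {ν : ℝ → ℝ} (hν : IsCircleFunction ν) {p : ℝ × ℝ} (hp : 0 < p.1)
    (hc : Real.cos p.2 < 0) : ν (leftAngle (planePolar p)) = ν p.2 := by
  have h0 : planePolar p 0 < 0 := mul_neg_of_pos_of_neg hp hc
  refine hν.eq_of_cos_sin ?_ ?_
  · rw [cos_leftAngle h0, normSq_planePolar, Real.sqrt_sq hp.le, planePolar_zero]
    field_simp
  · rw [sin_leftAngle h0, normSq_planePolar, Real.sqrt_sq hp.le, planePolar_one]
    field_simp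

/-- The relative change of the length of `∂_φ`, cut off near the origin. -/
def lengthChange (ν : ℝ → ℝ) (K : ℝ) (X : Plane) : ℝ :=
  Real.smoothTransition (normSq X - K) * ν (leftAngle X) *
    (jacobiDecay √(normSq X) / √(normSq X))

/-- The profile, supported on the half-plane `X₀ < 0`, that changes the length of `∂_φ` in the
hyperbolic metric by the factor `1 + lengthChange ν K`. -/
def leftProfile (ν : ℝ → ℝ) (K : ℝ) (X : Plane) : ℝ :=
  if X 0 < 0 then ((1 + lengthChange ν K X) ^ 2 - 1) / normSq X else 0

section

variable {ν : ℝ → ℝ} {K δ : ℝ}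

theorem normSq_pos_of_neg {X : Plane} (h : X 0 < 0) : 0 < normSq X := by
  rw [normSq]
  have := sq_pos_of_neg h
  positivity

theorem one_add_normSq_mul_leftProfile {X : Plane} (h : X 0 < 0) :
    1 + normSq X * leftProfile ν K X = (1 + lengthChange ν K X) ^ 2 := by
  have := (normSq_pos_of_neg h).ne'
  rw [leftProfile, if_pos h]
  field_simp
  ring

/-- The cutoff removes the region `normSq X ≤ K`; outside of it the relative change of length is
smaller than `K / normSq X`. -/
theorem one_add_lengthChange_pos (hK : 1 ≤ K) (hν : ∀ x, |ν x| ≤ K) (X : Plane) :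
    0 < 1 + lengthChange ν K X := by
  rcases le_total (normSq X) K with h | h
  · rw [lengthChange, Real.smoothTransition.zero_of_nonpos (by linarith)]
    norm_num
  · have hN : 0 < normSq X := by linarith
    set r := √(normSq X) with hr
    have hr0 : 0 < r := Real.sqrt_pos.2 hN
    have hr2 : r ^ 2 = normSq X := Real.sq_sqrt hN.le
    have h1 : 0 < jacobiDecay r / r := div_pos (jacobiDecay_pos r) hr0
    have h2 : K * (jacobiDecay r / r) < 1 := by
      have h3 : jacobiDecay r * r < 1 := by
        have := mul_lt_mul_of_pos_right (jacobiDecay_lt hr0) hr0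
        rwa [inv_mul_cancel₀ hr0.ne'] at this
      rw [← mul_div_assoc, div_lt_one hr0]
      have h4 : K * jacobiDecay r ≤ r ^ 2 * jacobiDecay r :=
        mul_le_mul_of_nonneg_right (by rw [hr2]; exact h) (jacobiDecay_pos r).le
      nlinarith
    have h3 : |lengthChange ν K X| ≤ K * (jacobiDecay r / r) := by
      rw [lengthChange, abs_mul, abs_mul, ← hr, abs_of_pos h1]
      refine mul_le_mul_of_nonneg_right ?_ h1.le
      rw [abs_of_nonneg (Real.smoothTransition.nonneg _)]
      calc _ ≤ 1 * K := mul_le_mul (Real.smoothTransition.le_one _) (hν _) (abs_nonneg _) zero_le_one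
        _ = K := one_mul K
    linarith [neg_abs_le (lengthChange ν K X)]

/-- If `ν` vanishes on the arc `cos φ > -δ`, the profile vanishes on a neighbourhood of the half-plane
of the disc: outside the unit disc of the plane the factor `1 + √(1 + r²)` by which Cartesian and disc
coordinates differ is at most `3 r`, so that `y₁ > -δ / 4` implies `cos φ > -δ`. -/
theorem leftProfile_eq_zero (hK : 1 ≤ K) (hδ : 0 < δ) (h0 : ∀ x, -δ < Real.cos x → ν x = 0)
    {X : Plane} (hX : -(δ / 4) < (toDisc X).1) : leftProfile ν K X = 0 := by
  rw [leftProfile]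
  split_ifs with h
  · suffices lengthChange ν K X = 0 by rw [this]; simp
    rcases le_total (normSq X) K with hN | hN
    · rw [lengthChange, Real.smoothTransition.zero_of_nonpos (by linarith)]
      simp
    · rw [lengthChange, h0, mul_zero, zero_mul]
      rw [cos_leftAngle h]
      set r := √(normSq X) with hr
      have hr2 : r ^ 2 = normSq X := Real.sq_sqrt (by linarith)
      have hr1 : 1 ≤ r := Real.one_le_sqrt.2 (hK.trans hN)
      have hs : √(1 + normSq X) ≤ 1 + r := Real.sqrt_le_left (by linarith) |>.2 (by nlinarith)
      have h1 : -(δ / 4) < X 0 / (1 + √(1 + normSq X)) := hX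
      rw [lt_div_iff₀ (by positivity)] at h1
      rw [lt_div_iff₀ (by linarith)]
      nlinarith
  · rfl

theorem contDiff_leftProfile (hK : 1 ≤ K) (hν : IsCircleFunction ν) (hδ : 0 < δ)
    (h0 : ∀ x, -δ < Real.cos x → ν x = 0) : ContDiff ℝ ∞ (leftProfile ν K) := by
  refine contDiff_iff_contDiffAt.2 fun X => ?_
  rcases lt_or_ge (X 0) 0 with h | h
  · have hN := (normSq_pos_of_neg h).ne'
    have cN : ContDiffAt ℝ ∞ normSq X := normSq_contDiff.contDiffAt
    have cs : ContDiffAt ℝ ∞ (fun X => √(normSq X)) X := cN.sqrt hN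
    have cs2 : ContDiffAt ℝ ∞ (fun X => √(1 + √(normSq X) ^ 2)) X :=
      (contDiffAt_const.add (cs.pow 2)).sqrt (by positivity)
    have ca : ContDiffAt ℝ ∞ leftAngle X := contDiffAt_const.add
      (Real.contDiff_arctan.contDiffAt.comp X
        ((coord_contDiff 1).contDiffAt.div (coord_contDiff 0).contDiffAt h.ne))
    have cl : ContDiffAt ℝ ∞ (lengthChange ν K) X :=
      ((Real.smoothTransition.contDiff.contDiffAt.comp X (cN.sub contDiffAt_const)).mul
        (hν.smooth.contDiffAt.comp X ca)).mul
        ((cs2.sub cs).div cs (Real.sqrt_ne_zero'.2 (normSq_pos_of_neg h)))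
    refine (((((contDiffAt_const (c := (1 : ℝ))).add cl).pow 2).sub
      (contDiffAt_const (c := (1 : ℝ)))).div cN hN).congr_of_eventuallyEq ?_
    filter_upwards [(isOpen_lt (coord_contDiff 0).continuous continuous_const).mem_nhds h] with Y hY
    exact if_pos hY
  · have hX : -(δ / 4) < (toDisc X).1 :=
      lt_of_lt_of_le (by linarith) (div_nonneg h (by positivity))
    refine (contDiffAt_const (c := (0 : ℝ))).congr_of_eventuallyEq ?_
    filter_upwards [(isOpen_lt continuous_const
      (continuous_fst.comp continuous_toDisc)).mem_nhds hX] with Y hY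
    exact leftProfile_eq_zero hK hδ h0 hY

end

namespace AngularProfile

/-- Near infinity, `H` changes the length of `∂_φ` so that the mass-aspect function is `2 ν - 1`. -/
def HasMass (H : AngularProfile) (R : ℝ) (ν : ℝ → ℝ) : Prop :=
  ∀ p : ℝ × ℝ, R < p.1 → 0 < massRadius ν p ∧
    p.1 ^ 2 * (1 + p.1 ^ 2 * H.toFun (planePolar p)) = massRadius ν p ^ 2

/-- Every circle function that vanishes on an arc slightly larger than the half-circle is realised
by a profile that is hyperbolic on a neighbourhood of the half-plane. -/
theorem exists_hasMass {ν : ℝ → ℝ} (hν : IsCircleFunction ν) {δ : ℝ} (hδ : 0 < δ)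
    (h0 : ∀ x, -δ < Real.cos x → ν x = 0) :
    ∃ (H : AngularProfile) (R : ℝ), 0 < R ∧ H.HasMass R ν ∧
      ∀ X, -(δ / 4) < (toDisc X).1 → H.toFun X = 0 := by
  obtain ⟨K, hK, hb⟩ := hν.exists_bound
  refine ⟨⟨leftProfile ν K, contDiff_leftProfile hK hν hδ h0, fun X => ?_⟩, K + 1, by linarith,
    fun p hp => ?_, fun X hX => leftProfile_eq_zero hK hδ h0 hX⟩
  · by_cases h : X 0 < 0
    · rw [one_add_normSq_mul_leftProfile h]
      exact pow_pos (one_add_lengthChange_pos hK hb X) 2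
    · simp [leftProfile, if_neg h]
  · have hp0 : 0 < p.1 := by linarith
    change 0 < massRadius ν p ∧ p.1 ^ 2 * (1 + p.1 ^ 2 * leftProfile ν K (planePolar p)) = _
    rw [← normSq_planePolar p]
    rcases lt_or_ge (Real.cos p.2) 0 with hc | hc
    · have hX : planePolar p 0 < 0 := mul_neg_of_pos_of_neg hp0 hc
      have e : p.1 * (1 + lengthChange ν K (planePolar p)) = massRadius ν p := by
        rw [lengthChange, eq_leftAngle hν hp0 hc, normSq_planePolar, Real.sqrt_sq hp0.le,
          Real.smoothTransition.one_of_one_le (by nlinarith), massRadius]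
        field_simp
      rw [one_add_normSq_mul_leftProfile hX, normSq_planePolar, ← e]
      exact ⟨mul_pos hp0 (one_add_lengthChange_pos hK hb _), by ring⟩
    · have hX : ¬planePolar p 0 < 0 := not_lt.2 (mul_nonneg hp0.le hc)
      rw [leftProfile, if_neg hX, massRadius, h0 p.2 (by linarith), normSq_planePolar]
      exact ⟨by linarith, by ring⟩

/-- The reflection of a profile in the origin. -/
def reflect (H : AngularProfile) : AngularProfile where
  toFun X := H.toFun (-X)
  smooth := H.smooth.comp contDiff_neg
  pos X := by
    have := H.pos (-X)
    simpa [normSq] using this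

theorem HasMass.reflect {H : AngularProfile} {R : ℝ} {ν : ℝ → ℝ} (h : H.HasMass R ν) :
    H.reflect.HasMass R fun x => ν (x + -Real.pi) := fun p hp => by
  have e : -planePolar p = planePolar (p.1, p.2 + -Real.pi) := by
    rw [← sub_eq_add_neg]
    ext i
    fin_cases i
    · change -(p.1 * Real.cos p.2) = p.1 * Real.cos (p.2 - Real.pi)
      rw [Real.cos_sub_pi]; ring
    · change -(p.1 * Real.sin p.2) = p.1 * Real.sin (p.2 - Real.pi)
      rw [Real.sin_sub_pi]; ring
  have := h (p.1, p.2 + -Real.pi) hp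
  rw [← e] at this
  exact this

theorem toDisc_neg (X : Plane) : (toDisc (-X)).1 = -(toDisc X).1 := by
  simp [toDisc, normSq, neg_div]

/-! ### Pieces and their gluing -/

/-- The identification of the disc with the surface. -/
def disc (H : AngularProfile) : ℝ × ℝ → H.surface.carrier := ofDisc

theorem disc_image (H : AngularProfile) (σ a : ℝ) :
    H.disc '' discPartClosed σ a = {X : Plane | a ≤ σ * (toDisc X).1} := by
  change ofDisc '' discPartClosed σ a = _
  ext X
  constructor
  · rintro ⟨y, hy, rfl⟩
    change a ≤ σ * (toDisc (ofDisc y)).1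
    rw [toDisc_ofDisc hy.1]
    exact hy.2
  · exact fun hX => ⟨toDisc X, ⟨toDisc_mem X, hX⟩, ofDisc_toDisc X⟩

/-- A profile vanishing on a neighbourhood of a half-plane gives a piece for Maskit gluing. -/
def piece (H : AngularProfile) {σ δ R : ℝ} {ν : ℝ → ℝ} (hδ : 0 < δ) (hδ1 : δ < 1) (hR : 0 < R)
    (hν : IsCircleFunction ν) (hm : H.HasMass R ν)
    (h0 : ∀ X, -δ < σ * (toDisc X).1 → H.toFun X = 0) : MaskitPiece.{0} σ δ where
  toRiemannianSurface := H.surface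
  R := R
  e := H.polar
  μ := fun φ => 2 * ν φ - 1
  isEnd := by
    obtain ⟨K, -, hK⟩ := hν.exists_bound
    exact H.isALHEnd hν hK hR hm
  s := H.disc
  δ_pos := hδ
  δ_lt_one := hδ1
  s_smooth := ContDiffOn.contMDiffOn (E := ℝ × ℝ) (E' := Plane) (f := ofDisc)
    fun y hy => (contDiffAt_ofDisc hy.1).contDiffWithinAt
  s_injOn := fun y hy z hz h => by
    have h : ofDisc y = ofDisc z := h
    rw [← toDisc_ofDisc hy.1, h, toDisc_ofDisc hz.1]
  s_isometry := fun y hy v w => H.pullbackMetric_ofDisc hy.1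
    (h0 _ (by rw [toDisc_ofDisc hy.1]; exact hy.2)) v w
  s_closed := fun a _ => by
    rw [disc_image]
    exact isClosed_le continuous_const (continuous_const.mul (continuous_fst.comp continuous_toDisc))
  s_eq_e := fun p _ _ => ofDisc_discPolar p
  e_mem_s := fun p _ ⟨y, hy, e⟩ => by
    have e : ofDisc y = planePolar p := e
    rwa [← toDisc_planePolar, ← e, toDisc_ofDisc hy.1]

theorem mem_keep_piece (H : AngularProfile) {σ δ R : ℝ} {ν : ℝ → ℝ} (hδ : 0 < δ) (hδ1 : δ < 1)
    (hR : 0 < R) (hν : IsCircleFunction ν) (hm : H.HasMass R ν)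
    (h0 : ∀ X, -δ < σ * (toDisc X).1 → H.toFun X = 0) (X : Plane) :
    X ∈ (H.piece hδ hδ1 hR hν hm h0).keep ↔ σ * (toDisc X).1 < δ := by
  change X ∉ H.disc '' discPartClosed σ δ ↔ _
  rw [disc_image]
  exact not_le (a := δ) (b := σ * (toDisc X).1)

/-- The sum of two profiles with disjoint supports. -/
def add (H H' : AngularProfile) (h : ∀ X, H.toFun X = 0 ∨ H'.toFun X = 0) : AngularProfile where
  toFun X := H.toFun X + H'.toFun X
  smooth := H.smooth.add H'.smooth
  pos X := by
    rcases h X with h | h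
    · rw [h, zero_add]; exact H'.pos X
    · rw [h, add_zero]; exact H.pos X

/-- Where two profiles agree, the identity is an isometry. -/
theorem isIsometricOpenEmbeddingOn_id (H H' : AngularProfile) {U : Set H.surface.carrier}
    (hU : IsOpen U) (h : ∀ X ∈ U, H'.toFun X = H.toFun X) :
    IsIsometricOpenEmbeddingOn H.surface H'.surface U fun X : Plane => (X : Plane) where
  smooth := (contMDiffOn_id : ContMDiffOn (𝓡 2) (𝓡 2) ∞ (id : Plane → Plane) U)
  openEmbedding := hU.isOpenEmbedding_subtypeVal
  isometry X hX v w := by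
    have key : ∀ (X v w : Plane) (L : Plane →L[ℝ] Plane), L = ContinuousLinearMap.id ℝ Plane →
        H'.toFun X = H.toFun X → planeForm H'.toFun X (L v) (L w) = planeForm H.toFun X v w := by
      rintro X v w _ rfl h
      change planeForm H'.toFun X v w = planeForm H.toFun X v w
      rw [planeForm_apply, planeForm_apply, h]
    exact key X v w _ mfderiv_id (h X hX)

/-- Pieces given by two profiles can be glued: the glued surface is given by the sum of the
profiles. -/
def gluing (H H' : AngularProfile) {δ R R' : ℝ} {ν ν' : ℝ → ℝ} (hδ : 0 < δ) (hδ1 : δ < 1)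
    (hR : 0 < R) (hR' : 0 < R') (hν : IsCircleFunction ν) (hν' : IsCircleFunction ν')
    (hm : H.HasMass R ν) (hm' : H'.HasMass R' ν')
    (h0 : ∀ X, -δ < 1 * (toDisc X).1 → H.toFun X = 0)
    (h0' : ∀ X, -δ < -1 * (toDisc X).1 → H'.toFun X = 0) :
    MaskitGluing.{0, 0, 0} (H.piece hδ hδ1 hR hν hm h0) (H'.piece hδ hδ1 hR' hν' hm' h0') where
  toRiemannianSurface := (H.add H' fun X => by
    rcases le_total 0 (toDisc X).1 with h | h
    · exact Or.inl (h0 X (by linarith))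
    · exact Or.inr (h0' X (by linarith))).surface
  jP := fun X : Plane => X
  jQ := fun X : Plane => X
  jP_embedding := isIsometricOpenEmbeddingOn_id H _ (MaskitPiece.isOpen_keep _) fun X hX => by
    have hX := (H.mem_keep_piece hδ hδ1 hR hν hm h0 X).1 hX
    change H.toFun X + H'.toFun X = H.toFun X
    rw [h0' X (by linarith), add_zero]
  jQ_embedding := isIsometricOpenEmbeddingOn_id H' _ (MaskitPiece.isOpen_keep _) fun X hX => by
    have hX := (H'.mem_keep_piece hδ hδ1 hR' hν' hm' h0' X).1 hX
    change H.toFun X + H'.toFun X = H'.toFun X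
    rw [h0 X (by linarith), zero_add]
  cover := Set.eq_univ_of_forall fun X => by
    rcases le_total (toDisc X).1 0 with h | h
    · exact Or.inl ⟨X, (H.mem_keep_piece hδ hδ1 hR hν hm h0 X).2 (by linarith), rfl⟩
    · exact Or.inr ⟨X, (H'.mem_keep_piece hδ hδ1 hR' hν' hm' h0' X).2 (by linarith), rfl⟩
  overlap := fun X hX Y hY => by
    have hX := (H.mem_keep_piece hδ hδ1 hR hν hm h0 X).1 hX
    have hY := (H'.mem_keep_piece hδ hδ1 hR' hν' hm' h0' Y).1 hY
    constructor
    · intro h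
      have h : X = Y := h
      subst h
      exact ⟨toDisc X, ⟨toDisc_mem X, abs_lt.2 ⟨by linarith, by linarith⟩⟩, ofDisc_toDisc X,
        ofDisc_toDisc X⟩
    · rintro ⟨z, -, h1, h2⟩
      have h : X = Y := h1.symm.trans h2
      exact h

end AngularProfile

/-! ### Existence of gluings and the glued mass -/

/-- Glued pieces of positive mass exist for all values of the masses and gluing parameters. -/
theorem exists_maskitGluing {mP mQ κP κQ : ℝ} (hmP : 0 < mP) (hmQ : 0 < mQ) (hκP : 1 < κP)
    (hκQ : 1 < κQ) :
    ∃ (δ : ℝ) (P : MaskitPiece.{0} 1 δ) (Q : MaskitPiece.{0} (-1) δ)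
      (_ : MaskitGluing.{0, 0, 0} P Q) (fP fQ : ℝ → ℝ),
      IsFirstGauge mP κP fP P.μ ∧ IsSecondGauge mQ κQ fQ Q.μ := by
  have hprofile : ∀ {m κ : ℝ}, 0 < m → 1 < κ → ∃ (f : ℝ → ℝ) (ν : ℝ → ℝ) (H : AngularProfile)
      (δ R : ℝ), 0 < δ ∧ δ < 1 ∧ 0 < R ∧ IsCircleFunction ν ∧ H.HasMass R ν ∧
        (∀ X, -δ < (toDisc X).1 → H.toFun X = 0) ∧ IsFirstGauge m κ f fun φ => 2 * ν φ - 1 := by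
    intro m κ hm hκ
    -- `ν = (μ + 1) / 2` vanishes where `μ` is the mass-aspect function `-1` of the hyperbolic plane
    obtain ⟨f, δ, h0, h1, hg, he⟩ := exists_isFirstGauge hm hκ
    have hc := massTransform_const_isCircleFunction hm hg.diffeo
    have hν : IsCircleFunction fun φ => (massTransform (fun _ => m) f φ + 1) / 2 :=
      ⟨(hc.smooth.add contDiff_const).div_const 2, fun x => by rw [hc.periodic]⟩
    obtain ⟨H, R, hR, hmass, hH⟩ := AngularProfile.exists_hasMass hν h0 fun x hx => by
      rw [he x hx]; norm_num
    exact ⟨f, _, H, δ / 4, R, by linarith, by linarith, hR, hν, hmass, hH,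
      ⟨hg.diffeo, fun x => by ring, hg.normalForm⟩⟩
  obtain ⟨f, ν, H, δ, R, hδ, hδ1, hR, hν, hmass, hH, hg⟩ := hprofile hmP hκP
  obtain ⟨f', ν', H', δ', R', hδ', -, hR', hν', hmass', hH', hg'⟩ := hprofile hmQ hκQ
  have hr : IsCircleFunction fun x => ν' (x + -Real.pi) :=
    ⟨hν'.smooth.comp (contDiff_id.add contDiff_const), fun x => by
      rw [← hν'.periodic (x + -Real.pi)]; congr 1; ring⟩
  exact ⟨min δ δ', _, _, H.gluing H'.reflect (lt_min hδ hδ') (min_lt_of_left_lt hδ1) hR hR' hν hr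
    hmass hmass'.reflect
    (fun X hX => hH X (by linarith [min_le_left δ δ']))
    (fun X hX => hH' (-X) (by
      rw [AngularProfile.toDisc_neg]
      linarith [min_le_right δ δ'])),
    f, _, hg, hg'.isSecondGauge hmQ⟩

/-- The half-trace of any monodromy matrix of the glued potential, by conjugation with the matrix of
the glued exponential basis. -/
theorem IsGluedPotential.halfTrace {δ : ℝ} {μ₁ μ₂ μ : ℝ → ℝ} (h : IsGluedPotential δ μ₁ μ₂ μ)
    {m₁ m₂ κ₁ κ₂ : ℝ} {f₁ f₂ : ℝ → ℝ} (hm₁ : 0 < m₁) (hm₂ : 0 < m₂) (hκ₁ : 1 < κ₁) (hκ₂ : 1 < κ₂)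
    (g₁ : IsFirstGauge m₁ κ₁ f₁ μ₁) (g₂ : IsSecondGauge m₂ κ₂ f₂ μ₂) {χ : ℝ → Fin 2 → ℝ}
    {A : Matrix (Fin 2) (Fin 2) ℝ} (hχ : IsHillBasis μ χ) (hA : IsMonodromy χ A) :
    A.trace / 2 = 2 * κ₁ * κ₂ * Real.cosh (√m₁ * Real.pi) * Real.cosh (√m₂ * Real.pi)
      - Real.cosh (√m₁ * Real.pi - √m₂ * Real.pi) := by
  obtain ⟨ψ, hψ, -, -, hM⟩ := h.exists_glued_exp hm₁ hm₂ hκ₁ hκ₂ g₁ g₂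
  rw [glued_monodromy_eq hm₁ hm₂] at hM
  rw [hχ.monodromy_trace_eq hψ hA hM, Matrix.trace_fin_two_of]
  exact halfTrace_eq _ _ _ _

end

theorem mainTheorem1 :
    -- every Maskit gluing
    (∀ (δ : ℝ) (P : MaskitPiece.{u} 1 δ) (Q : MaskitPiece.{v} (-1) δ)
        (G : MaskitGluing.{u, v, w} P Q),
      -- the conformal boundary of the glued surface and its mass-aspect function
      IsALHEnd G.toRiemannianSurface (max P.R Q.R) G.e G.μ ∧
      -- the monodromy of the glued surface, for pieces of any type
      (∀ (μP μQ fP fQ : ℝ → ℝ) (ψP ψQ : ℝ → Fin 2 → ℝ) (AP AQ : Matrix (Fin 2) (Fin 2) ℝ),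
        IsCircleFunction μP → IsCircleFunction μQ →
        IsCircleDiffeo fP → IsCircleDiffeo fQ →
        (∀ x, massTransform μP fP x = P.μ x) → (∀ x, massTransform μQ fQ x = Q.μ x) →
        IsHillBasis μP ψP → IsHillBasis μQ ψQ →
        IsMonodromy ψP AP → IsMonodromy ψQ AQ →
        ∃ RP RQ : Matrix (Fin 2) (Fin 2) ℝ, RP.det = 1 ∧ RQ.det = 1 ∧
          (∀ x ∈ Set.Icc (-(Real.pi / 2)) (Real.pi / 2),
            hillPull fP ψP x = RP *ᵥ halfAngleBasis x) ∧
          (∀ x ∈ Set.Icc (Real.pi / 2) (3 * Real.pi / 2),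
            hillPull fQ ψQ x = RQ *ᵥ halfAngleBasis x) ∧
          (∃ ψ : ℝ → Fin 2 → ℝ, IsHillBasis G.μ ψ ∧
            (∀ x ∈ Set.Icc (Real.pi / 2) (3 * Real.pi / 2),
              ψ x = RP⁻¹ *ᵥ hillPull fP ψP x) ∧
            (∀ x ∈ Set.Icc (-(Real.pi / 2)) (Real.pi / 2),
              ψ x = RQ⁻¹ *ᵥ hillPull fQ ψQ x) ∧
            IsMonodromy ψ (-((RP⁻¹ * AP * RP) * (RQ⁻¹ * AQ * RQ)))) ∧
          ∀ (ψ : ℝ → Fin 2 → ℝ) (A : Matrix (Fin 2) (Fin 2) ℝ),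
            IsHillBasis G.μ ψ → IsMonodromy ψ A →
            ∃ B : Matrix (Fin 2) (Fin 2) ℝ, B.det = 1 ∧
              A = B⁻¹ * (-((RP⁻¹ * AP * RP) * (RQ⁻¹ * AQ * RQ))) * B) ∧
      -- two pieces of positive mass
      (∀ (mP mQ κP κQ : ℝ) (fP fQ : ℝ → ℝ), 0 < mP → 0 < mQ → 1 < κP → 1 < κQ →
        IsFirstGauge mP κP fP P.μ → IsSecondGauge mQ κQ fQ Q.μ →
        (∃ ψ : ℝ → Fin 2 → ℝ, IsHillBasis G.μ ψ ∧
          (∀ x ∈ Set.Icc (Real.pi / 2) (3 * Real.pi / 2),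
            ψ x = (firstMatrix (gluingConst mP κP))⁻¹ *ᵥ hillPull fP (expBasis mP) x) ∧
          (∀ x ∈ Set.Icc (-(Real.pi / 2)) (Real.pi / 2),
            ψ x = (secondMatrix (gluingConst mQ κQ))⁻¹ *ᵥ hillPull fQ (expBasis mQ) x) ∧
          IsMonodromy ψ
            (-(((firstMatrix (gluingConst mP κP))⁻¹ * expMonodromy mP *
                  firstMatrix (gluingConst mP κP)) *
                ((secondMatrix (gluingConst mQ κQ))⁻¹ * expMonodromy mQ *
                  secondMatrix (gluingConst mQ κQ))))) ∧
        (∀ (ψ : ℝ → Fin 2 → ℝ) (A : Matrix (Fin 2) (Fin 2) ℝ),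
          IsHillBasis G.μ ψ → IsMonodromy ψ A →
          A.trace / 2 =
            2 * κP * κQ * Real.cosh (Real.sqrt mP * Real.pi) * Real.cosh (Real.sqrt mQ * Real.pi)
              - Real.cosh (Real.sqrt mP * Real.pi - Real.sqrt mQ * Real.pi) ∧
          1 < A.trace / 2) ∧
        ∃ mc : ℝ, 0 < mc ∧
          (∃ f : ℝ → ℝ, IsCircleDiffeo f ∧ ∀ x, massTransform G.μ f x = mc) ∧
          (∀ (m : ℝ) (f : ℝ → ℝ), IsCircleDiffeo f → (∀ x, massTransform G.μ f x = m) →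
            m = mc) ∧
          Real.cosh (Real.sqrt mc * Real.pi) =
            2 * κP * κQ * Real.cosh (Real.sqrt mP * Real.pi) * Real.cosh (Real.sqrt mQ * Real.pi)
              - Real.cosh (Real.sqrt mP * Real.pi - Real.sqrt mQ * Real.pi) ∧
          Real.cosh (2 * entropy mc) =
            2 * κP * κQ * Real.cosh (2 * entropy mP) * Real.cosh (2 * entropy mQ)
              - Real.cosh (2 * (entropy mP - entropy mQ)))) ∧
    -- the exponential solutions and their monodromy
    (∀ m : ℝ, 0 < m → IsHillBasis (fun _ => m) (expBasis m) ∧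
      IsMonodromy (expBasis m) (expMonodromy m)) ∧
    -- all values of the masses and of the gluing parameters occur
    (∀ mP mQ κP κQ : ℝ, 0 < mP → 0 < mQ → 1 < κP → 1 < κQ →
      ∃ (δ : ℝ) (P : MaskitPiece.{0} 1 δ) (Q : MaskitPiece.{0} (-1) δ)
        (_ : MaskitGluing.{0, 0, 0} P Q) (fP fQ : ℝ → ℝ),
        IsFirstGauge mP κP fP P.μ ∧ IsSecondGauge mQ κQ fQ Q.μ) := by
  refine ⟨fun δ P Q G => ⟨G.isALHEnd, ?_, ?_⟩,
    fun m hm => ⟨expBasis_isHillBasis hm, expBasis_isMonodromy m⟩,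
    fun mP mQ κP κQ hmP hmQ hκP hκQ => exists_maskitGluing hmP hmQ hκP hκQ⟩
  · intro μP μQ fP fQ ψP ψQ AP AQ _ _ hfP hfQ htP htQ hψP hψQ hAP hAQ
    obtain ⟨RP, RQ, dP, dQ, rP, rQ, ψ, hψ, eP, eQ, hM⟩ := G.isGluedPotential.exists_glued
      ((hψP.hillPull hfP).congr_potential htP) ((hψQ.hillPull hfQ).congr_potential htQ)
      (hAP.hillPull hfP) (hAQ.hillPull hfQ)
    exact ⟨RP, RQ, dP, dQ, rP, rQ, ⟨ψ, hψ, eP, eQ, hM⟩, fun χ A hχ hA =>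
      hχ.monodromy_conj hψ hA hM⟩
  · intro mP mQ κP κQ fP fQ hmP hmQ hκP hκQ gP gQ
    have hG := G.isGluedPotential
    have hx : 0 < √mP * Real.pi := mul_pos (Real.sqrt_pos.2 hmP) Real.pi_pos
    have hy : 0 < √mQ * Real.pi := mul_pos (Real.sqrt_pos.2 hmQ) Real.pi_pos
    refine ⟨hG.exists_glued_exp hmP hmQ hκP hκQ gP gQ, fun ψ A hψ hA => ?_, ?_⟩
    · have ht := hG.halfTrace hmP hmQ hκP hκQ gP gQ hψ hA
      exact ⟨ht, by rw [ht]; exact one_lt_halfTrace hx hy hκP hκQ⟩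
    · obtain ⟨mc, hmc, hf, hcosh⟩ := hG.exists_diffeo_to_const hmP hmQ hκP hκQ gP gQ
      refine ⟨mc, hmc, hf, fun m f hf ht => ?_, hcosh, ?_⟩
      · obtain ⟨ψ, hψ, -, -, hM⟩ := hG.exists_glued_exp hmP hmQ hκP hκQ gP gQ
        exact eq_of_const_halfTrace hmc ((hψ.hillPull hf).congr_potential ht) (hM.hillPull hf)
          ((hG.halfTrace hmP hmQ hκP hκQ gP gQ hψ hM).trans hcosh.symm)
      · rw [two_mul_entropy, two_mul_entropy, two_mul_entropy, mul_sub, two_mul_entropy,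
          two_mul_entropy, hcosh]
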